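/- Let $X$ be a topological space and $R$ a commutative ring. An open hypercover $V_\bullet\to U$ of an open subset $U\subseteq X$ is a simplicial object $V_\bullet$ in formal disjoint unions of open subsets of $U$ such that for every $n\ge 0$ the map from $V_n=\coprod_{\sigma\in I_n}V_\sigma$ to the $n$-th matching object $M_nV$ (formed over $U$, so $M_0V=U$) is an open covering. For a presheaf $F$ on $X$ of (unbounded) cochain complexes of $R$-modules put $F(V_n)=\prod_{\sigma\in I_n}F(V_\sigma)$; then $\operatorname{holim}F(V_\bullet)$ is computed by the product total complex, with $\prod_{p+q=n}F^q(V_p)$ in degree $n$, of the double complex whose horizontal differential is the alternating sum of the coface maps. $F$ is a hypersheaf if $F(U)\to\operatorname{holim}F(V_\bullet)$ is a quasi-isomorphism for every open hypercover $V_\bullet\to U$ of every open $U\subseteq X$. A map of presheaves of complexes is called a weak equivalence if it induces quasi-isomorphisms on all stalks. (1) Let $K$ be a bounded below cochain complex of flabby sheaves of $R$-modules on $X$. Then $K$, i.e. the presheaf of complexes $U\mapsto\Gamma(U,K)$, is a hypersheaf. (2) Consequently the definition of sheaf cohomology in terms of hypersheaves, $H^n(X,F)=H^n(\Gamma(X,F'))$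 for a weak equivalence $i\colon F\to F'$ to a hypersheaf $F'$, agrees with the classical definition $H^n(\Gamma(X,K))$ for a weak equivalence $j\colon F\to K$ to a bounded below complex of flabby sheaves $K$. Precisely, there are isomorphisms of $R$-modules $$e_n\colon H^n(\Gamma(X,F'))\xrightarrow{\ \cong\ }H^n(\Gamma(X,K)),\qquad n\in\mathbb Z,$$ for all presheaves of complexes $F$ and all choices of $i\colon F\to F'$ and $j\colon F\to K$ as above, such that $e_n\circ H^n(\Gamma(X,i))=H^n(\Gamma(X,j))$, and such that $e_n$ is natural: for further data $i_1\colon F_1\to F_1'$, $j_1\colon F_1\to K_1$ of the same kind and maps $f\colon F\to F_1$, $f'\colon F'\to F_1'$, $g\colon K\to K_1$ with $f'\circ i=i_1\circ f$ and $g\circ j=j_1\circ f$, one has $e_n\circ H^n(\Gamma(X,f'))=H^n(\Gamma(X,g))\circ e_n$. -/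

import Mathlib

open CategoryTheory Opposite TopologicalSpace Simplicial

universe u

namespace Hypersheaf

noncomputable section

/-! ### The product total complex of a double complex `D` with columns `p ≥ 0` -/

section ProdTotal

variable {R : Type u} [CommRing R]
  (D : CochainComplex (CochainComplex (ModuleCat.{u} R) ℤ) ℕ)

/-- The degree `n` part `∏_{p + q = n} D^{p,q}`. -/
abbrev ProdTotalX (n : ℤ) : Type u :=
  ∀ i : {i : ℕ × ℤ // (i.1 : ℤ) + i.2 = n}, (D.X i.1.1).X i.1.2

/-- The component in bidegree `(p, q)` of the horizontal part of the total differential. -/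
def prodTotalHoriz (n : ℤ) (p : ℕ) (q : ℤ) (h : (p : ℤ) + q = n + 1) :
    ProdTotalX D n →ₗ[R] (D.X p).X q :=
  match p, h with
  | 0, _ => 0
  | p + 1, h =>
    ((D.d p (p + 1)).f q).hom ∘ₗ
      (LinearMap.proj (⟨(p, q), by push_cast at h ⊢; lia⟩ :
        {i : ℕ × ℤ // (i.1 : ℤ) + i.2 = n}) :
        ProdTotalX D n →ₗ[R] (D.X p).X q)

/-- The component in bidegree `(p, q)` of the vertical part of the total differential,
without sign. -/
def prodTotalVert (n : ℤ) (p : ℕ) (q : ℤ) (h : (p : ℤ) + q = n + 1) :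
    ProdTotalX D n →ₗ[R] (D.X p).X q :=
  ((D.X p).d (q - 1) q).hom ∘ₗ
    (LinearMap.proj (⟨(p, q - 1), by push_cast; lia⟩ :
      {i : ℕ × ℤ // (i.1 : ℤ) + i.2 = n}) :
      ProdTotalX D n →ₗ[R] (D.X p).X (q - 1))

/-- The total differential `d_hor + (-1)^p d_vert`. -/
def prodTotalD (n : ℤ) : ProdTotalX D n →ₗ[R] ProdTotalX D (n + 1) :=
  LinearMap.pi fun i =>
    prodTotalHoriz D n i.1.1 i.1.2 i.2 + (-1 : R) ^ i.1.1 • prodTotalVert D n i.1.1 i.1.2 i.2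

lemma prodTotalD_comp (n : ℤ) (x : ProdTotalX D n) :
    prodTotalD D (n + 1) (prodTotalD D n x) = 0 := by
  have hvv : ∀ (p : ℕ) (q : ℤ) (z : (D.X p).X (q - 1 - 1)),
      ((D.X p).d (q - 1) q).hom (((D.X p).d (q - 1 - 1) (q - 1)).hom z) = 0 := by
    intro p q z
    have := (D.X p).d_comp_d (q - 1 - 1) (q - 1) q
    exact congrArg (fun f => f.hom z) this
  have hhh : ∀ (p : ℕ) (q : ℤ) (z : (D.X p).X q),
      ((D.d (p + 1) (p + 1 + 1)).f q).hom (((D.d p (p + 1)).f q).hom z) = 0 := by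
    intro p q z
    have := congrArg (fun f => f.f q) (D.d_comp_d p (p + 1) (p + 1 + 1))
    exact congrArg (fun f => f.hom z) this
  have hvh : ∀ (p : ℕ) (q : ℤ) (z : (D.X p).X (q - 1)),
      ((D.X (p + 1)).d (q - 1) q).hom (((D.d p (p + 1)).f (q - 1)).hom z) =
        ((D.d p (p + 1)).f q).hom (((D.X p).d (q - 1) q).hom z) := by
    intro p q z
    have := (D.d p (p + 1)).comm (q - 1) q
    exact congrArg (fun f => f.hom z) this
  funext ⟨⟨p, q⟩, h⟩
  rcases p with _ | _ | p
  · simp [prodTotalD, prodTotalHoriz, prodTotalVert, hvv]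
  · simp [prodTotalD, prodTotalHoriz, prodTotalVert, hvv, hvh]
  · simp [prodTotalD, prodTotalHoriz, prodTotalVert, hvv, hvh, hhh, pow_succ]

/-- The product total complex: in degree `n` it is `∏_{p + q = n} D^{p,q}`, and the differential
is `d_hor + (-1)^p d_vert`. -/
def prodTotal : CochainComplex (ModuleCat.{u} R) ℤ :=
  CochainComplex.of (fun n => ModuleCat.of R (ProdTotalX D n))
    (fun n => ModuleCat.ofHom (prodTotalD D n))
    (fun n => ModuleCat.hom_ext (LinearMap.ext fun x => prodTotalD_comp D n x))

/-- The degree `n` part of the map to the total complex given by an augmentation. -/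
def prodTotalAugX {A : CochainComplex (ModuleCat.{u} R) ℤ} (a : A ⟶ D.X 0) (n : ℤ) :
    A.X n →ₗ[R] ProdTotalX D n :=
  LinearMap.pi fun i => match i with
    | ⟨(0, q), h⟩ =>
      ((A.XIsoOfEq (show n = q by simpa using h.symm)).hom ≫ a.f q).hom
    | ⟨(_ + 1, _), _⟩ => 0

lemma prodTotalAugX_comm {A : CochainComplex (ModuleCat.{u} R) ℤ} (a : A ⟶ D.X 0)
    (ha : a ≫ D.d 0 1 = 0) (n : ℤ) (x : A.X n) :
    prodTotalD D n (prodTotalAugX D a n x) = prodTotalAugX D a (n + 1) ((A.d n (n + 1)).hom x) := by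
  have hz : ∀ (q : ℤ) (z : A.X q), ((D.d 0 1).f q).hom ((a.f q).hom z) = 0 := by
    intro q z
    have := congrArg (fun f => f.f q) ha
    exact congrArg (fun f => f.hom z) this
  have hc : ∀ (i j : ℤ) (z : A.X i),
      ((D.X 0).d i j).hom ((a.f i).hom z) = (a.f j).hom ((A.d i j).hom z) := by
    intro i j z
    exact congrArg (fun f => f.hom z) (a.comm i j)
  funext ⟨⟨p, q⟩, h⟩
  rcases p with _ | _ | p
  · obtain rfl : n = q - 1 := by simp at h; lia
    have key : ∀ (m : ℤ) (hm : m = q), ((a.f q).hom ((A.XIsoOfEq hm).hom.hom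
        ((A.d (q - 1) m).hom x))) = (a.f q).hom ((A.d (q - 1) q).hom x) := by
      rintro m rfl
      simp [HomologicalComplex.XIsoOfEq]
    simp only [CharP.cast_eq_zero] at h
    have := key (q - 1 + 1) (by lia)
    simp [prodTotalD, prodTotalHoriz, prodTotalVert, prodTotalAugX, hc, this]
  · simp [prodTotalD, prodTotalHoriz, prodTotalVert, prodTotalAugX, hz]
  · simp [prodTotalD, prodTotalHoriz, prodTotalVert, prodTotalAugX]

/-- The map `A ⟶ prodTotal D` given by an augmentation `a : A ⟶ D^{0,•}`. -/
def prodTotalAug {A : CochainComplex (ModuleCat.{u} R) ℤ} (a : A ⟶ D.X 0)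
    (ha : a ≫ D.d 0 1 = 0) : A ⟶ prodTotal D where
  f n := ModuleCat.ofHom (prodTotalAugX D a n)
  comm' i j hij := by
    obtain rfl : i + 1 = j := hij
    ext x
    simp only [prodTotal, CochainComplex.of_d]
    exact prodTotalAugX_comm D a ha i x

end ProdTotal

/-! ### Open hypercovers -/

/-- An open hypercover `V_• → U` of an open subset `U` of `X`: a simplicial object in the category
of formal disjoint unions of open subsets of `U`, such that for all `n ≥ 0` the map from `V_n` to
the matching object `M_n V` (formed over `U`, so that `M_0 V = U`) is an open covering.

The simplicial object is given by the simplicial set `I` of indices, with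
`V_n = ∐_{σ ∈ I_n} V σ`. The matching object `M_n V` is the disjoint union, over all maps
`b : ∂Δ[n] ⟶ I`, of the intersections of `U` with all `V (b s)`, and the part of `V_n` lying over
the component indexed by `b` is the disjoint union of the `V t`, for the `n`-simplices `t`
with boundary `b`. -/
structure OpenHypercover (X : TopCat.{u}) (U : Opens X) where
  /-- the simplicial set of indices -/
  I : SSet.{u}
  /-- the open subset indexed by a simplex -/
  V : ∀ {n : SimplexCategory}, I.obj (op n) → Opens X
  /-- the component at `σ` of the simplicial structure map given by `θ` -/
  V_le_map : ∀ {m n : SimplexCategory} (θ : m ⟶ n) (σ : I.obj (op n)), V σ ≤ V (I.map θ.op σ)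
  /-- the augmentation to `U` -/
  V_le : ∀ {n : SimplexCategory} (σ : I.obj (op n)), V σ ≤ U
  /-- `V_n → M_n V` is an open covering -/
  covers : ∀ (n : ℕ) (b : (SSet.boundary.{u} n : SSet.{u}) ⟶ I) (x : X), x ∈ U →
    (∀ (m : SimplexCategory) (s : (SSet.boundary.{u} n : SSet.{u}).obj (op m)),
      x ∈ V (b.app (op m) s)) →
    ∃ t : Δ[n] ⟶ I, (SSet.boundary.{u} n).ι ≫ t = b ∧ x ∈ V (SSet.yonedaEquiv t)

variable {X : TopCat.{u}} {R : Type u} [CommRing R]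

/-- Presheaves on `X` with values in (unbounded) cochain complexes of `R`-modules. -/
abbrev PshCh (X : TopCat.{u}) (R : Type u) [CommRing R] :=
  TopCat.Presheaf (CochainComplex (ModuleCat.{u} R) ℤ) X

namespace OpenHypercover

variable {U : Opens X} (H : OpenHypercover X U) (F : PshCh X R)

/-- The value `F(V_n) = ∏_{σ ∈ I_n} F(V σ)`. -/
def evalObj (n : SimplexCategory) : CochainComplex (ModuleCat.{u} R) ℤ where
  X q := ModuleCat.of R (∀ σ : H.I.obj (op n), (F.obj (op (H.V σ))).X q)
  d i j := ModuleCat.ofHom (LinearMap.pi fun σ =>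
    ((F.obj (op (H.V σ))).d i j).hom ∘ₗ LinearMap.proj σ)
  shape i j hij := by
    refine ModuleCat.hom_ext (LinearMap.ext fun x => funext fun σ => ?_)
    exact congrArg (fun f => f.hom (x σ)) ((F.obj (op (H.V σ))).shape i j hij)
  d_comp_d' i j k _ _ := by
    refine ModuleCat.hom_ext (LinearMap.ext fun x => funext fun σ => ?_)
    exact congrArg (fun f => f.hom (x σ)) ((F.obj (op (H.V σ))).d_comp_d i j k)

/-- The map `F(V_m) ⟶ F(V_n)` given by `θ : m ⟶ n`: restriction along
`V σ ≤ V (θ^* σ)` for all `σ ∈ I_n`. -/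
def evalMap {m n : SimplexCategory} (θ : m ⟶ n) : H.evalObj F m ⟶ H.evalObj F n where
  f q := ModuleCat.ofHom (LinearMap.pi fun σ =>
    ((F.map (homOfLE (H.V_le_map θ σ)).op).f q).hom ∘ₗ LinearMap.proj (H.I.map θ.op σ))
  comm' i j _ := by
    ext x
    funext σ
    exact congrArg (fun f => f.hom (x (H.I.map θ.op σ)))
      ((F.map (homOfLE (H.V_le_map θ σ)).op).comm i j)

lemma res_eq {n : SimplexCategory} {q : ℤ}
    (x : ∀ σ : H.I.obj (op n), (F.obj (op (H.V σ))).X q) {W : Opens X}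
    {σ τ : H.I.obj (op n)} (h : σ = τ) (hσ : W ≤ H.V σ) (hτ : W ≤ H.V τ) :
    ((F.map (homOfLE hσ).op).f q).hom (x σ) = ((F.map (homOfLE hτ).op).f q).hom (x τ) := by
  subst h
  rfl

/-- The cosimplicial cochain complex `F(V_•)`. -/
def eval : CosimplicialObject (CochainComplex (ModuleCat.{u} R) ℤ) where
  obj n := H.evalObj F n
  map θ := H.evalMap F θ
  map_id n := by
    ext q x
    funext σ
    refine (H.res_eq F x (by simp) _ le_rfl).trans ?_
    change ((F.map (𝟙 (op (H.V σ)))).f q).hom (x σ) = x σ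
    simp
  map_comp {m n k} θ η := by
    ext q x
    funext σ
    have h := (H.V_le_map η σ).trans (H.V_le_map θ (H.I.map η.op σ))
    refine (H.res_eq F x (τ := H.I.map θ.op (H.I.map η.op σ)) (by simp) _ h).trans ?_
    have : (homOfLE h).op = (homOfLE (H.V_le_map θ (H.I.map η.op σ))).op ≫
      (homOfLE (H.V_le_map η σ)).op := rfl
    rw [this, F.map_comp]
    rfl

/-- The double complex associated to the cosimplicial cochain complex `F(V_•)`, with horizontal
differential the alternating sum of the coface maps. For the Čech nerve of an open cover
this is the Čech double complex. -/
def doubleComplex : CochainComplex (CochainComplex (ModuleCat.{u} R) ℤ) ℕ :=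
  (AlgebraicTopology.alternatingCofaceMapComplex _).obj (H.eval F)

/-- The homotopy limit of `F(V_•)`, computed as the product total complex. -/
def holim : CochainComplex (ModuleCat.{u} R) ℤ :=
  prodTotal (H.doubleComplex F)

/-- The augmentation `F(U) ⟶ F(V_0)`. -/
def augmentation : F.obj (op U) ⟶ (H.doubleComplex F).X 0 where
  f q := ModuleCat.ofHom (LinearMap.pi fun σ => ((F.map (homOfLE (H.V_le σ)).op).f q).hom)
  comm' i j _ := by
    ext x
    funext σ
    exact congrArg (fun f => f.hom x) ((F.map (homOfLE (H.V_le σ)).op).comm i j)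

lemma augmentation_comp_evalMap (θ : ⦋0⦌ ⟶ ⦋1⦌) (q : ℤ) (x : (F.obj (op U)).X q)
    (σ : H.I.obj (op ⦋1⦌)) :
    (show ∀ σ : H.I.obj (op ⦋1⦌), (F.obj (op (H.V σ))).X q from
      ((H.evalMap F θ).f q).hom (((H.augmentation F).f q).hom x)) σ =
        ((F.map (homOfLE (H.V_le σ)).op).f q).hom x := by
  have : (homOfLE (H.V_le σ)).op = (homOfLE (H.V_le (H.I.map θ.op σ))).op ≫
    (homOfLE (H.V_le_map θ σ)).op := rfl
  rw [this, F.map_comp]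
  rfl

lemma augmentation_comp_d : H.augmentation F ≫ (H.doubleComplex F).d 0 1 = 0 := by
  have h : (H.doubleComplex F).d 0 1 =
      (H.evalMap F (SimplexCategory.δ 0) - H.evalMap F (SimplexCategory.δ 1) :
        H.evalObj F ⦋0⦌ ⟶ H.evalObj F ⦋1⦌) := by
    have : (H.doubleComplex F).d 0 1 = AlgebraicTopology.AlternatingCofaceMapComplex.objD
        (H.eval F) 0 :=
      CochainComplex.of_d (fun n => (H.eval F).obj ⦋n⦌)
        (AlgebraicTopology.AlternatingCofaceMapComplex.objD (H.eval F)) 0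
    rw [this, AlgebraicTopology.AlternatingCofaceMapComplex.objD, Fin.sum_univ_two]
    simp only [Fin.val_zero, Fin.val_one, pow_zero, pow_one, one_smul, neg_smul]
    exact (sub_eq_add_neg _ _).symm
  have h' : (H.augmentation F : F.obj (op U) ⟶ H.evalObj F ⦋0⦌) ≫
      H.evalMap F (SimplexCategory.δ 0) =
      (H.augmentation F : F.obj (op U) ⟶ H.evalObj F ⦋0⦌) ≫
      H.evalMap F (SimplexCategory.δ 1) := by
    ext q x
    funext σ
    exact (H.augmentation_comp_evalMap F _ q x σ).trans
      (H.augmentation_comp_evalMap F _ q x σ).symm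
  rw [h]
  exact (Preadditive.comp_sub (P := F.obj (op U)) (Q := H.evalObj F ⦋0⦌) (R := H.evalObj F ⦋1⦌)
    _ _ _).trans (sub_eq_zero.2 h')

/-- The natural map `F(U) ⟶ holim F(V_•)`. -/
def toHolim : F.obj (op U) ⟶ H.holim F :=
  prodTotalAug (H.doubleComplex F) (H.augmentation F) (H.augmentation_comp_d F)

end OpenHypercover

/-- A presheaf of cochain complexes is a hypersheaf if `F(U) ⟶ holim F(V_•)` is a
quasi-isomorphism for every open hypercover `V_• → U` of every open subset `U`. -/
def IsHypersheaf (F : PshCh X R) : Prop :=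
  ∀ (U : Opens X) (H : OpenHypercover X U), QuasiIso (H.toHolim F)

/-- Weak equivalences of presheaves of cochain complexes: the maps inducing quasi-isomorphisms
on all stalks. -/
def IsLocalWeakEquiv {F G : PshCh X R} (f : F ⟶ G) : Prop :=
  ∀ x : X, QuasiIso ((TopCat.Presheaf.stalkFunctor _ x).map f)

/-- The presheaf of cochain complexes `U ↦ Γ(U, K)` underlying a complex of sheaves. -/
def toPshCh (K : CochainComplex (TopCat.Sheaf (ModuleCat.{u} R) X) ℤ) : PshCh X R :=
  (((TopCat.Sheaf.forget (ModuleCat.{u} R) X).mapHomologicalComplex _).obj K).asFunctor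

/-- A bounded below complex of flabby sheaves. -/
structure IsBoundedBelowFlabby (K : CochainComplex (TopCat.Sheaf (ModuleCat.{u} R) X) ℤ) :
    Prop where
  boundedBelow : ∃ n : ℤ, K.IsStrictlyGE n
  flabby : ∀ q : ℤ, (K.X q).IsFlasque

/-- The map induced by `f` on the cohomology of the complexes of global sections. -/
def globalCohomologyMap {F G : PshCh X R} (f : F ⟶ G) (n : ℤ) :
    (F.obj (op ⊤)).homology n ⟶ (G.obj (op ⊤)).homology n :=
  HomologicalComplex.homologyMap (f.app (op ⊤)) n

/-- A presheaf of cochain complexes `F` with a choice of the data computing its cohomology in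
terms of hypersheaves (a weak equivalence `i` to a hypersheaf `F'`; the cohomology
is `H^n(Γ(X, F'))`), and of the data computing it in the classical way (a stalkwise
quasi-isomorphism `j` to a bounded below complex of flabby sheaves `K`; the cohomology is
`H^n(Γ(X, K))`). -/
structure ResolutionPair (X : TopCat.{u}) (R : Type u) [CommRing R] where
  F : PshCh X R
  F' : PshCh X R
  i : F ⟶ F'
  i_weakEquiv : IsLocalWeakEquiv i
  isHypersheaf : IsHypersheaf F'
  K : CochainComplex (TopCat.Sheaf (ModuleCat.{u} R) X) ℤ
  j : F ⟶ toPshCh K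
  j_weakEquiv : IsLocalWeakEquiv j
  isFlabby : IsBoundedBelowFlabby K

/-- The cohomology of `F` according to the definition in terms of hypersheaves. -/
abbrev ResolutionPair.hypersheafCohomology (P : ResolutionPair X R) (n : ℤ) : ModuleCat.{u} R :=
  (P.F'.obj (op ⊤)).homology n

/-- The cohomology of `F` according to the definition in terms of flabby resolutions. -/
abbrev ResolutionPair.flabbyCohomology (P : ResolutionPair X R) (n : ℤ) : ModuleCat.{u} R :=
  ((toPshCh P.K).obj (op ⊤)).homology n

end

end Hypersheaf

open Hypersheaf

/-!
Both parts are proved with explicit total cochains: a cochain of degree `n` of `holim F(V_•)` is a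
family of sections `x_{p,q} σ ∈ F^q(V σ)`, for `p + q = n` and `σ ∈ I_p`.

**Flabby complexes are hypersheaves.** For a single flabby sheaf `A` and a hypercover `V_• → U`, the
row `0 → A(U) → A(V_0) → A(V_1) → ⋯` is exact (`OpenHypercover.exists_rowD_eq`). If `A` is a sheaf
of arbitrary functions `W ↦ ∏_{x ∈ W} T x`, the row is a product over the points `x ∈ U` of the
cochain complexes of the simplicial sets of simplices `σ` with `x ∈ V σ`. The covering condition
allows all boundaries of simplices to be filled in these simplicial sets, so that joining with a
vertex gives a contraction (`OpenHypercover.exists_isCone`). A general flabby sheaf embeds into its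
Godement sheaf with flabby quotient, and the sequence of sections is exact over every open subset,
so exactness in degree `p + 1` for `A` follows from exactness in degree `p` for the quotient. For a
complex which is bounded below, a total cochain of given degree has finitely many nonzero columns,
and these are removed one by one from the right by means of the exactness of the rows
(`OpenHypercover.HasExactRows.exists_totAug_add_totD_eq`).

**Comparison.** Let `i : F → A` and `j : F → B` be weak equivalences to hypersheaves. Classes in
`H^n(A(U))` and `H^n(B(U))` correspond to each other if they come from the same total cocycle with
values in `F` on some hypercover of `U`. This correspondence is linear and natural by construction,
and it is shown to be the graph of an isomorphism (`exists_comparison`). As `B` is a hypersheaf,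
total cocycles with values in `B` come from sections over `U`. What is needed besides is that a
cocycle with values in `A` lifts to `F` on some refinement, and that this lift is unique up to
coboundaries after refinement. Both are instances of
`OpenHypercover.exists_refinement_of_isLocalWeakEquiv`: a total cocycle `z` with values in the
mapping cone `K` of a weak equivalence becomes a coboundary on a refinement. All cocycles of `K` are
locally coboundaries, and the refinement is the universal one. Its `k`-simplices are the
`k`-simplices `σ` of the given hypercover together with a cochain on `Δ^k`, defined on smaller open
subsets, whose coboundary is the restriction of `z`. To extend such a cochain from the boundary of a
simplex, only its value on the top simplex has to be found, and the equation for this value asks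
that a cocycle of `K` be a coboundary near a given point
(`OpenHypercover.TrivializedSimplex.exists_extension`). So the refinement is a hypercover, and it
carries a tautological cochain with coboundary `z`.

The cochains are normalized, i.e. zero on degenerate simplices, since the values at the degenerate
simplices over the top simplex cannot be chosen freely. By means of the Dold–Kan projector, a
normalized coboundary is the coboundary of a normalized cochain (`OpenHypercover.totD_totNorm`).
-/

namespace Hypersheaf

noncomputable section

/-! ### Cohomology classes of elements -/

section CohomologyClasses

variable {R : Type u} [CommRing R] {K L : CochainComplex (ModuleCat.{u} R) ℤ}

/-- The cohomology class of a cocycle. -/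
def cohomologyClass (K : CochainComplex (ModuleCat.{u} R) ℤ) (n : ℤ) (x : K.X n)
    (hx : (K.d n (n + 1)).hom x = 0) : K.homology n :=
  (K.homologyπ n).hom (K.cyclesMk (C := ModuleCat.{u} R) x (n + 1) (by simp) hx)

lemma iCycles_cyclesMk {n : ℤ} (x : K.X n) (hx : (K.d n (n + 1)).hom x = 0) :
    (K.iCycles n).hom (K.cyclesMk (C := ModuleCat.{u} R) x (n + 1) (by simp) hx) = x :=
  K.i_cyclesMk (C := ModuleCat.{u} R) x (n + 1) (by simp) hx

lemma iCycles_injective (n : ℤ) : Function.Injective (K.iCycles n).hom :=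
  (ModuleCat.mono_iff_injective (K.iCycles n)).1 inferInstance

lemma cohomologyClass_surjective {n : ℤ} (u : K.homology n) :
    ∃ (x : K.X n) (hx : (K.d n (n + 1)).hom x = 0), cohomologyClass K n x hx = u := by
  obtain ⟨c, rfl⟩ := (ModuleCat.epi_iff_surjective (K.homologyπ n)).1 inferInstance u
  have hc : (K.d n (n + 1)).hom ((K.iCycles n).hom c) = 0 :=
    congrArg (fun f => f.hom c) (K.iCycles_d n (n + 1))
  refine ⟨(K.iCycles n).hom c, hc, ?_⟩
  exact congrArg (K.homologyπ n).hom (iCycles_injective n (iCycles_cyclesMk _ hc))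

lemma cohomologyClass_eq_zero_iff {m n : ℤ} (hmn : m + 1 = n) (x : K.X n)
    (hx : (K.d n (n + 1)).hom x = 0) :
    cohomologyClass K n x hx = 0 ↔ ∃ w : K.X m, (K.d m n).hom w = x := by
  have hex : (ShortComplex.mk (K.toCycles m n) (K.homologyπ n) (by simp)).Exact :=
    ShortComplex.exact_of_g_is_cokernel _ (K.homologyIsCokernel m n (by simp [← hmn]))
  rw [ShortComplex.moduleCat_exact_iff] at hex
  have hi : ∀ w : K.X m, (K.iCycles n).hom ((K.toCycles m n).hom w) = (K.d m n).hom w :=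
    fun w => congrArg (fun f => f.hom w) (K.toCycles_i m n)
  constructor
  · intro h
    obtain ⟨w, hw⟩ := hex _ h
    refine ⟨w, ?_⟩
    rw [← hi, ← iCycles_cyclesMk x hx]
    exact congrArg _ hw
  · rintro ⟨w, rfl⟩
    have : K.cyclesMk (C := ModuleCat.{u} R) ((K.d m n).hom w) (n + 1) (by simp) hx =
        (K.toCycles m n).hom w :=
      iCycles_injective n ((iCycles_cyclesMk _ hx).trans (hi w).symm)
    exact (congrArg (K.homologyπ n).hom this).trans
      (congrArg (fun f => f.hom w) (K.toCycles_comp_homologyπ m n))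

lemma cohomologyClass_add {n : ℤ} (x y : K.X n) (hx : (K.d n (n + 1)).hom x = 0)
    (hy : (K.d n (n + 1)).hom y = 0) (hxy : (K.d n (n + 1)).hom (x + y) = 0) :
    cohomologyClass K n (x + y) hxy = cohomologyClass K n x hx + cohomologyClass K n y hy := by
  unfold cohomologyClass
  rw [← map_add]
  refine congrArg _ (iCycles_injective n ?_)
  rw [map_add]
  erw [iCycles_cyclesMk, iCycles_cyclesMk, iCycles_cyclesMk]

lemma cohomologyClass_smul {n : ℤ} (r : R) (x : K.X n) (hx : (K.d n (n + 1)).hom x = 0)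
    (hrx : (K.d n (n + 1)).hom (r • x) = 0) :
    cohomologyClass K n (r • x) hrx = r • cohomologyClass K n x hx := by
  unfold cohomologyClass
  rw [← map_smul]
  refine congrArg _ (iCycles_injective n ?_)
  rw [map_smul]
  erw [iCycles_cyclesMk, iCycles_cyclesMk]

lemma hom_comm_apply (φ : K ⟶ L) {i j : ℤ} (x : K.X i) :
    (L.d i j).hom ((φ.f i).hom x) = (φ.f j).hom ((K.d i j).hom x) :=
  congrArg (fun f => f.hom x) (φ.comm i j)

lemma d_d_apply (K : CochainComplex (ModuleCat.{u} R) ℤ) {i j k : ℤ} (x : K.X i) :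
    (K.d j k).hom ((K.d i j).hom x) = 0 :=
  congrArg (fun f => f.hom x) (K.d_comp_d i j k)

lemma homologyMap_cohomologyClass (φ : K ⟶ L) {n : ℤ} (x : K.X n)
    (hx : (K.d n (n + 1)).hom x = 0) (hx' : (L.d n (n + 1)).hom ((φ.f n).hom x) = 0) :
    (HomologicalComplex.homologyMap φ n).hom (cohomologyClass K n x hx) =
      cohomologyClass L n ((φ.f n).hom x) hx' := by
  unfold cohomologyClass
  have h1 := congrArg (fun f => f.hom (K.cyclesMk (C := ModuleCat.{u} R) x (n + 1) (by simp) hx))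
    (HomologicalComplex.homologyπ_naturality φ n)
  refine h1.trans (congrArg (L.homologyπ n).hom (iCycles_injective n ?_))
  refine Eq.trans ?_ (iCycles_cyclesMk _ hx').symm
  have h2 := congrArg (fun f => f.hom (K.cyclesMk (C := ModuleCat.{u} R) x (n + 1) (by simp) hx))
    (HomologicalComplex.cyclesMap_i φ n)
  exact h2.trans (congrArg (φ.f n).hom (iCycles_cyclesMk x hx))

lemma cohomologyClass_eq_iff {m n : ℤ} (hmn : m + 1 = n) (x y : K.X n)
    (hx : (K.d n (n + 1)).hom x = 0) (hy : (K.d n (n + 1)).hom y = 0) :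
    cohomologyClass K n x hx = cohomologyClass K n y hy ↔
      ∃ w : K.X m, (K.d m n).hom w = x - y := by
  have hy' : (K.d n (n + 1)).hom ((-1 : R) • y) = 0 := by rw [map_smul, hy, smul_zero]
  have hxy : (K.d n (n + 1)).hom (x + (-1 : R) • y) = 0 := by rw [map_add, hx, hy', add_zero]
  have e : cohomologyClass K n (x + (-1 : R) • y) hxy =
      cohomologyClass K n x hx - cohomologyClass K n y hy := by
    rw [cohomologyClass_add x _ hx hy', cohomologyClass_smul _ _ hy, neg_one_smul, sub_eq_add_neg]
  rw [← sub_eq_zero, ← e, cohomologyClass_eq_zero_iff hmn]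
  simp only [neg_one_smul, sub_eq_add_neg]

/-- A morphism of complexes of modules is a quasi-isomorphism if and only if it is injective and
surjective on cohomology, expressed in terms of cocycles and coboundaries. -/
lemma quasiIso_iff_elementwise (φ : K ⟶ L) :
    QuasiIso φ ↔ ∀ m n : ℤ, m + 1 = n →
      (∀ x : K.X n, (K.d n (n + 1)).hom x = 0 → (∃ w : L.X m, (L.d m n).hom w = (φ.f n).hom x) →
        ∃ w : K.X m, (K.d m n).hom w = x) ∧
      (∀ y : L.X n, (L.d n (n + 1)).hom y = 0 → ∃ x : K.X n, (K.d n (n + 1)).hom x = 0 ∧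
        ∃ w : L.X m, (L.d m n).hom w = (φ.f n).hom x - y) := by
  have key : ∀ n : ℤ, QuasiIsoAt φ n ↔
      Function.Bijective (HomologicalComplex.homologyMap φ n).hom := by
    intro n
    rw [quasiIsoAt_iff_isIso_homologyMap]
    exact ConcreteCategory.isIso_iff_bijective _
  have hφ : ∀ {n : ℤ} (x : K.X n), (K.d n (n + 1)).hom x = 0 →
      (L.d n (n + 1)).hom ((φ.f n).hom x) = 0 := by
    intro n x hx
    rw [hom_comm_apply, hx, map_zero]
  rw [quasiIso_iff]
  constructor
  · rintro h m n hmn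
    obtain ⟨hi, hs⟩ := (key n).1 (h n)
    refine ⟨fun x hx hw => ?_, fun y hy => ?_⟩
    · rw [← cohomologyClass_eq_zero_iff hmn x hx]
      apply hi
      rw [homologyMap_cohomologyClass φ x hx (hφ x hx), map_zero]
      exact (cohomologyClass_eq_zero_iff hmn _ _).2 hw
    · obtain ⟨u, hu⟩ := hs (cohomologyClass L n y hy)
      obtain ⟨x, hx, rfl⟩ := cohomologyClass_surjective u
      rw [homologyMap_cohomologyClass φ x hx (hφ x hx)] at hu
      exact ⟨x, hx, (cohomologyClass_eq_iff hmn _ _ _ _).1 hu⟩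
  · intro h n
    rw [key]
    obtain ⟨hi, hs⟩ := h (n - 1) n (by lia)
    constructor
    · rw [injective_iff_map_eq_zero]
      intro u hu
      obtain ⟨x, hx, rfl⟩ := cohomologyClass_surjective u
      rw [homologyMap_cohomologyClass φ x hx (hφ x hx)] at hu
      rw [cohomologyClass_eq_zero_iff (m := n - 1) (by lia)] at hu ⊢
      exact hi x hx hu
    · intro v
      obtain ⟨y, hy, rfl⟩ := cohomologyClass_surjective v
      obtain ⟨x, hx, hw⟩ := hs y hy
      refine ⟨cohomologyClass K n x hx, ?_⟩
      rw [homologyMap_cohomologyClass φ x hx (hφ x hx)]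
      exact (cohomologyClass_eq_iff (by lia) _ _ _ _).2 hw

end CohomologyClasses

variable {X : TopCat.{u}} {R : Type u} [CommRing R]

/-! ### Sections of presheaves of complexes -/

section Sections

/-- The module of degree `q` sections of `F` over `W`. -/
abbrev Sec (F : PshCh X R) (q : ℤ) (W : Opens X) : Type u := (F.obj (op W)).X q

variable (F : PshCh X R) {G : PshCh X R} (f : F ⟶ G) {q : ℤ}

/-- Restriction of sections. -/
def res {W' W : Opens X} (h : W' ≤ W) : Sec F q W →ₗ[R] Sec F q W' :=
  ((F.map (homOfLE h).op).f q).hom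

/-- The differential on sections. -/
def secD (q q' : ℤ) (W : Opens X) : Sec F q W →ₗ[R] Sec F q' W :=
  ((F.obj (op W)).d q q').hom

variable {F} in
/-- The map on sections induced by a morphism of presheaves of complexes. -/
def secMap (q : ℤ) (W : Opens X) : Sec F q W →ₗ[R] Sec G q W :=
  ((f.app (op W)).f q).hom

@[simp]
lemma res_self {W : Opens X} (h : W ≤ W) (x : Sec F q W) : res F h x = x := by
  change ((F.map (𝟙 (op W))).f q).hom x = x
  simp

@[simp]
lemma res_res {W'' W' W : Opens X} (h' : W'' ≤ W') (h : W' ≤ W) (x : Sec F q W) :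
    res F h' (res F h x) = res F (h'.trans h) x := by
  have : (homOfLE (h'.trans h)).op = (homOfLE h).op ≫ (homOfLE h').op := rfl
  unfold res
  rw [this, F.map_comp]
  rfl

lemma secD_res {W' W : Opens X} (h : W' ≤ W) (q' : ℤ) (x : Sec F q W) :
    secD F q q' W' (res F h x) = res F h (secD F q q' W x) :=
  hom_comm_apply (F.map (homOfLE h).op) x

@[simp]
lemma secD_secD (q' q'' : ℤ) {W : Opens X} (x : Sec F q W) :
    secD F q' q'' W (secD F q q' W x) = 0 :=
  d_d_apply _ x

lemma secD_secMap (q' : ℤ) {W : Opens X} (x : Sec F q W) :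
    secD G q q' W (secMap f q W x) = secMap f q' W (secD F q q' W x) :=
  hom_comm_apply (f.app (op W)) x

lemma secMap_res {W' W : Opens X} (h : W' ≤ W) (x : Sec F q W) :
    secMap f q W' (res F h x) = res G h (secMap f q W x) :=
  congrArg (fun g => (g.f q).hom x) (f.naturality (homOfLE h).op)

end Sections

/-! ### Stalks of presheaves of complexes -/

section Stalks

variable (F : PshCh X R) {G : PshCh X R} (f : F ⟶ G) {q : ℤ}

/-- The germ at `x` of a section of degree `q`. -/
def secGerm (q : ℤ) {W : Opens X} {x : X} (hx : x ∈ W) :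
    Sec F q W →ₗ[R] (TopCat.Presheaf.stalk F x).X q :=
  ((F.germ W x hx).f q).hom

lemma secGerm_res {W' W : Opens X} (h : W' ≤ W) {x : X} (hx : x ∈ W') (s : Sec F q W) :
    secGerm F q hx (res F h s) = secGerm F q (h hx) s :=
  congrArg (fun g => (g.f q).hom s) (F.germ_res (homOfLE h) x hx)

lemma d_secGerm (q' : ℤ) {W : Opens X} {x : X} (hx : x ∈ W) (s : Sec F q W) :
    ((TopCat.Presheaf.stalk F x).d q q').hom (secGerm F q hx s) =
      secGerm F q' hx (secD F q q' W s) :=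
  hom_comm_apply (F.germ W x hx) s

lemma stalkMap_secGerm {W : Opens X} {x : X} (hx : x ∈ W) (s : Sec F q W) :
    (((TopCat.Presheaf.stalkFunctor _ x).map f).f q).hom (secGerm F q hx s) =
      secGerm G q hx (secMap f q W s) :=
  congrArg (fun g => (g.f q).hom s) (TopCat.Presheaf.stalkFunctor_map_germ W x hx f)

lemma exists_secGerm_eq {x : X} (t : (TopCat.Presheaf.stalk F x).X q) :
    ∃ (W : Opens X) (hx : x ∈ W) (s : Sec F q W), secGerm F q hx s = t := by
  let Φ := HomologicalComplex.eval (ModuleCat.{u} R) (ComplexShape.up ℤ) q ⋙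
    forget (ModuleCat.{u} R)
  obtain ⟨W, s, hs⟩ := Limits.Types.jointly_surjective_of_isColimit
    (Limits.isColimitOfPreserves Φ
      (Limits.colimit.isColimit ((OpenNhds.inclusion x).op ⋙ F))) t
  exact ⟨W.unop.1, W.unop.2, s, hs⟩

lemma exists_res_eq_of_secGerm_eq {x : X} {U V : Opens X} (hU : x ∈ U) (hV : x ∈ V)
    (s : Sec F q U) (t : Sec F q V) (h : secGerm F q hU s = secGerm F q hV t) :
    ∃ (W : Opens X) (_ : x ∈ W) (hWU : W ≤ U) (hWV : W ≤ V), res F hWU s = res F hWV t := by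
  let Φ := HomologicalComplex.eval (ModuleCat.{u} R) (ComplexShape.up ℤ) q ⋙
    forget (ModuleCat.{u} R)
  obtain ⟨W, iU, iV, e⟩ := (Limits.Types.FilteredColimit.isColimit_eq_iff _
    (Limits.isColimitOfPreserves Φ
      (Limits.colimit.isColimit ((OpenNhds.inclusion x).op ⋙ F)))
    (i := op ⟨U, hU⟩) (j := op ⟨V, hV⟩) (xi := s) (xj := t)).1 h
  exact ⟨W.unop.1, W.unop.2, leOfHom iU.unop, leOfHom iV.unop, e⟩

variable {F} in
/-- A weak equivalence is locally acyclic: the cocycles of its mapping cone are locally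
coboundaries. -/
lemma IsLocalWeakEquiv.locally_exact {f : F ⟶ G} (hf : IsLocalWeakEquiv f) {q₀ q₁ q₂ : ℤ}
    (h₀ : q₀ + 1 = q₁) (h₁ : q₁ + 1 = q₂) {W : Opens X} {x : X} (hx : x ∈ W)
    (b : Sec F q₂ W) (c : Sec G q₁ W) (hb : secD F q₂ (q₂ + 1) W b = 0)
    (hbc : secMap f q₂ W b = secD G q₁ q₂ W c) :
    ∃ (W' : Opens X) (_ : x ∈ W') (h : W' ≤ W) (a : Sec F q₁ W') (e : Sec G q₀ W'),
      secD F q₁ q₂ W' a = res F h b ∧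
        secMap f q₁ W' a - res G h c = secD G q₀ q₁ W' e := by
  have hq := (quasiIso_iff_elementwise _).1 (hf x)
  -- injectivity on cohomology in degree `q₂` makes `b` a coboundary `d a₀` near `x`
  obtain ⟨w, hw⟩ := (hq q₁ q₂ h₁).1 (secGerm F q₂ hx b)
    ((d_secGerm F _ hx b).trans (by rw [hb]; exact map_zero _))
    ⟨secGerm G q₁ hx c, by
      refine (d_secGerm G _ hx c).trans ?_
      rw [← hbc]
      exact (stalkMap_secGerm F f hx b).symm⟩
  obtain ⟨W₁, hx₁, a₀, rfl⟩ := exists_secGerm_eq F w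
  obtain ⟨W₂, hx₂, h₂₁, h₂, e₂⟩ := exists_res_eq_of_secGerm_eq F hx₁ hx _ _
    ((d_secGerm F _ hx₁ a₀).symm.trans hw)
  -- surjectivity in degree `q₁` handles the cocycle `f a₀ - c`
  subst h₁
  have hcoc : secD G q₁ (q₁ + 1) W₂ (secMap f q₁ W₂ (res F h₂₁ a₀) - res G h₂ c) = 0 := by
    rw [map_sub, secD_secMap, secD_res, secD_res, e₂, ← hbc, secMap_res, sub_self]
  obtain ⟨w₁, hw₁, w₀, hw₀⟩ := (hq q₀ q₁ h₀).2
    (secGerm G q₁ hx₂ (secMap f q₁ W₂ (res F h₂₁ a₀) - res G h₂ c))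
    ((d_secGerm G _ hx₂ _).trans (by rw [hcoc]; exact map_zero _))
  obtain ⟨W₃, hx₃, a₁, rfl⟩ := exists_secGerm_eq F w₁
  obtain ⟨W₄, hx₄, e₀, rfl⟩ := exists_secGerm_eq G w₀
  obtain ⟨W₅, hx₅, h₅₃, h₅, e₅⟩ := exists_res_eq_of_secGerm_eq F hx₃ hx₃
    (secD F q₁ (q₁ + 1) W₃ a₁) 0 (by
      rw [map_zero]; exact (d_secGerm F _ hx₃ a₁).symm.trans hw₁)
  let V := W₂ ⊓ W₄ ⊓ W₅
  have hV : x ∈ V := ⟨⟨hx₂, hx₄⟩, hx₅⟩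
  have hV₂ : V ≤ W₂ := inf_le_left.trans inf_le_left
  have hV₄ : V ≤ W₄ := inf_le_left.trans inf_le_right
  have hV₃ : V ≤ W₃ := (inf_le_right : V ≤ W₅).trans h₅₃
  obtain ⟨W₆, hx₆, h₆, h₆', e₆⟩ := exists_res_eq_of_secGerm_eq G hV hV
    (secD G q₀ q₁ V (res G hV₄ e₀))
    (secMap f q₁ V (res F hV₃ a₁) -
      res G hV₂ (secMap f q₁ W₂ (res F h₂₁ a₀) - res G h₂ c)) (by
    rw [secD_res, secGerm_res, map_sub, secGerm_res, secMap_res, secGerm_res]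
    exact (d_secGerm G _ hx₄ e₀).symm.trans (hw₀.trans (by rw [← stalkMap_secGerm]; rfl)))
  refine ⟨W₆, hx₆, (h₆.trans hV₂).trans h₂,
    res F ((h₆.trans hV₂).trans h₂₁) a₀ - res F (h₆.trans hV₃) a₁,
    - res G (h₆.trans hV₄) e₀, ?_, ?_⟩
  · have e₅' := congrArg (res F ((h₆.trans (inf_le_right : V ≤ W₅)))) e₅
    rw [map_zero, map_zero, res_res] at e₅'
    have e₂' := congrArg (res F (h₆.trans hV₂)) e₂
    rw [res_res, res_res] at e₂'
    rw [map_sub, secD_res, secD_res, e₅', sub_zero, e₂']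
  · rw [secD_res, map_sub, map_sub, res_res, res_res, ← secMap_res, ← secMap_res, res_res,
      res_res] at e₆
    rw [map_neg, secD_res, e₆, map_sub, map_sub, res_res, ← secMap_res, res_res]
    abel

end Stalks

/-! ### Total cochains on a hypercover -/

namespace OpenHypercover

variable {U : Opens X} (H : OpenHypercover X U) (F : PshCh X R) {G : PshCh X R}

/-- The `i`-th face of an index. -/
abbrev face {p : ℕ} (i : Fin (p + 2)) (σ : H.I.obj (op ⦋p + 1⦌)) : H.I.obj (op ⦋p⦌) :=
  H.I.map (SimplexCategory.δ i).op σ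

/-- The `j`-th degeneracy of an index. -/
abbrev degen {p : ℕ} (j : Fin (p + 1)) (σ : H.I.obj (op ⦋p⦌)) : H.I.obj (op ⦋p + 1⦌) :=
  H.I.map (SimplexCategory.σ j).op σ

/-- The degree `n` part of the total complex `holim F(V_•)`. -/
abbrev Tot (n : ℤ) : Type u := ProdTotalX (H.doubleComplex F) n

/-- The differential of the total complex. -/
abbrev totD (n : ℤ) : H.Tot F n →ₗ[R] H.Tot F (n + 1) := prodTotalD (H.doubleComplex F) n

/-- The augmentation from the sections over `U` to the total complex. -/
abbrev totAug (n : ℤ) : Sec F n U →ₗ[R] H.Tot F n :=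
  prodTotalAugX (H.doubleComplex F) (H.augmentation F) n

variable {H F}

/-- The component of bidegree `(p, q)` of a total cochain, as a function on the `p`-simplices. -/
def totApp {n : ℤ} (x : H.Tot F n) (p : ℕ) (q : ℤ) (h : p + q = n) (σ : H.I.obj (op ⦋p⦌)) :
    Sec F q (H.V σ) :=
  (show ∀ σ : H.I.obj (op ⦋p⦌), Sec F q (H.V σ) from x ⟨(p, q), h⟩) σ

/-- The total cochain with given components. -/
def totMk {n : ℤ} (x : ∀ (p : ℕ) (q : ℤ) (_ : p + q = n) (σ : H.I.obj (op ⦋p⦌)),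
    Sec F q (H.V σ)) : H.Tot F n :=
  fun i => (show ∀ σ : H.I.obj (op ⦋i.1.1⦌), Sec F i.1.2 (H.V σ) from x i.1.1 i.1.2 i.2)

@[simp]
lemma totApp_totMk {n : ℤ} (x : ∀ (p : ℕ) (q : ℤ) (_ : p + q = n) (σ : H.I.obj (op ⦋p⦌)),
    Sec F q (H.V σ)) (p : ℕ) (q : ℤ) (h : p + q = n) (σ : H.I.obj (op ⦋p⦌)) :
    totApp (totMk x) p q h σ = x p q h σ := rfl

lemma tot_ext {n : ℤ} {x y : H.Tot F n} (h : ∀ p q h σ, totApp x p q h σ = totApp y p q h σ) :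
    x = y := by
  funext ⟨⟨p, q⟩, hpq⟩
  exact funext (h p q hpq)

@[simp]
lemma totApp_add {n : ℤ} (x y : H.Tot F n) (p : ℕ) (q : ℤ) (h : p + q = n)
    (σ : H.I.obj (op ⦋p⦌)) : totApp (x + y) p q h σ = totApp x p q h σ + totApp y p q h σ := rfl

@[simp]
lemma totApp_sub {n : ℤ} (x y : H.Tot F n) (p : ℕ) (q : ℤ) (h : p + q = n)
    (σ : H.I.obj (op ⦋p⦌)) : totApp (x - y) p q h σ = totApp x p q h σ - totApp y p q h σ := rfl

@[simp]
lemma totApp_smul {n : ℤ} (r : R) (x : H.Tot F n) (p : ℕ) (q : ℤ) (h : p + q = n)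
    (σ : H.I.obj (op ⦋p⦌)) : totApp (r • x) p q h σ = r • totApp x p q h σ := rfl

@[simp]
lemma totApp_zero {n : ℤ} (p : ℕ) (q : ℤ) (h : p + q = n)
    (σ : H.I.obj (op ⦋p⦌)) : totApp (0 : H.Tot F n) p q h σ = 0 := rfl

lemma res_congr {p : SimplexCategory} {q : ℤ} (x : ∀ σ : H.I.obj (op p), Sec F q (H.V σ))
    {W : Opens X} {σ τ : H.I.obj (op p)} (h : σ = τ) (hσ : W ≤ H.V σ) (hτ : W ≤ H.V τ) :
    res F hσ (x σ) = res F hτ (x τ) := by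
  subst h
  rfl

lemma alternatingSum_f_apply {k : ℕ} {A B : CochainComplex (ModuleCat.{u} R) ℤ}
    (φ : Fin k → (A ⟶ B)) (q : ℤ) (x : A.X q) :
    ((∑ i : Fin k, (-1 : ℤ) ^ (i : ℕ) • φ i).f q).hom x =
      ∑ i : Fin k, (-1 : ℤ) ^ (i : ℕ) • ((φ i).f q).hom x := by
  have h := (HomologicalComplex.eval (ModuleCat.{u} R) (ComplexShape.up ℤ) q).map_sum
    (fun i : Fin k => (-1 : ℤ) ^ (i : ℕ) • φ i) Finset.univ
  refine (congrArg (fun g => g.hom x) h).trans ?_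
  rw [ModuleCat.hom_sum]
  exact LinearMap.sum_apply _ _ _

lemma doubleComplex_d_apply (p : ℕ) (q : ℤ) (x : ∀ σ : H.I.obj (op ⦋p⦌), Sec F q (H.V σ))
    (σ : H.I.obj (op ⦋p + 1⦌)) :
    (show ∀ σ : H.I.obj (op ⦋p + 1⦌), Sec F q (H.V σ) from
      (((H.doubleComplex F).d p (p + 1)).f q).hom x) σ =
      ∑ i : Fin (p + 2), (-1 : ℤ) ^ (i : ℕ) •
        res F (H.V_le_map (SimplexCategory.δ i) σ) (x (H.face i σ)) := by
  have h : (H.doubleComplex F).d p (p + 1) =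
      AlgebraicTopology.AlternatingCofaceMapComplex.objD (H.eval F) p :=
    CochainComplex.of_d (fun n => (H.eval F).obj ⦋n⦌)
      (AlgebraicTopology.AlternatingCofaceMapComplex.objD (H.eval F)) p
  rw [h]
  refine (congrFun (alternatingSum_f_apply (fun i : Fin (p + 2) => (H.eval F).δ i) q x) σ).trans ?_
  exact (Finset.sum_apply σ Finset.univ _).trans (Finset.sum_congr rfl fun i _ => rfl)

lemma totApp_totD_zero {n : ℤ} (x : H.Tot F n) {q q' : ℤ} (hq : q' + 1 = q)
    (h : ((0 : ℕ) : ℤ) + q = n + 1) (h' : ((0 : ℕ) : ℤ) + q' = n) (σ : H.I.obj (op ⦋0⦌)) :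
    totApp (H.totD F n x) 0 q h σ = secD F q' q _ (totApp x 0 q' h' σ) := by
  obtain rfl : q' = q - 1 := by lia
  change (show ∀ σ : H.I.obj (op ⦋0⦌), Sec F q (H.V σ) from
    prodTotalD (H.doubleComplex F) n x ⟨(0, q), h⟩) σ = _
  have : prodTotalD (H.doubleComplex F) n x ⟨(0, q), h⟩ =
      (((H.doubleComplex F).X 0).d (q - 1) q).hom (x ⟨(0, q - 1), h'⟩) := by
    simp [prodTotalD, prodTotalHoriz, prodTotalVert]
  rw [this]
  rfl

lemma totApp_totD_succ {n : ℤ} (x : H.Tot F n) (p : ℕ) {q q' : ℤ} (hq : q' + 1 = q)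
    (h : ((p + 1 : ℕ) : ℤ) + q = n + 1) (h' : ((p + 1 : ℕ) : ℤ) + q' = n)
    (h'' : (p : ℤ) + q = n) (σ : H.I.obj (op ⦋p + 1⦌)) :
    totApp (H.totD F n x) (p + 1) q h σ =
      ∑ i : Fin (p + 2), (-1 : ℤ) ^ (i : ℕ) •
        res F (H.V_le_map (SimplexCategory.δ i) σ) (totApp x p q h'' (H.face i σ)) +
      (-1 : ℤ) ^ (p + 1) • secD F q' q _ (totApp x (p + 1) q' h' σ) := by
  obtain rfl : q' = q - 1 := by lia
  change (show ∀ σ : H.I.obj (op ⦋p + 1⦌), Sec F q (H.V σ) from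
    prodTotalD (H.doubleComplex F) n x ⟨(p + 1, q), h⟩) σ = _
  have : prodTotalD (H.doubleComplex F) n x ⟨(p + 1, q), h⟩ =
      (((H.doubleComplex F).d p (p + 1)).f q).hom (x ⟨(p, q), h''⟩) +
      (-1 : R) ^ (p + 1) • (((H.doubleComplex F).X (p + 1)).d (q - 1) q).hom
        (x ⟨(p + 1, q - 1), h'⟩) := by
    simp [prodTotalD, prodTotalHoriz, prodTotalVert]
  rw [this, ← doubleComplex_d_apply (F := F) p q (totApp x p q h'') σ]
  have e : ((-1 : R) ^ (p + 1)) = (((-1 : ℤ) ^ (p + 1) : ℤ) : R) := by simp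
  rw [e, Int.cast_smul_eq_zsmul]
  rfl

lemma totApp_totAug_zero {n : ℤ} (x : Sec F n U) (h : ((0 : ℕ) : ℤ) + n = n)
    (σ : H.I.obj (op ⦋0⦌)) : totApp (H.totAug F n x) 0 n h σ = res F (H.V_le σ) x := by
  change (show ∀ σ : H.I.obj (op ⦋0⦌), Sec F n (H.V σ) from
    prodTotalAugX (H.doubleComplex F) (H.augmentation F) n x ⟨(0, n), h⟩) σ = _
  have : prodTotalAugX (H.doubleComplex F) (H.augmentation F) n x ⟨(0, n), h⟩ =
      ((H.augmentation F).f n).hom x := by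
    simp [prodTotalAugX]
  rw [this]
  rfl

lemma totApp_totAug_succ {n : ℤ} (x : Sec F n U) (p : ℕ) (q : ℤ)
    (h : ((p + 1 : ℕ) : ℤ) + q = n) (σ : H.I.obj (op ⦋p + 1⦌)) :
    totApp (H.totAug F n x) (p + 1) q h σ = 0 := rfl

lemma totD_totD {n : ℤ} (x : H.Tot F n) : H.totD F (n + 1) (H.totD F n x) = 0 :=
  prodTotalD_comp _ n x

lemma totD_totAug {n : ℤ} (x : Sec F n U) :
    H.totD F n (H.totAug F n x) = H.totAug F (n + 1) (secD F n (n + 1) U x) :=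
  prodTotalAugX_comm _ _ (H.augmentation_comp_d F) n x

variable (H F) in
/-- The map to the homotopy limit is a quasi-isomorphism if and only if it is injective and
surjective on cohomology. -/
lemma quasiIso_toHolim_iff :
    QuasiIso (H.toHolim F) ↔ ∀ m : ℤ,
      (∀ x : Sec F (m + 1) U, secD F (m + 1) (m + 1 + 1) U x = 0 →
        (∃ w : H.Tot F m, H.totD F m w = H.totAug F (m + 1) x) →
          ∃ w : Sec F m U, secD F m (m + 1) U w = x) ∧
      (∀ y : H.Tot F (m + 1), H.totD F (m + 1) y = 0 →
        ∃ x : Sec F (m + 1) U, secD F (m + 1) (m + 1 + 1) U x = 0 ∧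
          ∃ w : H.Tot F m, H.totD F m w = H.totAug F (m + 1) x - y) := by
  have hd : ∀ n : ℤ, ((H.holim F).d n (n + 1)) = ModuleCat.ofHom (H.totD F n) := fun n =>
    CochainComplex.of_d (fun n => ModuleCat.of R (ProdTotalX (H.doubleComplex F) n))
      (fun n => ModuleCat.ofHom (prodTotalD (H.doubleComplex F) n)) n
  rw [quasiIso_iff_elementwise]
  constructor
  · intro h m
    obtain ⟨h1, h2⟩ := h m (m + 1) rfl
    rw [hd] at h1 h2
    rw [hd] at h2
    exact ⟨h1, h2⟩
  · rintro h m _ rfl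
    rw [hd, hd]
    exact h m

end OpenHypercover

/-! ### Functoriality of total cochains -/

namespace OpenHypercover

variable {U : Opens X} {H H' H'' : OpenHypercover X U} {F G : PshCh X R}

/-- The map on total cochains induced by a morphism of presheaves of complexes. -/
def totMap (H : OpenHypercover X U) (f : F ⟶ G) (n : ℤ) : H.Tot F n →ₗ[R] H.Tot G n where
  toFun x := totMk fun p q h σ => secMap f q _ (totApp x p q h σ)
  map_add' x y := tot_ext fun p q h σ => by simp
  map_smul' r x := tot_ext fun p q h σ => by simp

@[simp]
lemma totApp_totMap (f : F ⟶ G) {n : ℤ} (x : H.Tot F n) (p : ℕ) (q : ℤ) (h : p + q = n)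
    (σ : H.I.obj (op ⦋p⦌)) :
    totApp (H.totMap f n x) p q h σ = secMap f q _ (totApp x p q h σ) := rfl

lemma totD_totMap (f : F ⟶ G) {n : ℤ} (x : H.Tot F n) :
    H.totD G n (H.totMap f n x) = H.totMap f (n + 1) (H.totD F n x) := by
  refine tot_ext fun p q h σ => ?_
  rcases p with _ | p
  · rw [totApp_totD_zero _ (show q - 1 + 1 = q by lia) _ (by lia), totApp_totMap, totApp_totMap,
      totApp_totD_zero _ (show q - 1 + 1 = q by lia) _ (by lia), secD_secMap]
  · rw [totApp_totD_succ _ p (show q - 1 + 1 = q by lia) _ (by lia) (by push_cast at h; lia),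
      totApp_totMap, totApp_totMap,
      totApp_totD_succ _ p (show q - 1 + 1 = q by lia) _ (by lia) (by push_cast at h; lia),
      secD_secMap]
    simp [secMap_res]

lemma totMap_totAug (f : F ⟶ G) {n : ℤ} (x : Sec F n U) :
    H.totMap f n (H.totAug F n x) = H.totAug G n (secMap f n U x) := by
  refine tot_ext fun p q h σ => ?_
  rcases p with _ | p
  · obtain rfl : q = n := by simpa using h
    rw [totApp_totMap, totApp_totAug_zero, totApp_totAug_zero, secMap_res]
  · rw [totApp_totMap, totApp_totAug_succ, totApp_totAug_succ, map_zero]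

lemma totMap_comp {K : PshCh X R} (f : F ⟶ G) (g : G ⟶ K) (n : ℤ) (x : H.Tot F n) :
    H.totMap (f ≫ g) n x = H.totMap g n (H.totMap f n x) := rfl

/-- A refinement `H' → H` of open hypercovers of `U`: a simplicial map `V'_• → V_•` over `U`. -/
structure Refinement (H' H : OpenHypercover X U) where
  /-- the map on indices -/
  map : H'.I ⟶ H.I
  le : ∀ {n : SimplexCategory} (σ : H'.I.obj (op n)), H'.V σ ≤ H.V (map.app (op n) σ)

namespace Refinement

variable (r : Refinement H' H)

/-- The pullback of total cochains along a refinement. -/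
def pull (F : PshCh X R) (n : ℤ) : H.Tot F n →ₗ[R] H'.Tot F n where
  toFun x := totMk fun p q h σ => res F (r.le σ) (totApp x p q h (r.map.app (op ⦋p⦌) σ))
  map_add' x y := tot_ext fun p q h σ => by simp
  map_smul' r x := tot_ext fun p q h σ => by simp

@[simp]
lemma totApp_pull {n : ℤ} (x : H.Tot F n) (p : ℕ) (q : ℤ) (h : p + q = n)
    (σ : H'.I.obj (op ⦋p⦌)) :
    totApp (r.pull F n x) p q h σ = res F (r.le σ) (totApp x p q h (r.map.app (op ⦋p⦌) σ)) := rfl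

lemma map_map {m n : SimplexCategory} (θ : m ⟶ n) (σ : H'.I.obj (op n)) :
    r.map.app (op m) (H'.I.map θ.op σ) = H.I.map θ.op (r.map.app (op n) σ) :=
  NatTrans.naturality_apply r.map θ.op σ

lemma totD_pull {n : ℤ} (x : H.Tot F n) :
    H'.totD F n (r.pull F n x) = r.pull F (n + 1) (H.totD F n x) := by
  refine tot_ext fun p q h σ => ?_
  rcases p with _ | p
  · rw [totApp_totD_zero _ (show q - 1 + 1 = q by lia) _ (by lia), totApp_pull, totApp_pull,
      totApp_totD_zero _ (show q - 1 + 1 = q by lia) _ (by lia), secD_res]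
  · rw [totApp_totD_succ _ p (show q - 1 + 1 = q by lia) _ (by lia) (by push_cast at h; lia),
      totApp_pull, totApp_pull,
      totApp_totD_succ _ p (show q - 1 + 1 = q by lia) _ (by lia) (by push_cast at h; lia),
      secD_res]
    simp only [map_add, map_sum, map_zsmul, totApp_pull, res_res]
    congr 1
    refine Finset.sum_congr rfl fun i _ => congrArg _ ?_
    exact res_congr _ (r.map_map _ _) _ _

lemma pull_totAug {n : ℤ} (x : Sec F n U) :
    r.pull F n (H.totAug F n x) = H'.totAug F n x := by
  refine tot_ext fun p q h σ => ?_
  rcases p with _ | p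
  · obtain rfl : q = n := by simpa using h
    rw [totApp_pull, totApp_totAug_zero, totApp_totAug_zero, res_res]
  · rw [totApp_pull, totApp_totAug_succ, totApp_totAug_succ, map_zero]

lemma totMap_pull (f : F ⟶ G) {n : ℤ} (x : H.Tot F n) :
    H'.totMap f n (r.pull F n x) = r.pull G n (H.totMap f n x) :=
  tot_ext fun p q h σ => by simp [secMap_res]

end Refinement

end OpenHypercover

/-! ### Normalization -/

section CosimplicialNormalization

open AlgebraicTopology AlgebraicTopology.DoldKan

variable {C : Type*} [Category* C] [Preadditive C]

/-- The Dold–Kan projector onto the normalized cochains of a cosimplicial object, obtained from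
the one for simplicial objects by passing to the opposite category. -/
def cosimplicialNorm (Y : CosimplicialObject C) (p : ℕ) : Y.obj ⦋p⦌ ⟶ Y.obj ⦋p⦌ :=
  ((PInfty (X := (cosimplicialSimplicialEquiv C).functor.obj (op Y))).f p).unop

lemma cosimplicialNorm_comp_d (Y : CosimplicialObject C) (p : ℕ) :
    cosimplicialNorm Y p ≫ AlternatingCofaceMapComplex.objD Y p =
      AlternatingCofaceMapComplex.objD Y p ≫ cosimplicialNorm Y (p + 1) := by
  rw [AlternatingCofaceMapComplex.d_eq_unop_d]
  have h := (PInfty (X := (cosimplicialSimplicialEquiv C).functor.obj (op Y))).comm (p + 1) p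
  rw [AlternatingFaceMapComplex.obj_d_eq] at h
  exact (congrArg Quiver.Hom.unop h).symm

lemma cosimplicialNorm_comp_σ (Y : CosimplicialObject C) {p : ℕ} (j : Fin (p + 1)) :
    cosimplicialNorm Y (p + 1) ≫ Y.σ j = 0 :=
  congrArg Quiver.Hom.unop
    (σ_comp_PInfty ((cosimplicialSimplicialEquiv C).functor.obj (op Y)) j)

lemma cosimplicialNorm_zero (Y : CosimplicialObject C) : cosimplicialNorm Y 0 = 𝟙 _ := rfl

/-- The complement of the normalization projector factors through the codegeneracies. -/
lemma exists_cosimplicialNorm_eq (Y : CosimplicialObject C) (p : ℕ) :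
    ∃ g : Fin (p + 1) → (Y.obj ⦋p⦌ ⟶ Y.obj ⦋p + 1⦌),
      𝟙 _ - cosimplicialNorm Y (p + 1) = ∑ j, Y.σ j ≫ g j := by
  let Z := (cosimplicialSimplicialEquiv C).functor.obj (op Y)
  refine ⟨fun j => ((P (X := Z) j.rev).f (p + 1) ≫ Z.δ j.succ).unop, ?_⟩
  have h1 := PInfty_f_add_QInfty_f (X := Z) (p + 1)
  have h2 := decomposition_Q (X := Z) p (p + 1)
  rw [QInfty_f, h2, Finset.filter_true_of_mem (fun i _ => i.2)] at h1
  have h3 := congrArg Quiver.Hom.unop (eq_sub_of_add_eq' h1)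
  refine h3.symm.trans ?_
  rw [unop_sum, ← Equiv.sum_comp Fin.revPerm]
  refine Finset.sum_congr rfl fun j _ => ?_
  simp only [Fin.revPerm_apply, Fin.rev_rev]
  exact congrArg Quiver.Hom.unop (Category.assoc _ _ _).symm

end CosimplicialNormalization

namespace OpenHypercover

variable {U : Opens X} {H H' : OpenHypercover X U} {F G : PshCh X R}

/-- A total cochain is normalized if it vanishes on the degenerate simplices. -/
def IsNormalized {n : ℤ} (x : H.Tot F n) : Prop :=
  ∀ (p : ℕ) (q : ℤ) (h : ((p + 1 : ℕ) : ℤ) + q = n) (j : Fin (p + 1)) (σ : H.I.obj (op ⦋p⦌)),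
    totApp x (p + 1) q h (H.degen j σ) = 0

lemma IsNormalized.add {n : ℤ} {x y : H.Tot F n} (hx : IsNormalized x) (hy : IsNormalized y) :
    IsNormalized (x + y) := fun p q h j σ => by
  rw [totApp_add, hx p q h j σ, hy p q h j σ, add_zero]

lemma IsNormalized.smul {n : ℤ} {x : H.Tot F n} (r : R) (hx : IsNormalized x) :
    IsNormalized (r • x) := fun p q h j σ => by
  rw [totApp_smul, hx p q h j σ, smul_zero]

lemma IsNormalized.totMap {n : ℤ} {x : H.Tot F n} (hx : IsNormalized x) (f : F ⟶ G) :
    IsNormalized (H.totMap f n x) := fun p q h j σ => by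
  rw [totApp_totMap, hx p q h j σ, map_zero]

lemma IsNormalized.pull {n : ℤ} {x : H.Tot F n} (hx : IsNormalized x) (r : Refinement H' H) :
    IsNormalized (r.pull F n x) := fun p q h j σ => by
  have e : r.map.app (op ⦋p + 1⦌) (H'.degen j σ) = H.degen j (r.map.app (op ⦋p⦌) σ) :=
    r.map_map _ _
  rw [Refinement.totApp_pull, res_congr (totApp x (p + 1) q h) e _ (e ▸ r.le _),
    hx p q h j, map_zero]

lemma isNormalized_totAug {n : ℤ} (x : Sec F n U) : IsNormalized (H.totAug F n x) :=
  fun p q h _ _ => totApp_totAug_succ x p q h _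

lemma isNormalized_zero {n : ℤ} : IsNormalized (0 : H.Tot F n) := fun _ _ _ _ _ => rfl

/-- The normalization projector on the cochains of bidegree `(p, q)`. -/
def normMap (H : OpenHypercover X U) (F : PshCh X R) (p : ℕ) (q : ℤ) :
    (∀ σ : H.I.obj (op ⦋p⦌), Sec F q (H.V σ)) →ₗ[R] (∀ σ : H.I.obj (op ⦋p⦌), Sec F q (H.V σ)) :=
  ((cosimplicialNorm (H.eval F) p).f q).hom

lemma normMap_zero (q : ℤ) (x : ∀ σ : H.I.obj (op ⦋0⦌), Sec F q (H.V σ)) :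
    normMap H F 0 q x = x := by
  unfold normMap
  rw [cosimplicialNorm_zero]
  rfl

lemma secD_normMap (p : ℕ) (q q' : ℤ) (x : ∀ σ : H.I.obj (op ⦋p⦌), Sec F q (H.V σ))
    (σ : H.I.obj (op ⦋p⦌)) :
    secD F q q' _ (normMap H F p q x σ) =
      normMap H F p q' (fun τ => secD F q q' _ (x τ)) σ :=
  congrFun (hom_comm_apply (j := q') (cosimplicialNorm (H.eval F) p) x) σ

lemma normMap_d (p : ℕ) (q : ℤ) (x : ∀ σ : H.I.obj (op ⦋p⦌), Sec F q (H.V σ))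
    (σ : H.I.obj (op ⦋p + 1⦌)) :
    ∑ i : Fin (p + 2), (-1 : ℤ) ^ (i : ℕ) •
        res F (H.V_le_map (SimplexCategory.δ i) σ) (normMap H F p q x (H.face i σ)) =
      normMap H F (p + 1) q (fun σ => ∑ i : Fin (p + 2), (-1 : ℤ) ^ (i : ℕ) •
        res F (H.V_le_map (SimplexCategory.δ i) σ) (x (H.face i σ))) σ := by
  have h : (H.doubleComplex F).d p (p + 1) =
      AlgebraicTopology.AlternatingCofaceMapComplex.objD (H.eval F) p :=
    CochainComplex.of_d (fun n => (H.eval F).obj ⦋n⦌)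
      (AlgebraicTopology.AlternatingCofaceMapComplex.objD (H.eval F)) p
  have h' := congrArg (fun g => (g.f q).hom x) (cosimplicialNorm_comp_d (H.eval F) p)
  rw [← h] at h'
  have e : (show ∀ σ : H.I.obj (op ⦋p + 1⦌), Sec F q (H.V σ) from
      (((H.doubleComplex F).d p (p + 1)).f q).hom x) = _ :=
    funext (doubleComplex_d_apply (F := F) p q x)
  rw [← doubleComplex_d_apply, ← e]
  exact congrFun h' σ

lemma normMap_degen (p : ℕ) (q : ℤ) (x : ∀ σ : H.I.obj (op ⦋p + 1⦌), Sec F q (H.V σ))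
    (j : Fin (p + 1)) (σ : H.I.obj (op ⦋p⦌)) :
    normMap H F (p + 1) q x (H.degen j σ) = 0 := by
  have h := congrArg (fun g => (g.f q).hom x) (cosimplicialNorm_comp_σ (H.eval F) (p := p) j)
  have h' : res F (H.V_le_map (SimplexCategory.σ j) σ)
    (normMap H F (p + 1) q x (H.degen j σ)) = 0 := congrFun h σ
  have e : H.face j.castSucc (H.degen j σ) = σ := by
    change H.I.map _ (H.I.map _ σ) = σ
    rw [← Functor.map_comp_apply, ← op_comp, SimplexCategory.δ_comp_σ_self]
    simp
  -- a degenerate simplex has the same open subset as the simplex it comes from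
  have hV : H.V (H.degen j σ) ≤ H.V σ := by
    have := H.V_le_map (SimplexCategory.δ j.castSucc) (H.degen j σ)
    rwa [show H.I.map (SimplexCategory.δ j.castSucc).op (H.degen j σ) = σ from e] at this
  have := congrArg (res F hV) h'
  rwa [res_res, res_self, map_zero] at this

lemma normMap_eq_self (p : ℕ) (q : ℤ) (x : ∀ σ : H.I.obj (op ⦋p + 1⦌), Sec F q (H.V σ))
    (hx : ∀ j σ, x (H.degen j σ) = 0) : normMap H F (p + 1) q x = x := by
  obtain ⟨g, hg⟩ := exists_cosimplicialNorm_eq (H.eval F) p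
  have h0 : ∀ j : Fin (p + 1), (((H.eval F).σ j).f q).hom x = 0 := by
    intro j
    funext σ
    exact (congrArg (res F (H.V_le_map (SimplexCategory.σ j) σ)) (hx j σ)).trans (map_zero _)
  have h1 := congrArg (fun g => (g.f q).hom x) hg
  have h2 := (HomologicalComplex.eval (ModuleCat.{u} R) (ComplexShape.up ℤ) q).map_sum
    (fun j : Fin (p + 1) => (H.eval F).σ j ≫ g j) Finset.univ
  have h3 : ((∑ j : Fin (p + 1), (H.eval F).σ j ≫ g j).f q).hom x = 0 := by
    refine (congrArg (fun g => g.hom x) h2).trans ?_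
    rw [ModuleCat.hom_sum]
    refine (LinearMap.sum_apply _ _ _).trans (Finset.sum_eq_zero fun j _ => ?_)
    exact (congrArg ((g j).f q).hom (h0 j)).trans (map_zero _)
  have h4 : x - normMap H F (p + 1) q x = 0 := h1.trans h3
  exact (sub_eq_zero.1 h4).symm

/-- The normalization projector on total cochains. -/
def totNorm (H : OpenHypercover X U) (F : PshCh X R) (n : ℤ) : H.Tot F n →ₗ[R] H.Tot F n where
  toFun x := totMk fun p q h => normMap H F p q (totApp x p q h)
  map_add' _ _ := tot_ext fun p q _ σ => congrFun (map_add (normMap H F p q) _ _) σ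
  map_smul' _ _ := tot_ext fun p q _ σ => congrFun (map_smul (normMap H F p q) _ _) σ

@[simp]
lemma totApp_totNorm {n : ℤ} (x : H.Tot F n) (p : ℕ) (q : ℤ) (h : p + q = n)
    (σ : H.I.obj (op ⦋p⦌)) :
    totApp (H.totNorm F n x) p q h σ = normMap H F p q (totApp x p q h) σ := rfl

lemma isNormalized_totNorm {n : ℤ} (x : H.Tot F n) : IsNormalized (H.totNorm F n x) :=
  fun p q _ j σ => normMap_degen p q _ j σ

lemma IsNormalized.totNorm_eq {n : ℤ} {x : H.Tot F n} (hx : IsNormalized x) :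
    H.totNorm F n x = x := by
  refine tot_ext fun p q h σ => ?_
  rw [totApp_totNorm]
  rcases p with _ | p
  · rw [normMap_zero]
  · rw [normMap_eq_self _ _ _ (hx p q h)]

lemma totD_totNorm {n : ℤ} (x : H.Tot F n) :
    H.totD F n (H.totNorm F n x) = H.totNorm F (n + 1) (H.totD F n x) := by
  refine tot_ext fun p q h σ => ?_
  rcases p with _ | p
  · rw [totApp_totD_zero _ (show q - 1 + 1 = q by lia) _ (by lia), totApp_totNorm,
      totApp_totNorm, secD_normMap]
    refine congrFun (congrArg (normMap H F 0 q) (funext fun τ => ?_)) σ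
    rw [totApp_totD_zero _ (show q - 1 + 1 = q by lia) _ (by lia)]
  · rw [totApp_totD_succ _ p (show q - 1 + 1 = q by lia) _ (by lia) (by push_cast at h; lia),
      totApp_totNorm, totApp_totNorm, secD_normMap]
    simp only [totApp_totNorm]
    rw [normMap_d]
    have e : totApp (H.totD F n x) (p + 1) q h = (fun σ => ∑ i : Fin (p + 2), (-1 : ℤ) ^ (i : ℕ) •
        res F (H.V_le_map (SimplexCategory.δ i) σ)
          (totApp x p q (by push_cast at h; lia) (H.face i σ))) +
        (-1 : ℤ) ^ (p + 1) • (fun σ => secD F (q - 1) q _ (totApp x (p + 1) (q - 1)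
          (by push_cast at h ⊢; lia) σ)) := by
      funext τ
      exact totApp_totD_succ _ p (show q - 1 + 1 = q by lia) _ _ _ _
    rw [e, map_add, map_zsmul]
    rfl

end OpenHypercover

/-! ### Filling boundaries of simplices -/

section Boundary

open SSet

/-- A map `∂Δ[n] ⟶ I`, described as a compatible family of simplices indexed by the maps
`m ⟶ ⦋n⦌` that are not surjective. -/
structure BoundaryFamily (I : SSet.{u}) (n : ℕ) where
  /-- the simplex indexed by `s` -/
  simplex : ∀ {m : SimplexCategory} (s : m ⟶ ⦋n⦌), ¬ Function.Surjective s.toOrderHom →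
    I.obj (op m)
  map_simplex : ∀ {m' m : SimplexCategory} (θ : m' ⟶ m) (s : m ⟶ ⦋n⦌)
    (hs : ¬ Function.Surjective s.toOrderHom)
    (hs' : ¬ Function.Surjective (θ ≫ s).toOrderHom),
    I.map θ.op (simplex s hs) = simplex (θ ≫ s) hs'

namespace BoundaryFamily

variable {I : SSet.{u}} {n : ℕ}

/-- The map out of the boundary given by a family of simplices. -/
def toHom (b : BoundaryFamily I n) : (SSet.boundary.{u} n : SSet.{u}) ⟶ I where
  app m := TypeCat.ofHom fun s => b.simplex (stdSimplex.objEquiv s.1) s.2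
  naturality m m' θ := by
    ext s
    exact (b.map_simplex θ.unop (stdSimplex.objEquiv s.1) s.2 _).symm

/-- The family of simplices given by a map out of the boundary. -/
def ofHom (b : (SSet.boundary.{u} n : SSet.{u}) ⟶ I) : BoundaryFamily I n where
  simplex {m} s hs := b.app (op m) ⟨stdSimplex.objEquiv.symm s, hs⟩
  map_simplex θ s hs _ :=
    (NatTrans.naturality_apply b θ.op ⟨stdSimplex.objEquiv.symm s, hs⟩).symm

end BoundaryFamily

lemma not_surjective_comp {m' m n : SimplexCategory} (θ : m' ⟶ m) {s : m ⟶ n}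
    (hs : ¬ Function.Surjective s.toOrderHom) : ¬ Function.Surjective (θ ≫ s).toOrderHom :=
  fun h => hs (Function.Surjective.of_comp h)

lemma not_surjective_δ {n : ℕ} (i : Fin (n + 2)) :
    ¬ Function.Surjective (SimplexCategory.δ i).toOrderHom := by
  intro h
  have := SimplexCategory.epi_iff_surjective.2 h
  simpa using SimplexCategory.len_le_of_epi (SimplexCategory.δ i)

/-- A family of simplices with compatible faces extends to the boundary. -/
lemma exists_boundaryFamily (I : SSet.{u}) {n : ℕ} (y : Fin (n + 2) → I.obj (op ⦋n⦌))
    (hy : ∀ {m : SimplexCategory} (u v : m ⟶ ⦋n⦌) (i j : Fin (n + 2)), i < j →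
      u ≫ SimplexCategory.δ i = v ≫ SimplexCategory.δ j → I.map u.op (y i) = I.map v.op (y j)) :
    ∃ b : BoundaryFamily I (n + 1), ∀ {m : SimplexCategory} (u : m ⟶ ⦋n⦌) (i : Fin (n + 2)) hs,
      b.simplex (u ≫ SimplexCategory.δ i) hs = I.map u.op (y i) := by
  have hy' : ∀ {m : SimplexCategory} (u v : m ⟶ ⦋n⦌) (i j : Fin (n + 2)),
      u ≫ SimplexCategory.δ i = v ≫ SimplexCategory.δ j →
        I.map u.op (y i) = I.map v.op (y j) := by
    intro m u v i j h
    rcases lt_trichotomy i j with hij | rfl | hij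
    · exact hy u v i j hij h
    · rw [cancel_mono] at h
      rw [h]
    · exact (hy v u j i hij h.symm).symm
  choose i u hu using fun (m : SimplexCategory) (s : m ⟶ ⦋n + 1⦌) =>
    SimplexCategory.eq_comp_δ_of_not_surjective s
  refine ⟨⟨fun {m} s hs => I.map (u m s hs).op (y (i m s hs)), ?_⟩, ?_⟩
  · intro m' m θ s hs hs'
    rw [← Functor.map_comp_apply, ← op_comp]
    apply hy'
    rw [Category.assoc, ← hu, ← hu]
  · intro m v j hs
    apply hy'
    exact (hu _ _ hs).symm

end Boundary

namespace OpenHypercover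

variable {U : Opens X}

/-- The covering condition of a hypercover, with maps out of the boundary of a simplex described
as families of simplices. -/
lemma exists_filler (H : OpenHypercover X U) {n : ℕ} (b : BoundaryFamily H.I n) {x : X}
    (hx : x ∈ U) (hb : ∀ {m : SimplexCategory} (s : m ⟶ ⦋n⦌) hs, x ∈ H.V (b.simplex s hs)) :
    ∃ τ : H.I.obj (op ⦋n⦌), x ∈ H.V τ ∧ ∀ {m : SimplexCategory} (s : m ⟶ ⦋n⦌) hs,
      H.I.map s.op τ = b.simplex s hs := by
  obtain ⟨t, ht, hxt⟩ := H.covers n b.toHom x hx (fun m s => hb _ s.2)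
  refine ⟨SSet.yonedaEquiv t, hxt, fun {m} s hs => ?_⟩
  have h := ConcreteCategory.congr_hom (NatTrans.congr_app ht (op m))
    ⟨SSet.stdSimplex.objEquiv.symm s, hs⟩
  refine Eq.trans ?_ h
  obtain ⟨τ, rfl⟩ := SSet.yonedaEquiv.symm.surjective t
  rw [Equiv.apply_symm_apply]
  rfl

/-- The covering condition of a hypercover can be checked on families of simplices. -/
lemma covers_of_exists_filler {I : SSet.{u}} {V : ∀ {n : SimplexCategory}, I.obj (op n) → Opens X}
    {n : ℕ} {x : X}
    (h : ∀ b : BoundaryFamily I n,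
      (∀ {m : SimplexCategory} (s : m ⟶ ⦋n⦌) hs, x ∈ V (b.simplex s hs)) →
      ∃ τ : I.obj (op ⦋n⦌), x ∈ V τ ∧ ∀ {m : SimplexCategory} (s : m ⟶ ⦋n⦌) hs,
        I.map s.op τ = b.simplex s hs)
    (b : (SSet.boundary.{u} n : SSet.{u}) ⟶ I)
    (hb : ∀ (m : SimplexCategory) (s : (SSet.boundary.{u} n : SSet.{u}).obj (op m)),
      x ∈ V (b.app (op m) s)) :
    ∃ t : Δ[n] ⟶ I, (SSet.boundary.{u} n).ι ≫ t = b ∧ x ∈ V (SSet.yonedaEquiv t) := by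
  obtain ⟨τ, hτ, hs⟩ := h (BoundaryFamily.ofHom b) (fun s hs => hb _ _)
  refine ⟨SSet.yonedaEquiv.symm τ, ?_, by rwa [Equiv.apply_symm_apply]⟩
  ext m s
  exact hs (SSet.stdSimplex.objEquiv s.1) s.2

/-- The hypercover of `U` by itself. -/
def trivial (U : Opens X) : OpenHypercover X U where
  I := (Functor.const _).obj PUnit.{u + 1}
  V _ := U
  V_le_map _ _ := le_rfl
  V_le _ := le_rfl
  covers _ b _ hx hb := covers_of_exists_filler (V := fun _ => U)
    (fun _ _ => ⟨PUnit.unit, hx, fun _ _ => rfl⟩) b hb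

end OpenHypercover

/-! ### Alternating sums over the faces of a simplex -/

section AltFace

variable {A B : Type u} [AddCommGroup A] [AddCommGroup B] {k : SimplexCategory}

/-- The alternating sum over faces of a function on the simplices of `Δ^k`. -/
def altFace (g : ∀ p : ℕ, (⦋p⦌ ⟶ k) → A) (p : ℕ) (s : ⦋p⦌ ⟶ k) : A :=
  match p, s with
  | 0, _ => 0
  | p + 1, s => ∑ i : Fin (p + 2), (-1 : ℤ) ^ (i : ℕ) • g p (SimplexCategory.δ i ≫ s)

lemma altFace_altFace (g : ∀ p : ℕ, (⦋p⦌ ⟶ k) → A) (p : ℕ) (s : ⦋p⦌ ⟶ k) :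
    altFace (altFace g) p s = 0 := by
  rcases p with _ | _ | p
  · rfl
  · simp [altFace]
  simp only [altFace, Finset.smul_sum, smul_smul]
  rw [← Finset.sum_product', Finset.univ_product_univ]
  let S : Finset (Fin (p + 3) × Fin (p + 2)) := {ij | (ij.2 : ℕ) < (ij.1 : ℕ)}
  rw [← Finset.sum_add_sum_compl S, ← eq_neg_iff_add_eq_zero, ← Finset.sum_neg_distrib]
  -- the terms `(i, j)` with `j < i` cancel against the terms `(j, i - 1)`
  refine Finset.sum_bij' (fun ij _ => (ij.2.castSucc, ⟨(ij.1 : ℕ) - 1, by have := ij.1.2; lia⟩))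
    (fun ij _ => (ij.2.succ, ⟨min (ij.1 : ℕ) (p + 1), by lia⟩)) ?_ ?_ ?_ ?_ ?_
  · rintro ⟨i, j⟩ h
    simp only [S, Finset.compl_filter, Finset.mem_filter_univ] at h ⊢
    simp only [Fin.val_castSucc]
    lia
  · rintro ⟨i, j⟩ h
    simp only [S, Finset.compl_filter, Finset.mem_filter_univ] at h ⊢
    simp only [Fin.val_succ]
    lia
  · rintro ⟨i, j⟩ h
    simp only [S, Finset.mem_filter_univ] at h
    ext
    · simp
      lia
    · simp
      lia
  · rintro ⟨i, j⟩ h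
    simp only [S, Finset.compl_filter, Finset.mem_filter_univ] at h
    ext
    · simp
      lia
    · simp
  · rintro ⟨i, j⟩ h
    simp only [S, Finset.mem_filter_univ] at h
    obtain ⟨i, rfl⟩ : ∃ i' : Fin (p + 2), i = i'.succ :=
      ⟨⟨(i : ℕ) - 1, by lia⟩, by ext; simp; lia⟩
    simp only [Fin.val_succ, Nat.add_sub_cancel, Fin.eta, Fin.val_castSucc]
    have hδ := SimplexCategory.δ_comp_δ (i := j) (j := i) (by
      rw [Fin.le_iff_val_le_val]; simp only [Fin.val_succ] at h; lia)
    rw [← Category.assoc, ← Category.assoc, hδ, ← neg_smul]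
    congr 1
    ring

lemma map_altFace (φ : A →+ B) (g : ∀ p : ℕ, (⦋p⦌ ⟶ k) → A) (p : ℕ) (s : ⦋p⦌ ⟶ k) :
    φ (altFace g p s) = altFace (fun p s => φ (g p s)) p s := by
  cases p with
  | zero => exact map_zero φ
  | succ p => simp only [altFace, map_sum, map_zsmul]

/-- Alternating sums over faces of functions vanishing on degenerate simplices vanish on
degenerate simplices. -/
lemma altFace_degenerate (g : ∀ p : ℕ, (⦋p⦌ ⟶ k) → A) {p : ℕ} (j : Fin (p + 1)) (s : ⦋p⦌ ⟶ k)
    (hg : ∀ (p' : ℕ) (j' : Fin (p' + 1)) (s' : ⦋p'⦌ ⟶ k), p' + 1 = p →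
      g (p' + 1) (SimplexCategory.σ j' ≫ s') = 0) :
    altFace g (p + 1) (SimplexCategory.σ j ≫ s) = 0 := by
  have h1 : g p (SimplexCategory.δ j.castSucc ≫ SimplexCategory.σ j ≫ s) = g p s := by
    rw [← Category.assoc, SimplexCategory.δ_comp_σ_self, Category.id_comp]
  have h2 : g p (SimplexCategory.δ j.succ ≫ SimplexCategory.σ j ≫ s) = g p s := by
    rw [← Category.assoc, SimplexCategory.δ_comp_σ_succ, Category.id_comp]
  have h0 : ∀ i : Fin (p + 2), i ≠ j.castSucc → i ≠ j.succ →
      g p (SimplexCategory.δ i ≫ SimplexCategory.σ j ≫ s) = 0 := by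
    intro i hi hi'
    rcases p with _ | p
    · exfalso
      fin_cases j
      fin_cases i
      · exact hi rfl
      · exact hi' rfl
    have hne : (i : ℕ) ≠ j := fun h => hi (Fin.ext h)
    have hne' : (i : ℕ) ≠ j + 1 := fun h => hi' (Fin.ext h)
    rcases lt_or_gt_of_ne hne with hlt | hgt
    · obtain ⟨j, rfl⟩ : ∃ j' : Fin (p + 1), j = j'.succ :=
        ⟨⟨(j : ℕ) - 1, by lia⟩, by ext; simp; lia⟩
      obtain ⟨i, rfl⟩ : ∃ i' : Fin (p + 2), i = i'.castSucc :=
        ⟨⟨(i : ℕ), by have := j.2; simp at hlt; lia⟩, rfl⟩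
      rw [← Category.assoc, SimplexCategory.δ_comp_σ_of_le (by
        rw [Fin.le_iff_val_le_val]; simp at hlt ⊢; lia), Category.assoc]
      exact hg p _ _ rfl
    · obtain ⟨i, rfl⟩ : ∃ i' : Fin (p + 2), i = i'.succ :=
        ⟨⟨(i : ℕ) - 1, by lia⟩, by ext; simp; lia⟩
      obtain ⟨j, rfl⟩ : ∃ j' : Fin (p + 1), j = j'.castSucc :=
        ⟨⟨(j : ℕ), by have := i.2; simp at hgt hne'; lia⟩, rfl⟩
      rw [← Category.assoc, SimplexCategory.δ_comp_σ_of_gt (by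
        rw [Fin.lt_def]; simp at hgt hne' ⊢; lia), Category.assoc]
      exact hg p _ _ rfl
  have hne : j.castSucc ≠ j.succ := by simp [Fin.ext_iff]
  simp only [altFace]
  rw [← Finset.sum_subset (Finset.subset_univ {j.castSucc, j.succ})
    (fun i _ hi => by
      rw [h0 i (by rintro rfl; simp at hi) (by rintro rfl; simp at hi), smul_zero]),
    Finset.sum_pair hne, h1, h2]
  simp [pow_succ]

end AltFace

/-! ### Simplices with a trivialization of a cocycle -/

/-- A presheaf on `X` of cochain complexes of abelian groups, all of whose cocycles are locally
coboundaries. -/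
structure LocallyAcyclic (X : TopCat.{u}) where
  /-- the sections of degree `q` -/
  C : ℤ → Opens X → Type u
  [group : ∀ q W, AddCommGroup (C q W)]
  /-- restriction of sections -/
  res : ∀ {q : ℤ} {W' W : Opens X}, W' ≤ W → C q W →+ C q W'
  /-- the differential -/
  d : ∀ (q : ℤ) (W : Opens X), C q W →+ C (q + 1) W
  res_self : ∀ {q : ℤ} {W : Opens X} (h : W ≤ W) (x : C q W), res h x = x
  res_res : ∀ {q : ℤ} {W'' W' W : Opens X} (h' : W'' ≤ W') (h : W' ≤ W) (x : C q W),
    res h' (res h x) = res (h'.trans h) x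
  d_res : ∀ {q : ℤ} {W' W : Opens X} (h : W' ≤ W) (x : C q W), d q W' (res h x) = res h (d q W x)
  d_d : ∀ {q : ℤ} {W : Opens X} (x : C q W), d (q + 1) W (d q W x) = 0
  exact : ∀ {q : ℤ} {W : Opens X} {x : X}, x ∈ W → ∀ z : C (q + 1) W, d (q + 1) W z = 0 →
    ∃ (W' : Opens X) (_ : x ∈ W') (h : W' ≤ W) (a : C q W'), d q W' a = res h z

namespace LocallyAcyclic

attribute [instance] LocallyAcyclic.group

variable (K : LocallyAcyclic X)

/-- A family of sections of all degrees over an open subset. -/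
abbrev LocalSection : Type u := Σ W : Opens X, ∀ q : ℤ, K.C q W

variable {K}

open Classical in
/-- The restriction of the degree `q` part of a local section to `W`, with the value zero if it
is not defined on `W`. -/
def LocalSection.at (t : K.LocalSection) (q : ℤ) (W : Opens X) : K.C q W :=
  if h : W ≤ t.1 then K.res h (t.2 q) else 0

lemma LocalSection.at_eq (t : K.LocalSection) (q : ℤ) {W : Opens X} (h : W ≤ t.1) :
    t.at q W = K.res h (t.2 q) := dif_pos h

lemma LocalSection.at_self (t : K.LocalSection) (q : ℤ) : t.at q t.1 = t.2 q := by
  rw [t.at_eq q le_rfl, K.res_self]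

lemma LocalSection.at_eq_zero (t : K.LocalSection) (q : ℤ) (W : Opens X) (h : t.2 q = 0) :
    t.at q W = 0 := by
  unfold LocalSection.at
  split_ifs
  · rw [h, map_zero]
  · rfl

lemma LocalSection.res_at (t : K.LocalSection) (q : ℤ) {W' W : Opens X} (h' : W' ≤ W)
    (h : W ≤ t.1) : K.res h' (t.at q W) = t.at q W' := by
  rw [t.at_eq q h, K.res_res, t.at_eq]

/-- A family of local sections indexed by the simplices of `Δ^k`. -/
abbrev Family (K : LocallyAcyclic X) (k : SimplexCategory) : Type u :=
  ∀ m : SimplexCategory, (m ⟶ k) → K.LocalSection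

namespace Family

variable {k : SimplexCategory}

/-- The pullback of a family along a map of simplices. -/
def pull {k' : SimplexCategory} (φ : k' ⟶ k) (t : K.Family k) : K.Family k' :=
  fun m s => t m (s ≫ φ)

/-- The open subsets of a family decrease along simplicial operators. -/
def IsMono (t : K.Family k) : Prop :=
  ∀ {m' m : SimplexCategory} (θ : m' ⟶ m) (s : m ⟶ k), (t m s).1 ≤ (t m' (θ ≫ s)).1

/-- The value over `W` of the total differential of a family at a simplex `s`. -/
def totalD (t : K.Family k) (p : ℕ) (s : ⦋p⦌ ⟶ k) (q : ℤ) (W : Opens X) : K.C (q + 1) W :=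
  altFace (fun p s => (t ⦋p⦌ s).at (q + 1) W) p s + (-1 : ℤ) ^ p • K.d q W ((t ⦋p⦌ s).at q W)

lemma res_altFace {t : K.Family k} (ht : t.IsMono) {p : ℕ} (s : ⦋p⦌ ⟶ k) (q : ℤ)
    {W' W : Opens X} (h' : W' ≤ W) (h : W ≤ (t ⦋p⦌ s).1) :
    K.res h' (altFace (fun p s => (t ⦋p⦌ s).at q W) p s) =
      altFace (fun p s => (t ⦋p⦌ s).at q W') p s := by
  rw [map_altFace]
  rcases p with _ | p
  · rfl
  · refine Finset.sum_congr rfl fun i _ => congrArg _ ?_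
    exact LocalSection.res_at _ _ _ (h.trans (ht _ _))

lemma res_totalD {t : K.Family k} (ht : t.IsMono) {p : ℕ} (s : ⦋p⦌ ⟶ k) (q : ℤ)
    {W' W : Opens X} (h' : W' ≤ W) (h : W ≤ (t ⦋p⦌ s).1) :
    K.res h' (t.totalD p s q W) = t.totalD p s q W' := by
  unfold totalD
  rw [map_add, res_altFace ht s _ h' h, map_zsmul, ← K.d_res, LocalSection.res_at _ _ _ h]

lemma totalD_pull {k' : SimplexCategory} (φ : k' ⟶ k) (t : K.Family k) {p : ℕ} (s : ⦋p⦌ ⟶ k')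
    (q : ℤ) (W : Opens X) : (t.pull φ).totalD p s q W = t.totalD p (s ≫ φ) q W := by
  rcases p with _ | p
  · rfl
  · simp only [totalD, altFace, pull, Category.assoc]

/-- The alternating sum over the faces of a simplex of the total differential. -/
lemma altFace_totalD (t : K.Family k) (p : ℕ) (s : ⦋p⦌ ⟶ k) (q : ℤ) (W : Opens X) :
    altFace (fun p s => t.totalD p s q W) p s =
      -((-1 : ℤ) ^ p • K.d q W (altFace (fun p s => (t ⦋p⦌ s).at q W) p s)) := by
  have h := altFace_altFace (fun p s => (t ⦋p⦌ s).at (q + 1) W) p s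
  rcases p with _ | p
  · simp [altFace]
  · rw [map_altFace]
    simp only [altFace, totalD, smul_add, Finset.sum_add_distrib] at h ⊢
    rw [h, zero_add, Finset.smul_sum, ← Finset.sum_neg_distrib]
    refine Finset.sum_congr rfl fun i _ => ?_
    rw [smul_comm, pow_succ, mul_neg_one, neg_smul, neg_neg]

/-- A family is normalized in degree `N` if it vanishes on the degenerate simplices. -/
def IsNormalized (N : ℤ) (t : K.Family k) : Prop :=
  ∀ (p : ℕ) (q : ℤ), ((p + 1 : ℕ) : ℤ) + q = N → ∀ (j : Fin (p + 1)) (s : ⦋p⦌ ⟶ k),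
    (t ⦋p + 1⦌ (SimplexCategory.σ j ≫ s)).2 q = 0

lemma totalD_degenerate {N : ℤ} {t : K.Family k} (ht : t.IsNormalized N) {p : ℕ} {q : ℤ}
    (h : ((p + 1 : ℕ) : ℤ) + q = N) (j : Fin (p + 1)) (s : ⦋p⦌ ⟶ k) (W : Opens X) :
    t.totalD (p + 1) (SimplexCategory.σ j ≫ s) q W = 0 := by
  unfold totalD
  rw [altFace_degenerate, LocalSection.at_eq_zero _ _ _ (ht p q h j s), map_zero, smul_zero,
    add_zero]
  rintro p' j' s' rfl
  exact LocalSection.at_eq_zero _ _ _ (ht p' (q + 1) (by push_cast at h ⊢; lia) j' s')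

end Family

end LocallyAcyclic

namespace OpenHypercover

variable {U : Opens X} (H : OpenHypercover X U) {K : LocallyAcyclic X}

/-- The family of local sections given by the values of `z` on the faces of `σ`. -/
def family (z : ∀ (m : SimplexCategory) (σ : H.I.obj (op m)) (q : ℤ), K.C q (H.V σ))
    {k : SimplexCategory} (σ : H.I.obj (op k)) : K.Family k :=
  fun m s => ⟨H.V (H.I.map s.op σ), z m (H.I.map s.op σ)⟩

variable {H} (z : ∀ (m : SimplexCategory) (σ : H.I.obj (op m)) (q : ℤ), K.C q (H.V σ))

lemma family_isMono {k : SimplexCategory} (σ : H.I.obj (op k)) : (H.family z σ).IsMono := by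
  intro m' m θ s
  change H.V _ ≤ H.V _
  rw [op_comp, Functor.map_comp_apply]
  exact H.V_le_map _ _

lemma family_map {k' k : SimplexCategory} (φ : k' ⟶ k) (σ : H.I.obj (op k)) :
    H.family z (H.I.map φ.op σ) = (H.family z σ).pull φ := by
  funext m s
  unfold family LocallyAcyclic.Family.pull
  rw [← Functor.map_comp_apply, ← op_comp]

/-- A `k`-simplex of the universal hypercover refining `H` on which `z` becomes the total
differential of a cochain: a `k`-simplex `σ` of `H`, together with a shrinking of the open subsets
indexed by the faces of `σ`, and a normalized cochain of total degree `N` on the simplices of `Δ^k`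
whose total differential is `z`. -/
structure TrivializedSimplex (N : ℤ) (k : SimplexCategory) where
  /-- the simplex of `H` -/
  simplex : H.I.obj (op k)
  /-- the shrunken open subsets, with the cochain on them -/
  family : K.Family k
  le : ∀ {m : SimplexCategory} (s : m ⟶ k), (family m s).1 ≤ H.V (H.I.map s.op simplex)
  isMono : family.IsMono
  isNormalized : family.IsNormalized N
  totalD_eq : ∀ (p : ℕ) (q : ℤ), p + q = N → ∀ s : ⦋p⦌ ⟶ k,
    family.totalD p s q (family ⦋p⦌ s).1 =
      (H.family z simplex ⦋p⦌ s).at (q + 1) (family ⦋p⦌ s).1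

namespace TrivializedSimplex

variable {z} {N : ℤ} {k : SimplexCategory}

@[ext]
lemma ext {τ τ' : TrivializedSimplex z N k} (h : τ.simplex = τ'.simplex)
    (h' : τ.family = τ'.family) : τ = τ' := by
  cases τ; cases τ'; simp_all

/-- The pullback along a map of simplices. -/
def pull {k' : SimplexCategory} (φ : k' ⟶ k) (τ : TrivializedSimplex z N k) :
    TrivializedSimplex z N k' where
  simplex := H.I.map φ.op τ.simplex
  family := τ.family.pull φ
  le s := by
    rw [← Functor.map_comp_apply, ← op_comp]
    exact τ.le _
  isMono θ s := by
    simpa [LocallyAcyclic.Family.pull] using τ.isMono θ (s ≫ φ)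
  isNormalized p q h j s := by
    have := τ.isNormalized p q h j (s ≫ φ)
    rwa [← Category.assoc] at this
  totalD_eq p q h s := by
    rw [family_map]
    exact (LocallyAcyclic.Family.totalD_pull _ _ _ _ _).trans (τ.totalD_eq p q h (s ≫ φ))

end TrivializedSimplex

/-- The simplicial set of indices of the universal hypercover refining `H` on which `z` becomes
a total differential. -/
def trivializedIndex (N : ℤ) : SSet.{u} where
  obj k := TrivializedSimplex z N k.unop
  map φ := TypeCat.ofHom fun τ => τ.pull φ.unop
  map_id k := by
    refine ConcreteCategory.hom_ext _ _ fun τ => ?_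
    refine TrivializedSimplex.ext ?_ ?_
    · change H.I.map (𝟙 _) τ.simplex = τ.simplex
      simp
    · funext m s
      change τ.family m (s ≫ 𝟙 _) = _
      rw [Category.comp_id]
      rfl
  map_comp φ ψ := by
    refine ConcreteCategory.hom_ext _ _ fun τ => ?_
    refine TrivializedSimplex.ext ?_ ?_
    · change H.I.map (φ ≫ ψ) τ.simplex = H.I.map ψ (H.I.map φ τ.simplex)
      simp
    · funext m s
      change τ.family m (s ≫ ψ.unop ≫ φ.unop) = τ.family m ((s ≫ ψ.unop) ≫ φ.unop)
      rw [Category.assoc]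

end OpenHypercover

/-! ### Extending trivializations from the boundary of a simplex -/

/-- The alternating sums at `s` agree if the functions agree at the faces of `s`, which are not
surjective if `s` is not surjective or if the dimension of `s` is at most `n`. -/
lemma altFace_congr {A : Type u} [AddCommGroup A] {n p : ℕ}
    {g g' : ∀ p : ℕ, (⦋p⦌ ⟶ ⦋n⦌) → A} (s : ⦋p⦌ ⟶ ⦋n⦌)
    (h : ∀ (p' : ℕ) (s' : ⦋p'⦌ ⟶ ⦋n⦌), p' + 1 = p →
      (¬ Function.Surjective s.toOrderHom ∨ p ≤ n → ¬ Function.Surjective s'.toOrderHom) →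
      g p' s' = g' p' s') :
    altFace g p s = altFace g' p s := by
  rcases p with _ | p
  · rfl
  · refine Finset.sum_congr rfl fun i _ => congrArg _ (h p _ rfl ?_)
    rintro (hs | hp) hsurj
    · exact not_surjective_comp _ hs hsurj
    · have := SimplexCategory.epi_iff_surjective.2 hsurj
      have := SimplexCategory.le_of_epi (SimplexCategory.δ i ≫ s)
      lia

namespace OpenHypercover

variable {U : Opens X} {H : OpenHypercover X U} {K : LocallyAcyclic X}
  {z : ∀ (m : SimplexCategory) (σ : H.I.obj (op m)) (q : ℤ), K.C q (H.V σ)} {N : ℤ}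

namespace TrivializedSimplex

variable {n : ℕ} (b : BoundaryFamily (trivializedIndex z N) n)

/-- The local section at the top simplex of the component of a boundary family at `s`. -/
def top {m : SimplexCategory} (s : m ⟶ ⦋n⦌) (hs : ¬ Function.Surjective s.toOrderHom) :
    K.LocalSection :=
  TrivializedSimplex.family (b.simplex s hs) m (𝟙 m)

lemma family_eq_top {m' m : SimplexCategory} (θ : m' ⟶ m) (s : m ⟶ ⦋n⦌)
    (hs : ¬ Function.Surjective s.toOrderHom) :
    TrivializedSimplex.family (b.simplex s hs) m' θ = top b (θ ≫ s) (not_surjective_comp θ hs) := by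
  have h := congrArg (fun τ : TrivializedSimplex z N m' => τ.family m' (𝟙 m'))
    (b.map_simplex θ s hs (not_surjective_comp θ hs))
  refine Eq.trans ?_ h
  change _ = TrivializedSimplex.family (b.simplex s hs) m' (𝟙 m' ≫ θ)
  rw [Category.id_comp]

open Classical in
/-- The extension of a boundary family to the simplex, by the sections `A` over `W` on the
nondegenerate top simplex and by zero on its degeneracies. -/
def extend (W : Opens X) (A : ∀ q : ℤ, K.C q W) : K.Family ⦋n⦌ := fun m s =>
  if hs : Function.Surjective s.toOrderHom then ⟨W, fun q => if m = ⦋n⦌ then A q else 0⟩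
  else top b s hs

variable {b} {W : Opens X} {A : ∀ q : ℤ, K.C q W}

lemma extend_of_not_surjective {m : SimplexCategory} (s : m ⟶ ⦋n⦌)
    (hs : ¬ Function.Surjective s.toOrderHom) : extend b W A m s = top b s hs := dif_neg hs

lemma extend_fst {m : SimplexCategory} (s : m ⟶ ⦋n⦌)
    (hs : Function.Surjective s.toOrderHom) : (extend b W A m s).1 = W := by
  unfold extend
  rw [dif_pos hs]

lemma extend_id : extend b W A ⦋n⦌ (𝟙 _) = ⟨W, A⟩ := by
  unfold extend
  rw [dif_pos (show Function.Surjective (SimplexCategory.Hom.toOrderHom (𝟙 ⦋n⦌)) from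
    fun x => ⟨x, rfl⟩)]
  simp

lemma extend_isMono (hW : ∀ {m : SimplexCategory} (s : m ⟶ ⦋n⦌) hs, W ≤ (top b s hs).1) :
    (extend b W A).IsMono := by
  intro m' m θ s
  by_cases hs : Function.Surjective s.toOrderHom
  · rw [extend_fst s hs]
    by_cases hs' : Function.Surjective (θ ≫ s).toOrderHom
    · rw [extend_fst _ hs']
    · rw [extend_of_not_surjective _ hs']
      exact hW _ _
  · rw [extend_of_not_surjective s hs, extend_of_not_surjective _ (not_surjective_comp θ hs),
      ← family_eq_top]
    simpa [top] using (b.simplex s hs : TrivializedSimplex z N m).isMono θ (𝟙 m)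

lemma extend_isNormalized : (extend b W A).IsNormalized N := by
  intro p q h j s
  by_cases hs : Function.Surjective s.toOrderHom
  · have hp : ⦋p + 1⦌ ≠ ⦋n⦌ := by
      intro e
      have e' : p + 1 = n := congrArg SimplexCategory.len e
      have := SimplexCategory.epi_iff_surjective.2 hs
      have := SimplexCategory.le_of_epi s
      lia
    have hs' : Function.Surjective (SimplexCategory.σ j ≫ s).toOrderHom := by
      have := SimplexCategory.epi_iff_surjective.2 hs
      exact SimplexCategory.epi_iff_surjective.1 inferInstance
    unfold extend
    rw [dif_pos hs']
    exact if_neg hp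
  · rw [extend_of_not_surjective _ (not_surjective_comp _ hs), ← family_eq_top]
    have := (b.simplex s hs : TrivializedSimplex z N ⦋p⦌).isNormalized p q h j (𝟙 _)
    rwa [Category.comp_id] at this

/-- On simplices of the boundary, the total differential of the extension is the one prescribed by
the boundary family. -/
lemma extend_totalD_eq {σ : H.I.obj (op ⦋n⦌)}
    (hσ : ∀ {m : SimplexCategory} (s : m ⟶ ⦋n⦌) hs,
      H.I.map s.op σ = TrivializedSimplex.simplex (b.simplex s hs))
    {p : ℕ} {q : ℤ} (h : p + q = N) (s : ⦋p⦌ ⟶ ⦋n⦌) (hs : ¬ Function.Surjective s.toOrderHom)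
    {W' : Opens X} (hW' : W' ≤ (top b s hs).1) :
    (extend b W A).totalD p s q W' = (H.family z σ ⦋p⦌ s).at (q + 1) W' := by
  let τ : TrivializedSimplex z N ⦋p⦌ := b.simplex s hs
  have h1 := τ.totalD_eq p q h (𝟙 _)
  have h2 := congrArg (K.res (show W' ≤ (τ.family ⦋p⦌ (𝟙 _)).1 from hW')) h1
  rw [LocallyAcyclic.Family.res_totalD τ.isMono _ _ _ le_rfl,
    LocallyAcyclic.LocalSection.res_at _ _ _ (τ.le _)] at h2
  have h3 : H.family z σ ⦋p⦌ s = H.family z τ.simplex ⦋p⦌ (𝟙 _) := by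
    rw [← hσ s hs, family_map]
    unfold LocallyAcyclic.Family.pull
    rw [Category.id_comp]
  rw [h3, ← h2]
  have h4 : ∀ (p' : ℕ) (θ : ⦋p'⦌ ⟶ ⦋p⦌), extend b W A ⦋p'⦌ (θ ≫ s) = τ.family ⦋p'⦌ θ := by
    intro p' θ
    rw [extend_of_not_surjective _ (not_surjective_comp θ hs), ← family_eq_top]
  have h5 := h4 p (𝟙 _)
  rw [Category.id_comp] at h5
  unfold LocallyAcyclic.Family.totalD
  rw [h5]
  rcases p with _ | p
  · rfl
  · simp only [altFace, h4, Category.comp_id]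

/-- The boundary of a simplex is generated by finitely many faces, so that the open subsets of a
boundary family contain a common neighbourhood of each of their common points. -/
lemma exists_le_top {x : X} (σ : H.I.obj (op ⦋n⦌)) (hx : x ∈ H.V σ)
    (hb : ∀ {m : SimplexCategory} (s : m ⟶ ⦋n⦌) hs, x ∈ (top b s hs).1) :
    ∃ W : Opens X, x ∈ W ∧ W ≤ H.V σ ∧
      ∀ {m : SimplexCategory} (s : m ⟶ ⦋n⦌) hs, W ≤ (top b s hs).1 := by
  rcases n with _ | n
  · refine ⟨H.V σ, hx, le_rfl, fun s hs => (hs fun y => ⟨0, ?_⟩).elim⟩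
    exact Subsingleton.elim (α := Fin 1) _ _
  · let T : Opens X := ⟨⋂ i : Fin (n + 2), (top b (SimplexCategory.δ i) (not_surjective_δ i)).1,
      isOpen_iInter_of_finite fun i => (top b (SimplexCategory.δ i) (not_surjective_δ i)).1.2⟩
    refine ⟨H.V σ ⊓ T, ⟨hx, Set.mem_iInter.2 fun i => hb _ _⟩, inf_le_left, fun {m} s hs => ?_⟩
    obtain ⟨i, θ, rfl⟩ := SimplexCategory.eq_comp_δ_of_not_surjective s hs
    have h1 : T ≤ (top b (SimplexCategory.δ i) (not_surjective_δ i)).1 :=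
      fun y hy => Set.mem_iInter.1 hy i
    refine (inf_le_right.trans h1).trans ?_
    rw [← family_eq_top b θ _ (not_surjective_δ i)]
    simpa [top] using
      TrivializedSimplex.isMono (b.simplex (SimplexCategory.δ i) (not_surjective_δ i)) θ (𝟙 _)

/-- The lifting property behind the universal hypercover: if `z` is a cocycle, local acyclicity
of `K` extends a trivialization of `z` from the boundary of a simplex to the simplex, after
shrinking around a point. -/
lemma exists_extension
    (hznorm : ∀ {k : SimplexCategory} (σ : H.I.obj (op k)), (H.family z σ).IsNormalized (N + 1))
    (hzcocycle : ∀ (p : ℕ) (q : ℤ), p + q = N + 1 → ∀ σ : H.I.obj (op ⦋p⦌),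
      (H.family z σ).totalD p (𝟙 _) q (H.V σ) = 0)
    {x : X} (σ : H.I.obj (op ⦋n⦌)) (hx : x ∈ H.V σ)
    (hσ : ∀ {m : SimplexCategory} (s : m ⟶ ⦋n⦌) hs,
      H.I.map s.op σ = TrivializedSimplex.simplex (b.simplex s hs))
    (hb : ∀ {m : SimplexCategory} (s : m ⟶ ⦋n⦌) hs, x ∈ (top b s hs).1) :
    ∃ τ : TrivializedSimplex z N ⦋n⦌, x ∈ (τ.family ⦋n⦌ (𝟙 _)).1 ∧
      ∀ {m : SimplexCategory} (s : m ⟶ ⦋n⦌) hs, τ.pull s = b.simplex s hs := by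
  obtain ⟨W, hxW, hWσ, hWb⟩ := exists_le_top σ hx hb
  obtain ⟨q, hq⟩ : ∃ q : ℤ, n + q = N := ⟨N - n, by lia⟩
  let t₀ := extend b W (fun _ => 0)
  have hfam : (H.family z σ ⦋n⦌ (𝟙 _)).1 = H.V σ := by
    change H.V (H.I.map (𝟙 _) σ) = _
    simp
  have hWfam : W ≤ (H.family z σ ⦋n⦌ (𝟙 _)).1 := hWσ.trans hfam.ge
  -- the obstruction to extending the trivialization, which is a cocycle
  let c : K.C (q + 1) W := (H.family z σ ⦋n⦌ (𝟙 _)).at (q + 1) W -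
    altFace (fun p s => (t₀ ⦋p⦌ s).at (q + 1) W) n (𝟙 _)
  have hc : K.d (q + 1) W c = 0 := by
    have h1 := LocallyAcyclic.Family.altFace_totalD t₀ n (𝟙 _) (q + 1) W
    rw [altFace_congr (g' := fun p s => (H.family z σ ⦋p⦌ s).at (q + 1 + 1) W) (𝟙 _)
      (fun p' s' hp' hs' => extend_totalD_eq hσ (by lia) s' (hs' (Or.inr le_rfl))
        (hWb _ _))] at h1
    have h2 := congrArg (K.res hWσ) (hzcocycle n (q + 1) (by lia) σ)
    rw [map_zero, LocallyAcyclic.Family.res_totalD (family_isMono z σ) _ _ _ hfam.ge] at h2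
    unfold LocallyAcyclic.Family.totalD at h2
    rw [h1, ← smul_neg, ← smul_add, ← sub_eq_neg_add, ← map_sub] at h2
    have h3 := congrArg (fun y => (-1 : ℤ) ^ n • y) h2
    simpa only [smul_smul, ← mul_pow, neg_mul_neg, one_mul, one_pow, one_smul, smul_zero] using h3
  obtain ⟨W', hxW', hW', a, ha⟩ := K.exact hxW c hc
  -- the sign is the one of the vertical part of the total differential in column `n`
  let A : ∀ q' : ℤ, K.C q' W' := Pi.single q ((-1 : ℤ) ^ n • a)
  have hWb' : ∀ {m : SimplexCategory} (s : m ⟶ ⦋n⦌) hs, W' ≤ (top b s hs).1 :=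
    fun s hs => hW'.trans (hWb s hs)
  have hmono : (extend b W' A).IsMono := extend_isMono hWb'
  refine ⟨⟨σ, extend b W' A, ?_, hmono, extend_isNormalized, ?_⟩, ?_, ?_⟩
  · intro m s
    by_cases hs : Function.Surjective s.toOrderHom
    · rw [extend_fst s hs]
      exact (hW'.trans hWσ).trans (H.V_le_map _ _)
    · rw [extend_of_not_surjective s hs, hσ s hs]
      have := TrivializedSimplex.le (b.simplex s hs) (𝟙 m)
      refine this.trans (le_of_eq ?_)
      simp
  · intro p q' hp s
    by_cases hs : Function.Surjective s.toOrderHom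
    swap
    · refine extend_totalD_eq hσ hp s hs (le_of_eq ?_)
      rw [extend_of_not_surjective s hs]
    have hepi := SimplexCategory.epi_iff_surjective.2 hs
    rw [extend_fst s hs]
    rcases (SimplexCategory.le_of_epi s).eq_or_lt with rfl | hlt
    · obtain rfl := SimplexCategory.eq_id_of_epi s
      obtain rfl : q' = q := by lia
      unfold LocallyAcyclic.Family.totalD
      have h1 : (extend b W' A ⦋n⦌ (𝟙 _)).at q' W' = (-1 : ℤ) ^ n • a := by
        rw [extend_id]
        refine (LocallyAcyclic.LocalSection.at_self _ _).trans ?_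
        exact Pi.single_eq_same _ _
      have h2 : altFace (fun p s => (extend b W' A ⦋p⦌ s).at (q' + 1) W') n (𝟙 _) =
          K.res hW' (altFace (fun p s => (t₀ ⦋p⦌ s).at (q' + 1) W) n (𝟙 _)) := by
        rw [LocallyAcyclic.Family.res_altFace (extend_isMono hWb) _ _ _
          (by rw [extend_id])]
        refine altFace_congr _ fun p' s' _ hs' => ?_
        have := hs' (Or.inr le_rfl)
        rw [extend_of_not_surjective _ this, extend_of_not_surjective _ this]
      rw [h1, h2, map_zsmul, ha, smul_smul, ← mul_pow, neg_mul_neg, one_mul, one_pow, one_smul,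
        map_sub, LocallyAcyclic.LocalSection.res_at _ _ _ hWfam]
      abel
    · -- a surjection from a simplex of larger dimension is degenerate: both sides vanish
      obtain ⟨p, rfl⟩ : ∃ p', p = p' + 1 := ⟨p - 1, by lia⟩
      have hinj : ¬ Function.Injective s.toOrderHom := by
        intro hinj
        have := SimplexCategory.mono_iff_injective.2 hinj
        have := SimplexCategory.len_le_of_mono s
        simp at this
        lia
      obtain ⟨j, s', rfl⟩ := SimplexCategory.eq_σ_comp_of_not_injective s hinj
      rw [LocallyAcyclic.Family.totalD_degenerate extend_isNormalized hp]
      exact (LocallyAcyclic.LocalSection.at_eq_zero _ _ _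
        (hznorm σ p (q' + 1) (by lia) j s')).symm
  · change x ∈ (extend b W' A ⦋n⦌ (𝟙 _)).1
    rw [extend_id]
    exact hxW'
  · intro m s hs
    refine TrivializedSimplex.ext (hσ s hs) ?_
    funext m' θ
    change extend b W' A m' (θ ≫ s) = _
    rw [extend_of_not_surjective _ (not_surjective_comp θ hs)]
    exact (family_eq_top b θ s hs).symm

end TrivializedSimplex

end OpenHypercover

/-! ### The hypercover of trivialized simplices -/

namespace OpenHypercover

variable {U : Opens X} {H : OpenHypercover X U} {K : LocallyAcyclic X}
  {z : ∀ (m : SimplexCategory) (σ : H.I.obj (op m)) (q : ℤ), K.C q (H.V σ)} {N : ℤ}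

section

variable (hznorm : ∀ {k : SimplexCategory} (σ : H.I.obj (op k)),
    (H.family z σ).IsNormalized (N + 1))
  (hzcocycle : ∀ (p : ℕ) (q : ℤ), p + q = N + 1 → ∀ σ : H.I.obj (op ⦋p⦌),
    (H.family z σ).totalD p (𝟙 _) q (H.V σ) = 0)

/-- The universal hypercover refining `H` on which the normalized cocycle `z` becomes the
total differential of a normalized cochain. -/
def trivialized : OpenHypercover X U where
  I := trivializedIndex z N
  V {m} τ := (TrivializedSimplex.family τ m (𝟙 m)).1
  V_le_map {m n} θ τ := by
    change _ ≤ (TrivializedSimplex.family τ m (𝟙 m ≫ θ)).1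
    simpa using TrivializedSimplex.isMono τ θ (𝟙 n)
  V_le {n} τ := (TrivializedSimplex.le τ (𝟙 n)).trans (H.V_le _)
  covers n b x hx hb := by
    refine covers_of_exists_filler
      (V := fun {m} (τ : TrivializedSimplex z N m) => (τ.family m (𝟙 m)).1) (fun b' hb' => ?_) b hb
    let b₀ : BoundaryFamily H.I n :=
      { simplex := fun s hs => TrivializedSimplex.simplex (b'.simplex s hs)
        map_simplex := fun θ s hs hs' =>
          congrArg TrivializedSimplex.simplex (b'.map_simplex θ s hs hs') }
    obtain ⟨σ, hxσ, hσ⟩ := H.exists_filler b₀ hx (fun {m} s hs => by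
      have h := TrivializedSimplex.le (b'.simplex s hs) (𝟙 m) (hb' s hs)
      rw [op_id, Functor.map_id_apply] at h
      exact h)
    obtain ⟨τ, hτ, hb⟩ := TrivializedSimplex.exists_extension hznorm hzcocycle σ hxσ hσ hb'
    exact ⟨τ, hτ, hb⟩

/-- The projection from the universal refinement. -/
def trivializedRefinement : Refinement (trivialized hznorm hzcocycle) H where
  map :=
    { app := fun _ => TypeCat.ofHom fun τ => TrivializedSimplex.simplex τ
      naturality := fun _ _ _ => rfl }
  le {m} τ := by
    have h := TrivializedSimplex.le τ (𝟙 m)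
    rw [op_id, Functor.map_id_apply] at h
    exact h

/-- The tautological cochain on the universal refinement. -/
def trivializingCochain (m : SimplexCategory)
    (τ : (trivialized hznorm hzcocycle).I.obj (op m)) (q : ℤ) :
    K.C q ((trivialized hznorm hzcocycle).V τ) :=
  (TrivializedSimplex.family τ m (𝟙 m)).2 q

lemma family_trivializingCochain {k : SimplexCategory}
    (τ : (trivialized hznorm hzcocycle).I.obj (op k)) :
    (trivialized hznorm hzcocycle).family (trivializingCochain hznorm hzcocycle) τ =
      TrivializedSimplex.family τ := by
  funext m s
  change TrivializedSimplex.family τ m (𝟙 m ≫ s) = _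
  rw [Category.id_comp]

end

lemma family_at {m k : SimplexCategory} (s : m ⟶ k) (σ : H.I.obj (op k)) {σ' : H.I.obj (op m)}
    (e : H.I.map s.op σ = σ') (q : ℤ) {W : Opens X} (hW : W ≤ H.V σ') :
    (H.family z σ m s).at q W = K.res hW (z m σ' q) := by
  subst e
  exact LocallyAcyclic.LocalSection.at_eq _ _ _

lemma family_totalD_zero (σ : H.I.obj (op ⦋0⦌)) (q : ℤ) :
    (H.family z σ).totalD 0 (𝟙 _) q (H.V σ) = K.d q _ (z _ σ q) := by
  unfold LocallyAcyclic.Family.totalD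
  rw [family_at (𝟙 _) σ (σ' := σ) (by simp) q le_rfl, K.res_self]
  simp [altFace]

lemma family_totalD_succ {p : ℕ} (σ : H.I.obj (op ⦋p + 1⦌)) (q : ℤ) :
    (H.family z σ).totalD (p + 1) (𝟙 _) q (H.V σ) =
      ∑ i : Fin (p + 2), (-1 : ℤ) ^ (i : ℕ) •
        K.res (H.V_le_map (SimplexCategory.δ i) σ) (z _ (H.face i σ) (q + 1)) +
      (-1 : ℤ) ^ (p + 1) • K.d q _ (z _ σ q) := by
  unfold LocallyAcyclic.Family.totalD
  rw [family_at (𝟙 _) σ (σ' := σ) (by simp) q le_rfl, K.res_self]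
  congr 1
  refine Finset.sum_congr rfl fun i _ => congrArg _ ?_
  exact family_at _ _ (by simp) _ _

/-- Every normalized cocycle with values in a locally acyclic complex becomes the total
differential of a normalized cochain on a refinement. -/
lemma exists_trivializing_refinement
    (hznorm : ∀ {k : SimplexCategory} (σ : H.I.obj (op k)), (H.family z σ).IsNormalized (N + 1))
    (hzcocycle : ∀ (p : ℕ) (q : ℤ), p + q = N + 1 → ∀ σ : H.I.obj (op ⦋p⦌),
      (H.family z σ).totalD p (𝟙 _) q (H.V σ) = 0) :
    ∃ (H' : OpenHypercover X U) (r : Refinement H' H)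
      (α : ∀ (m : SimplexCategory) (σ : H'.I.obj (op m)) (q : ℤ), K.C q (H'.V σ)),
      (∀ (p : ℕ) (q : ℤ), ((p + 1 : ℕ) : ℤ) + q = N → ∀ (j : Fin (p + 1)) (σ : H'.I.obj (op ⦋p⦌)),
        α _ (H'.degen j σ) q = 0) ∧
      ∀ (p : ℕ) (q : ℤ), p + q = N → ∀ σ : H'.I.obj (op ⦋p⦌),
        (H'.family α σ).totalD p (𝟙 _) q (H'.V σ) =
          K.res (r.le σ) (z _ (r.map.app (op ⦋p⦌) σ) (q + 1)) := by
  refine ⟨trivialized hznorm hzcocycle, trivializedRefinement hznorm hzcocycle,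
    trivializingCochain hznorm hzcocycle, ?_, ?_⟩
  · intro p q h j τ
    have := TrivializedSimplex.isNormalized τ p q h j (𝟙 _)
    rwa [Category.comp_id, ← Category.id_comp (SimplexCategory.σ j)] at this
  · intro p q h τ
    rw [family_trivializingCochain]
    refine (TrivializedSimplex.totalD_eq τ p q h (𝟙 _)).trans ?_
    exact family_at _ _ (by rw [op_id, Functor.map_id_apply]; rfl) _ _

end OpenHypercover

/-! ### Trivializing cocycles of the cone of a weak equivalence -/

section Cone

variable {F G : PshCh X R} {f : F ⟶ G}

/-- The mapping cone of a weak equivalence, as a locally acyclic complex. -/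
def IsLocalWeakEquiv.cone (hf : IsLocalWeakEquiv f) : LocallyAcyclic X where
  C q W := Sec F (q + 1) W × Sec G q W
  res h := ((res F h).toAddMonoidHom).prodMap ((res G h).toAddMonoidHom)
  d q W := AddMonoidHom.prod
    (-((secD F (q + 1) (q + 1 + 1) W).toAddMonoidHom.comp (AddMonoidHom.fst _ _)))
    ((secMap f (q + 1) W).toAddMonoidHom.comp (AddMonoidHom.fst _ _) +
      (secD G q (q + 1) W).toAddMonoidHom.comp (AddMonoidHom.snd _ _))
  res_self h x := Prod.ext (res_self F h x.1) (res_self G h x.2)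
  res_res h' h x := Prod.ext (res_res F h' h x.1) (res_res G h' h x.2)
  d_res h x := by
    refine Prod.ext ?_ ?_
    · simp [secD_res]
    · simp [secD_res, secMap_res]
  d_d x := by
    refine Prod.ext ?_ ?_
    · simp
    · simp [secD_secMap]
  exact {q W x} hx z hz := by
    obtain ⟨b, c⟩ := z
    have h1 : secD F (q + 1 + 1) (q + 1 + 1 + 1) W b = 0 :=
      neg_eq_zero.1 (congrArg Prod.fst hz)
    have h2 : secMap f (q + 1 + 1) W b + secD G (q + 1) (q + 1 + 1) W c = 0 :=
      congrArg Prod.snd hz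
    obtain ⟨W', hx', h, a, e, ha, he⟩ := hf.locally_exact (q₀ := q) rfl rfl hx b (-c) h1
      (by rw [map_neg, ← add_eq_zero_iff_eq_neg, h2])
    refine ⟨W', hx', h, (-a, e), Prod.ext ?_ ?_⟩
    · change -(secD F (q + 1) (q + 1 + 1) W' (-a)) = res F h b
      rw [map_neg, neg_neg, ha]
    · change secMap f (q + 1) W' (-a) + secD G q (q + 1) W' e = res G h c
      rw [← he, map_neg, map_neg]
      abel

namespace IsLocalWeakEquiv

variable (hf : IsLocalWeakEquiv f) {q : ℤ} {W W' : Opens X}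

/-- The first component of a section of the mapping cone. -/
def coneFst {q' : ℤ} (h : q + 1 = q') : hf.cone.C q W →+ Sec F q' W :=
  h ▸ (AddMonoidHom.fst _ _ : Sec F (q + 1) W × Sec G q W →+ Sec F (q + 1) W)

/-- The second component of a section of the mapping cone. -/
def coneSnd : hf.cone.C q W →+ Sec G q W :=
  (AddMonoidHom.snd _ _ : Sec F (q + 1) W × Sec G q W →+ Sec G q W)

lemma cone_ext {x y : hf.cone.C q W} (h₁ : hf.coneFst rfl x = hf.coneFst rfl y)
    (h₂ : hf.coneSnd x = hf.coneSnd y) : x = y := Prod.ext h₁ h₂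

lemma coneFst_res {q' : ℤ} (h : q + 1 = q') (hW : W' ≤ W) (x : hf.cone.C q W) :
    hf.coneFst h (hf.cone.res hW x) = res F hW (hf.coneFst h x) := by
  subst h; rfl

lemma coneSnd_res (hW : W' ≤ W) (x : hf.cone.C q W) :
    hf.coneSnd (hf.cone.res hW x) = res G hW (hf.coneSnd x) := rfl

lemma coneFst_d {q' q'' : ℤ} (h : q + 1 = q') (h' : q + 1 + 1 = q'') (x : hf.cone.C q W) :
    hf.coneFst h' (hf.cone.d q W x) = -secD F q' q'' W (hf.coneFst h x) := by
  subst h; subst h'; rfl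

lemma coneSnd_d (x : hf.cone.C q W) :
    hf.coneSnd (hf.cone.d q W x) =
      secMap f (q + 1) W (hf.coneFst rfl x) + secD G q (q + 1) W (hf.coneSnd x) := rfl

end IsLocalWeakEquiv

namespace OpenHypercover

variable {U : Opens X} {H : OpenHypercover X U}

/-- The cochain with values in the mapping cone given by a pair of total cochains. The signs
turn the total differential of the cone into the total differentials of the two components. The
values are zero in bidegrees of total degree other than `N + 1`. -/
def coneCochain (hf : IsLocalWeakEquiv f) {N : ℤ} (b : H.Tot F (N + 1 + 1)) (c : H.Tot G (N + 1))
    (m : SimplexCategory) (σ : H.I.obj (op m)) (q : ℤ) : hf.cone.C q (H.V σ) :=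
  if h : (m.len : ℤ) + q = N + 1 then
    ((-1 : ℤ) ^ m.len • totApp b m.len (q + 1) (by lia) σ, -totApp c m.len q h σ)
  else 0

section

variable (hf : IsLocalWeakEquiv f) {N : ℤ} (b : H.Tot F (N + 1 + 1))
    (c : H.Tot G (N + 1)) {p : ℕ} (σ : H.I.obj (op ⦋p⦌)) {q : ℤ}

lemma coneFst_coneCochain (h : p + q = N + 1) {q' : ℤ} (h' : q + 1 = q') :
    hf.coneFst h' (coneCochain hf b c ⦋p⦌ σ q) = (-1 : ℤ) ^ p • totApp b p q' (by lia) σ := by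
  subst h'
  exact congrArg Prod.fst (dif_pos h)

lemma coneSnd_coneCochain (h : p + q = N + 1) :
    hf.coneSnd (coneCochain hf b c ⦋p⦌ σ q) = -totApp c p q h σ :=
  congrArg Prod.snd (dif_pos h)

end

lemma neg_one_pow_smul_self {A : Type*} [AddCommGroup A] (p : ℕ) (x : A) :
    (-1 : ℤ) ^ p • (-1 : ℤ) ^ p • x = x := by
  rw [smul_smul, ← mul_pow]
  simp

lemma coneCochain_isNormalized (hf : IsLocalWeakEquiv f) {N : ℤ}
    {b : H.Tot F (N + 1 + 1)} {c : H.Tot G (N + 1)} (hbn : IsNormalized b) (hcn : IsNormalized c)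
    {k : SimplexCategory} (σ : H.I.obj (op k)) :
    (H.family (coneCochain hf b c) σ).IsNormalized (N + 1) := by
  intro p q h j s
  change coneCochain hf b c ⦋p + 1⦌ (H.I.map (SimplexCategory.σ j ≫ s).op σ) q = 0
  have e : H.I.map (SimplexCategory.σ j ≫ s).op σ = H.degen j (H.I.map s.op σ) := by
    rw [op_comp, Functor.map_comp_apply]
  have key : ∀ τ : H.I.obj (op ⦋p + 1⦌), τ = H.degen j (H.I.map s.op σ) →
      coneCochain hf b c ⦋p + 1⦌ τ q = 0 := by
    rintro _ rfl
    refine hf.cone_ext ?_ ?_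
    · rw [coneFst_coneCochain hf b c _ h, hbn p (q + 1) (by lia) j, smul_zero, map_zero]
    · rw [coneSnd_coneCochain hf b c _ h, hcn p q h j, neg_zero, map_zero]
  exact key _ e

lemma coneCochain_totalD (hf : IsLocalWeakEquiv f) {N : ℤ}
    {b : H.Tot F (N + 1 + 1)} {c : H.Tot G (N + 1)} (hb : H.totD F _ b = 0)
    (hbc : H.totMap f _ b = H.totD G _ c) (p : ℕ) (q : ℤ) (h : p + q = N + 1)
    (σ : H.I.obj (op ⦋p⦌)) :
    (H.family (coneCochain hf b c) σ).totalD p (𝟙 _) q (H.V σ) = 0 := by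
  have h1 := congrArg (fun x => totApp x p (q + 1 + 1) (by lia) σ) hb
  have h2 := congrArg (fun x => totApp x p (q + 1) (by lia) σ) hbc
  simp only [totApp_totMap, totApp_zero] at h1 h2
  rcases p with _ | p
  · rw [family_totalD_zero]
    rw [totApp_totD_zero _ rfl _ (by lia)] at h1 h2
    refine hf.cone_ext ?_ ?_
    · rw [hf.coneFst_d rfl rfl, coneFst_coneCochain hf b c _ h, pow_zero, one_smul, h1,
        neg_zero, map_zero]
    · rw [hf.coneSnd_d, coneFst_coneCochain hf b c _ h, coneSnd_coneCochain hf b c _ h,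
        pow_zero, one_smul, h2, map_neg, add_neg_cancel, map_zero]
  · rw [family_totalD_succ]
    have h' : (p : ℤ) + (q + 1) = N + 1 := by push_cast at h; lia
    rw [totApp_totD_succ _ _ rfl _ (by lia) (by lia)] at h1 h2
    refine hf.cone_ext ?_ ?_
    · simp only [map_add, map_sum, map_zsmul, hf.coneFst_res, hf.coneFst_d rfl rfl,
        coneFst_coneCochain hf b c _ h, coneFst_coneCochain hf b c _ h', map_zero]
      rw [smul_neg, neg_one_pow_smul_self]
      simp only [smul_comm _ ((-1 : ℤ) ^ p)]
      have h3 := congrArg (fun y => (-1 : ℤ) ^ p • y) h1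
      simp only [smul_add, smul_zero, Finset.smul_sum, pow_succ, mul_neg_one, neg_smul,
        smul_neg, neg_one_pow_smul_self] at h3
      exact h3
    · simp only [map_add, map_sum, map_zsmul, hf.coneSnd_res, hf.coneSnd_d,
        coneFst_coneCochain hf b c _ h, coneSnd_coneCochain hf b c _ h,
        coneSnd_coneCochain hf b c _ h', map_zero, map_neg, smul_add, smul_neg,
        Finset.sum_neg_distrib, neg_one_pow_smul_self, h2]
      abel

/-- A normalized cocycle of the mapping cone of a weak equivalence becomes the coboundary of a
normalized cochain on a refinement of the hypercover. -/
theorem exists_refinement_of_isLocalWeakEquiv (hf : IsLocalWeakEquiv f) {N : ℤ}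
    (b : H.Tot F (N + 1 + 1)) (c : H.Tot G (N + 1)) (hb : H.totD F _ b = 0)
    (hbc : H.totMap f _ b = H.totD G _ c) (hbn : IsNormalized b) (hcn : IsNormalized c) :
    ∃ (H' : OpenHypercover X U) (r : Refinement H' H) (a : H'.Tot F (N + 1)) (e : H'.Tot G N),
      IsNormalized a ∧ H'.totD F _ a = r.pull F _ b ∧
        H'.totMap f _ a - r.pull G _ c = H'.totD G _ e := by
  obtain ⟨H', r, α, hα, hαz⟩ := exists_trivializing_refinement
    (coneCochain_isNormalized hf hbn hcn) (coneCochain_totalD hf hb hbc)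
  -- the sign turns the first component of the equation for `α` into `D a = b`
  obtain ⟨a, ha⟩ : ∃ a : H'.Tot F (N + 1), ∀ (p : ℕ) (q q' : ℤ) (hq : q + 1 = q')
      (h : p + q' = N + 1) (σ : H'.I.obj (op ⦋p⦌)),
      totApp a p q' h σ = (-1 : ℤ) ^ (p + 1) • hf.coneFst hq (α ⦋p⦌ σ q) := by
    refine ⟨totMk fun p q h σ =>
      (-1 : ℤ) ^ (p + 1) • hf.coneFst (show q - 1 + 1 = q by lia) (α ⦋p⦌ σ (q - 1)), ?_⟩
    intro p q q' hq h σ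
    obtain rfl : q = q' - 1 := by lia
    rfl
  obtain ⟨e, he⟩ : ∃ e : H'.Tot G N, ∀ (p : ℕ) (q : ℤ) (h : p + q = N) (σ : H'.I.obj (op ⦋p⦌)),
      totApp e p q h σ = hf.coneSnd (α ⦋p⦌ σ q) :=
    ⟨totMk fun p q h σ => hf.coneSnd (α ⦋p⦌ σ q), fun _ _ _ _ => rfl⟩
  refine ⟨H', r, a, e, ?_, ?_, ?_⟩
  · intro p q h j σ
    rw [ha _ (q - 1) q (by omega), hα p (q - 1) (by omega), map_zero, smul_zero]
  · refine tot_ext fun p q h σ => ?_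
    obtain ⟨q, rfl⟩ : ∃ q' : ℤ, q = q' + 1 + 1 := ⟨q - 1 - 1, by omega⟩
    have hp : (p : ℤ) + q = N := by omega
    have h1 := congrArg (hf.coneFst rfl) (hαz p q hp σ)
    rw [hf.coneFst_res] at h1
    rw [coneFst_coneCochain hf b c _ (by omega)] at h1
    rcases p with _ | p
    · rw [family_totalD_zero, hf.coneFst_d rfl rfl] at h1
      rw [totApp_totD_zero _ rfl _ (by omega), ha _ q _ rfl, Refinement.totApp_pull]
      simpa using h1
    · rw [family_totalD_succ] at h1
      rw [totApp_totD_succ _ _ rfl _ (by omega) (by push_cast at hp; omega), ha _ q _ rfl,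
        Refinement.totApp_pull]
      have h' : (p : ℤ) + (q + 1 + 1) = N + 1 := by push_cast at hp; omega
      simp only [ha p (q + 1) _ rfl h']
      simp only [map_add, map_sum, map_zsmul, hf.coneFst_res, hf.coneFst_d rfl rfl] at h1
      have h3 := congrArg (fun y => (-1 : ℤ) ^ (p + 1) • y) h1
      simp only [neg_one_pow_smul_self, smul_add, Finset.smul_sum, smul_neg] at h3
      rw [← h3]
      simp only [map_neg, map_zsmul, pow_succ _ (p + 1), mul_neg_one, neg_smul, smul_neg,
        neg_one_pow_smul_self]
      congr 1
      exact Finset.sum_congr rfl fun i _ => smul_comm _ _ _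
  · refine tot_ext fun p q h σ => ?_
    obtain ⟨q, rfl⟩ : ∃ q' : ℤ, q = q' + 1 := ⟨q - 1, by omega⟩
    have hp : (p : ℤ) + q = N := by omega
    have h1 := congrArg hf.coneSnd (hαz p q hp σ)
    rw [hf.coneSnd_res] at h1
    rw [coneSnd_coneCochain hf b c _ (by omega), map_neg] at h1
    rw [totApp_sub, totApp_totMap, Refinement.totApp_pull, ha p q _ rfl, sub_eq_add_neg, ← h1,
      map_zsmul]
    rcases p with _ | p
    · rw [family_totalD_zero, hf.coneSnd_d, totApp_totD_zero _ rfl _ (by omega), he]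
      simp
    · rw [family_totalD_succ, totApp_totD_succ _ _ rfl _ (by omega) (by push_cast at hp; omega)]
      simp only [map_add, map_sum, map_zsmul, hf.coneSnd_res, hf.coneSnd_d, he]
      rw [smul_add, pow_succ _ (p + 1), mul_neg_one, neg_smul]
      abel

end OpenHypercover

end Cone

/-! ### Comparison of hypersheaves weakly equivalent to the same presheaf -/

namespace OpenHypercover

variable {U : Opens X} {H H' : OpenHypercover X U} {F G : PshCh X R} {n : ℤ}

/-- The product of two hypercovers of `U`, a common refinement. A pair of simplices indexes the
intersection of their open subsets. -/
def prod (H H' : OpenHypercover X U) : OpenHypercover X U where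
  I :=
    { obj := fun k => H.I.obj k × H'.I.obj k
      map := fun φ => TypeCat.ofHom fun σ => (H.I.map φ σ.1, H'.I.map φ σ.2)
      map_id := fun k => by
        refine ConcreteCategory.hom_ext _ _ fun σ => ?_
        exact Prod.ext (Functor.map_id_apply H.I k σ.1) (Functor.map_id_apply H'.I k σ.2)
      map_comp := fun φ ψ => by
        refine ConcreteCategory.hom_ext _ _ fun σ => ?_
        exact Prod.ext (Functor.map_comp_apply H.I φ ψ σ.1) (Functor.map_comp_apply H'.I φ ψ σ.2) }
  V σ := H.V σ.1 ⊓ H'.V σ.2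
  V_le_map θ σ := inf_le_inf (H.V_le_map θ σ.1) (H'.V_le_map θ σ.2)
  V_le σ := inf_le_left.trans (H.V_le σ.1)
  covers n b x hx hb := by
    refine covers_of_exists_filler
      (V := fun {m} (σ : H.I.obj (op m) × H'.I.obj (op m)) => H.V σ.1 ⊓ H'.V σ.2)
      (fun b' hb' => ?_) b hb
    obtain ⟨σ, hxσ, hσ⟩ := H.exists_filler
      { simplex := fun s hs => (b'.simplex s hs).1
        map_simplex := fun θ s hs hs' => congrArg Prod.fst (b'.map_simplex θ s hs hs') } hx
      (fun s hs => (hb' s hs).1)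
    obtain ⟨τ, hxτ, hτ⟩ := H'.exists_filler
      { simplex := fun s hs => (b'.simplex s hs).2
        map_simplex := fun θ s hs hs' => congrArg Prod.snd (b'.map_simplex θ s hs hs') } hx
      (fun s hs => (hb' s hs).2)
    exact ⟨(σ, τ), ⟨hxσ, hxτ⟩, fun s hs => Prod.ext (hσ s hs) (hτ s hs)⟩

/-- The first projection of a product of hypercovers. -/
def prodFst (H H' : OpenHypercover X U) : Refinement (prod H H') H where
  map :=
    { app := fun k => TypeCat.ofHom fun σ : H.I.obj k × H'.I.obj k => σ.1
      naturality := fun _ _ _ => rfl }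
  le σ := (inf_le_left : H.V σ.1 ⊓ H'.V σ.2 ≤ H.V σ.1)

/-- The second projection of a product of hypercovers. -/
def prodSnd (H H' : OpenHypercover X U) : Refinement (prod H H') H' where
  map :=
    { app := fun k => TypeCat.ofHom fun σ : H.I.obj k × H'.I.obj k => σ.2
      naturality := fun _ _ _ => rfl }
  le σ := (inf_le_right : H.V σ.1 ⊓ H'.V σ.2 ≤ H'.V σ.2)

/-- A total cochain is a coboundary if it is in the image of the total differential. -/
def IsCoboundary (y : H.Tot F n) : Prop :=
  ∃ (m : ℤ) (h : m + 1 = n) (w : H.Tot F m), h ▸ H.totD F m w = y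

lemma isCoboundary_iff {m : ℤ} {y : H.Tot F (m + 1)} :
    IsCoboundary y ↔ ∃ w : H.Tot F m, H.totD F m w = y := by
  constructor
  · rintro ⟨m', h, w, hw⟩
    obtain rfl : m' = m := by lia
    exact ⟨w, hw⟩
  · rintro ⟨w, hw⟩
    exact ⟨m, rfl, w, hw⟩

namespace IsCoboundary

lemma zero : IsCoboundary (0 : H.Tot F n) := by
  obtain ⟨m, rfl⟩ : ∃ m, n = m + 1 := ⟨n - 1, by lia⟩
  exact isCoboundary_iff.2 ⟨0, map_zero _⟩

lemma add {x y : H.Tot F n} (hx : IsCoboundary x) (hy : IsCoboundary y) :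
    IsCoboundary (x + y) := by
  obtain ⟨m, rfl⟩ : ∃ m, n = m + 1 := ⟨n - 1, by lia⟩
  obtain ⟨v, rfl⟩ := isCoboundary_iff.1 hx
  obtain ⟨w, rfl⟩ := isCoboundary_iff.1 hy
  exact isCoboundary_iff.2 ⟨v + w, map_add _ _ _⟩

lemma smul {x : H.Tot F n} (r : R) (hx : IsCoboundary x) : IsCoboundary (r • x) := by
  obtain ⟨m, rfl⟩ : ∃ m, n = m + 1 := ⟨n - 1, by lia⟩
  obtain ⟨v, rfl⟩ := isCoboundary_iff.1 hx
  exact isCoboundary_iff.2 ⟨r • v, map_smul _ _ _⟩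

lemma sub {x y : H.Tot F n} (hx : IsCoboundary x) (hy : IsCoboundary y) :
    IsCoboundary (x - y) := by
  simpa [sub_eq_add_neg] using hx.add (hy.smul (-1 : R))

lemma totMap {x : H.Tot F n} (hx : IsCoboundary x) (f : F ⟶ G) :
    IsCoboundary (H.totMap f n x) := by
  obtain ⟨m, rfl⟩ : ∃ m, n = m + 1 := ⟨n - 1, by lia⟩
  obtain ⟨v, rfl⟩ := isCoboundary_iff.1 hx
  exact isCoboundary_iff.2 ⟨H.totMap f m v, totD_totMap f v⟩

lemma pull {x : H.Tot F n} (hx : IsCoboundary x) (r : Refinement H' H) :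
    IsCoboundary (r.pull F n x) := by
  obtain ⟨m, rfl⟩ : ∃ m, n = m + 1 := ⟨n - 1, by lia⟩
  obtain ⟨v, rfl⟩ := isCoboundary_iff.1 hx
  exact isCoboundary_iff.2 ⟨r.pull F m v, r.totD_pull v⟩

lemma totAug {m : ℤ} (h : m + 1 = n) (x : Sec F m U) :
    IsCoboundary (H.totAug F n (secD F m n U x)) := by
  subst h
  exact isCoboundary_iff.2 ⟨H.totAug F m x, totD_totAug x⟩

end IsCoboundary

end OpenHypercover

open OpenHypercover

lemma IsHypersheaf.exists_secD_eq {F : PshCh X R} (hF : IsHypersheaf F) {U : Opens X}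
    (H : OpenHypercover X U) {m n : ℤ} (h : m + 1 = n) (x : Sec F n U)
    (hx : secD F n (n + 1) U x = 0) (hc : IsCoboundary (H.totAug F n x)) :
    ∃ w : Sec F m U, secD F m n U w = x := by
  subst h
  exact ((H.quasiIso_toHolim_iff F).1 (hF U H) m).1 x hx (isCoboundary_iff.1 hc)

lemma IsHypersheaf.exists_totAug {F : PshCh X R} (hF : IsHypersheaf F) {U : Opens X}
    {H : OpenHypercover X U} {n : ℤ} (y : H.Tot F n) (hy : H.totD F n y = 0) :
    ∃ x : Sec F n U, secD F n (n + 1) U x = 0 ∧ IsCoboundary (y - H.totAug F n x) := by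
  obtain ⟨m, rfl⟩ : ∃ m, n = m + 1 := ⟨n - 1, by lia⟩
  obtain ⟨x, hx, w, hw⟩ := ((H.quasiIso_toHolim_iff F).1 (hF U H) m).2 y hy
  exact ⟨x, hx, isCoboundary_iff.2 ⟨-w, by rw [map_neg, hw, neg_sub]⟩⟩

variable {F A B : PshCh X R} {U : Opens X} {n : ℤ}

/-- Cocycles of weakly equivalent presheaves come from normalized cocycles on a hypercover. -/
lemma IsLocalWeakEquiv.exists_tot {i : F ⟶ A} (hi : IsLocalWeakEquiv i) (a : Sec A n U)
    (ha : secD A n (n + 1) U a = 0) :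
    ∃ (H : OpenHypercover X U) (b : H.Tot F n), IsNormalized b ∧ H.totD F n b = 0 ∧
      IsCoboundary (H.totMap i n b - H.totAug A n a) := by
  obtain ⟨m, rfl⟩ : ∃ m, n = m + 1 := ⟨n - 1, by lia⟩
  obtain ⟨H, r, b, e, hbn, hb, he⟩ := exists_refinement_of_isLocalWeakEquiv hi
    (0 : (trivial U).Tot F (m + 1 + 1)) ((trivial U).totAug A (m + 1) a) (map_zero _)
    (by rw [totD_totAug, ha, map_zero, map_zero]) isNormalized_zero (isNormalized_totAug a)
  refine ⟨H, b, hbn, by rw [hb, map_zero], isCoboundary_iff.2 ⟨e, ?_⟩⟩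
  rw [← he, r.pull_totAug]

/-- A normalized cocycle which becomes a coboundary after applying a weak equivalence is a
coboundary on a refinement of the hypercover. -/
lemma IsLocalWeakEquiv.exists_pull_isCoboundary {i : F ⟶ A} (hi : IsLocalWeakEquiv i)
    {H : OpenHypercover X U} (b : H.Tot F n) (hbn : IsNormalized b) (hb : H.totD F n b = 0)
    (hib : IsCoboundary (H.totMap i n b)) :
    ∃ (H' : OpenHypercover X U) (r : Refinement H' H), IsCoboundary (r.pull F n b) := by
  obtain ⟨m, rfl⟩ : ∃ m, n = m + 1 + 1 := ⟨n - 1 - 1, by lia⟩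
  obtain ⟨w, hw⟩ := isCoboundary_iff.1 hib
  obtain ⟨H', r, a, e, -, ha, -⟩ := exists_refinement_of_isLocalWeakEquiv hi b (H.totNorm A _ w)
    hb (by rw [totD_totNorm, hw, (hbn.totMap i).totNorm_eq]) hbn (isNormalized_totNorm w)
  exact ⟨H', r, isCoboundary_iff.2 ⟨a, ha⟩⟩

/-- Two cocycles `a` and `k` of presheaves receiving maps `i` and `j` from `F` are related if they
are both represented by the same normalized total cocycle with values in `F` on some hypercover. -/
def Related (i : F ⟶ A) (j : F ⟶ B) (a : Sec A n U) (k : Sec B n U) : Prop :=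
  ∃ (H : OpenHypercover X U) (b : H.Tot F n), IsNormalized b ∧ H.totD F n b = 0 ∧
    IsCoboundary (H.totMap i n b - H.totAug A n a) ∧
    IsCoboundary (H.totMap j n b - H.totAug B n k)

namespace Related

variable {i : F ⟶ A} {j : F ⟶ B}

lemma symm {a : Sec A n U} {k : Sec B n U} (h : Related i j a k) : Related j i k a := by
  obtain ⟨H, b, h1, h2, h3, h4⟩ := h
  exact ⟨H, b, h1, h2, h4, h3⟩

lemma smul {a : Sec A n U} {k : Sec B n U} (r : R) (h : Related i j a k) :
    Related i j (r • a) (r • k) := by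
  obtain ⟨H, b, h1, h2, h3, h4⟩ := h
  refine ⟨H, r • b, h1.smul r, by rw [map_smul, h2, smul_zero], ?_, ?_⟩
  · rw [map_smul, map_smul, ← smul_sub]
    exact h3.smul r
  · rw [map_smul, map_smul, ← smul_sub]
    exact h4.smul r

lemma add {a a' : Sec A n U} {k k' : Sec B n U} (h : Related i j a k) (h' : Related i j a' k') :
    Related i j (a + a') (k + k') := by
  obtain ⟨H, b, h1, h2, h3, h4⟩ := h
  obtain ⟨H', b', h1', h2', h3', h4'⟩ := h'
  refine ⟨prod H H', (prodFst H H').pull F n b + (prodSnd H H').pull F n b',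
    (h1.pull _).add (h1'.pull _), ?_, ?_, ?_⟩
  · rw [map_add, Refinement.totD_pull, Refinement.totD_pull, h2, h2', map_zero, map_zero, add_zero]
  · have := (h3.pull (prodFst H H')).add (h3'.pull (prodSnd H H'))
    rw [map_sub, map_sub, Refinement.pull_totAug, Refinement.pull_totAug, sub_add_sub_comm,
      ← map_add] at this
    rwa [map_add, Refinement.totMap_pull, Refinement.totMap_pull]
  · have := (h4.pull (prodFst H H')).add (h4'.pull (prodSnd H H'))
    rw [map_sub, map_sub, Refinement.pull_totAug, Refinement.pull_totAug, sub_add_sub_comm,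
      ← map_add] at this
    rwa [map_add, Refinement.totMap_pull, Refinement.totMap_pull]

/-- A cocycle of `A` lifts to a total cocycle with values in `F`, whose image in the hypersheaf `B`
comes from a section. -/
lemma exists_right (hi : IsLocalWeakEquiv i) (hB : IsHypersheaf B) (a : Sec A n U)
    (ha : secD A n (n + 1) U a = 0) :
    ∃ k : Sec B n U, secD B n (n + 1) U k = 0 ∧ Related i j a k := by
  obtain ⟨H, b, h1, h2, h3⟩ := hi.exists_tot a ha
  obtain ⟨k, hk, h4⟩ := hB.exists_totAug (H.totMap j n b) (by rw [totD_totMap, h2, map_zero])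
  exact ⟨k, hk, H, b, h1, h2, h3, h4⟩

/-- A cocycle related to a coboundary is a coboundary: the total cocycle with values in `F` becomes
a coboundary on a refinement, which is again a hypercover to which the hypersheaf condition for
`B` applies. -/
lemma isCoboundary_right (hi : IsLocalWeakEquiv i) (hB : IsHypersheaf B) {m : ℤ} (hm : m + 1 = n)
    {a : Sec A n U} {k : Sec B n U} (h : Related i j a k) (hk : secD B n (n + 1) U k = 0)
    (ha : ∃ w : Sec A m U, secD A m n U w = a) : ∃ w : Sec B m U, secD B m n U w = k := by
  obtain ⟨H, b, h1, h2, h3, h4⟩ := h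
  obtain ⟨w, rfl⟩ := ha
  have h3' := h3.add (IsCoboundary.totAug hm w)
  rw [sub_add_cancel] at h3'
  obtain ⟨H', r, hr⟩ := hi.exists_pull_isCoboundary b h1 h2 h3'
  refine hB.exists_secD_eq H' hm k hk ?_
  have h5 := (hr.totMap j).sub (h4.pull r)
  rwa [map_sub, r.pull_totAug, r.totMap_pull, sub_sub_cancel] at h5

lemma map {F₁ A₁ B₁ : PshCh X R} {i₁ : F₁ ⟶ A₁} {j₁ : F₁ ⟶ B₁} {f : F ⟶ F₁} {f' : A ⟶ A₁}
    {g : B ⟶ B₁} (hf' : i ≫ f' = f ≫ i₁) (hg : j ≫ g = f ≫ j₁) {a : Sec A n U} {k : Sec B n U}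
    (h : Related i j a k) : Related i₁ j₁ (secMap f' n U a) (secMap g n U k) := by
  obtain ⟨H, b, h1, h2, h3, h4⟩ := h
  refine ⟨H, H.totMap f n b, h1.totMap f, by rw [totD_totMap, h2, map_zero], ?_, ?_⟩
  · have := h3.totMap f'
    rwa [map_sub, ← totMap_comp, hf', totMap_comp, totMap_totAug] at this
  · have := h4.totMap g
    rwa [map_sub, ← totMap_comp, hg, totMap_comp, totMap_totAug] at this

lemma of_section (i : F ⟶ A) (j : F ⟶ B) (x : Sec F n U) (hx : secD F n (n + 1) U x = 0) :
    Related i j (secMap i n U x) (secMap j n U x) := by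
  refine ⟨trivial U, (trivial U).totAug F n x, isNormalized_totAug x,
    by rw [totD_totAug, hx, map_zero], ?_, ?_⟩
  · rw [totMap_totAug, sub_self]
    exact IsCoboundary.zero
  · rw [totMap_totAug, sub_self]
    exact IsCoboundary.zero

end Related

/-- The correspondence between the cohomology of `A` and of `B` over `U` given by the cocycles of
`F` on hypercovers of `U`. -/
def cohomologyRelation (i : F ⟶ A) (j : F ⟶ B) (U : Opens X) (n : ℤ) :
    Submodule R ((A.obj (op U)).homology n × (B.obj (op U)).homology n) where
  carrier := {p | ∃ (a : Sec A n U) (k : Sec B n U) (ha : secD A n (n + 1) U a = 0)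
    (hk : secD B n (n + 1) U k = 0), Related i j a k ∧
      (cohomologyClass _ n a ha, cohomologyClass _ n k hk) = p}
  add_mem' := by
    rintro _ _ ⟨a, k, ha, hk, h, rfl⟩ ⟨a', k', ha', hk', h', rfl⟩
    refine ⟨a + a', k + k', by rw [map_add, ha, ha', add_zero], by rw [map_add, hk, hk', add_zero],
      h.add h', Prod.ext ?_ ?_⟩
    · exact cohomologyClass_add _ _ _ _ _
    · exact cohomologyClass_add _ _ _ _ _
  zero_mem' := by
    refine ⟨secMap i n U 0, secMap j n U 0, by simp, by simp,
      Related.of_section i j 0 (map_zero _), Prod.ext ?_ ?_⟩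
    · exact (cohomologyClass_eq_zero_iff (m := n - 1) (by lia) _ _).2
        ⟨0, (map_zero _).trans (map_zero _).symm⟩
    · exact (cohomologyClass_eq_zero_iff (m := n - 1) (by lia) _ _).2
        ⟨0, (map_zero _).trans (map_zero _).symm⟩
  smul_mem' := by
    rintro r _ ⟨a, k, ha, hk, h, rfl⟩
    refine ⟨r • a, r • k, by rw [map_smul, ha, smul_zero], by rw [map_smul, hk, smul_zero],
      h.smul r, Prod.ext ?_ ?_⟩
    · exact cohomologyClass_smul _ _ _ _
    · exact cohomologyClass_smul _ _ _ _

section Comparison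

variable {i : F ⟶ A} {j : F ⟶ B}

lemma cohomologyRelation_swap {u : (A.obj (op U)).homology n} {v : (B.obj (op U)).homology n}
    (h : (u, v) ∈ cohomologyRelation i j U n) : (v, u) ∈ cohomologyRelation j i U n := by
  obtain ⟨a, k, ha, hk, h, e⟩ := h
  exact ⟨k, a, hk, ha, h.symm, congrArg Prod.swap e⟩

lemma exists_mem_cohomologyRelation (hi : IsLocalWeakEquiv i) (hB : IsHypersheaf B)
    (u : (A.obj (op U)).homology n) : ∃ v, (u, v) ∈ cohomologyRelation i j U n := by
  obtain ⟨a, ha, rfl⟩ := cohomologyClass_surjective u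
  obtain ⟨k, hk, h⟩ := Related.exists_right (j := j) hi hB a ha
  exact ⟨cohomologyClass _ n k hk, a, k, ha, hk, h, rfl⟩

lemma eq_zero_of_mem_cohomologyRelation (hi : IsLocalWeakEquiv i) (hB : IsHypersheaf B)
    {v : (B.obj (op U)).homology n} (h : (0, v) ∈ cohomologyRelation i j U n) : v = 0 := by
  obtain ⟨a, k, ha, hk, h, e⟩ := h
  have h1 : cohomologyClass _ n a ha = 0 := congrArg Prod.fst e
  have h2 : cohomologyClass _ n k hk = v := congrArg Prod.snd e
  rw [← h2]
  exact (cohomologyClass_eq_zero_iff (m := n - 1) (by lia) _ hk).2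
    (h.isCoboundary_right hi hB (by lia) hk
      ((cohomologyClass_eq_zero_iff (m := n - 1) (by lia) _ ha).1 h1))

/-- The comparison isomorphism between the cohomology of two hypersheaves weakly equivalent to the
same presheaf. Its graph is the correspondence `cohomologyRelation`. -/
lemma exists_comparison (hi : IsLocalWeakEquiv i) (hj : IsLocalWeakEquiv j) (hA : IsHypersheaf A)
    (hB : IsHypersheaf B) (U : Opens X) (n : ℤ) :
    ∃ e : (A.obj (op U)).homology n ≅ (B.obj (op U)).homology n,
      ∀ u v, (u, v) ∈ cohomologyRelation i j U n ↔ e.hom.hom u = v := by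
  let ρ := cohomologyRelation i j U n
  have h1 : Function.Bijective ((LinearMap.fst R _ _).comp ρ.subtype) := by
    refine ⟨(injective_iff_map_eq_zero _).2 ?_, fun u => ?_⟩
    · rintro ⟨⟨u, v⟩, huv⟩ (rfl : u = 0)
      obtain rfl := eq_zero_of_mem_cohomologyRelation hi hB huv
      rfl
    · obtain ⟨v, hv⟩ := exists_mem_cohomologyRelation (j := j) hi hB u
      exact ⟨⟨(u, v), hv⟩, rfl⟩
  have h2 : Function.Bijective ((LinearMap.snd R _ _).comp ρ.subtype) := by
    refine ⟨(injective_iff_map_eq_zero _).2 ?_, fun v => ?_⟩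
    · rintro ⟨⟨u, v⟩, huv⟩ (rfl : v = 0)
      obtain rfl := eq_zero_of_mem_cohomologyRelation hj hA (cohomologyRelation_swap huv)
      rfl
    · obtain ⟨u, hu⟩ := exists_mem_cohomologyRelation (j := i) hj hA v
      exact ⟨⟨(u, v), cohomologyRelation_swap hu⟩, rfl⟩
  let e₁ := LinearEquiv.ofBijective _ h1
  let e₂ := LinearEquiv.ofBijective _ h2
  refine ⟨(e₁.symm.trans e₂).toModuleIso, fun u v => ?_⟩
  constructor
  · intro h
    have : e₁.symm u = ⟨(u, v), h⟩ := e₁.injective (by rw [e₁.apply_symm_apply]; rfl)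
    change e₂ (e₁.symm u) = v
    rw [this]
    rfl
  · rintro rfl
    have h3 : (e₁.symm u).1.1 = u := e₁.apply_symm_apply u
    have h4 := (e₁.symm u).2
    rw [← Prod.mk.eta (p := (e₁.symm u).1), h3] at h4
    exact h4

lemma map_mem_cohomologyRelation {F₁ A₁ B₁ : PshCh X R} {i₁ : F₁ ⟶ A₁} {j₁ : F₁ ⟶ B₁}
    {f : F ⟶ F₁} {f' : A ⟶ A₁} {g : B ⟶ B₁} (hf' : i ≫ f' = f ≫ i₁) (hg : j ≫ g = f ≫ j₁)
    {u : (A.obj (op U)).homology n} {v : (B.obj (op U)).homology n}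
    (h : (u, v) ∈ cohomologyRelation i j U n) :
    ((HomologicalComplex.homologyMap (f'.app (op U)) n).hom u,
      (HomologicalComplex.homologyMap (g.app (op U)) n).hom v) ∈
        cohomologyRelation i₁ j₁ U n := by
  obtain ⟨a, k, ha, hk, h, e⟩ := h
  obtain ⟨rfl, rfl⟩ := Prod.mk.inj e
  have ha' : secD A₁ n (n + 1) U (secMap f' n U a) = 0 := by rw [secD_secMap, ha, map_zero]
  have hk' : secD B₁ n (n + 1) U (secMap g n U k) = 0 := by rw [secD_secMap, hk, map_zero]
  exact ⟨secMap f' n U a, secMap g n U k, ha', hk', h.map hf' hg, Prod.ext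
    (homologyMap_cohomologyClass (f'.app (op U)) a ha ha').symm
    (homologyMap_cohomologyClass (g.app (op U)) k hk hk').symm⟩

lemma homologyMap_mem_cohomologyRelation (i : F ⟶ A) (j : F ⟶ B)
    (u : (F.obj (op U)).homology n) :
    ((HomologicalComplex.homologyMap (i.app (op U)) n).hom u,
      (HomologicalComplex.homologyMap (j.app (op U)) n).hom u) ∈ cohomologyRelation i j U n := by
  obtain ⟨x, hx, rfl⟩ := cohomologyClass_surjective u
  have hx' : secD F n (n + 1) U x = 0 := hx
  have ha : secD A n (n + 1) U (secMap i n U x) = 0 := by rw [secD_secMap, hx', map_zero]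
  have hk : secD B n (n + 1) U (secMap j n U x) = 0 := by rw [secD_secMap, hx', map_zero]
  exact ⟨_, _, ha, hk, Related.of_section i j x hx, Prod.ext
    (homologyMap_cohomologyClass (i.app (op U)) x hx ha).symm
    (homologyMap_cohomologyClass (j.app (op U)) x hx hk).symm⟩

end Comparison

/-- The comparison of the two definitions of sheaf cohomology, given that bounded below complexes
of flabby sheaves are hypersheaves. -/
theorem exists_natural_comparison
    (hflabby : ∀ K : CochainComplex (TopCat.Sheaf (ModuleCat.{u} R) X) ℤ,
      IsBoundedBelowFlabby K → IsHypersheaf (toPshCh K)) :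
    ∃ e : ∀ (P : ResolutionPair X R) (n : ℤ), P.hypersheafCohomology n ≅ P.flabbyCohomology n,
      (∀ (P : ResolutionPair X R) (n : ℤ),
        globalCohomologyMap P.i n ≫ (e P n).hom = globalCohomologyMap P.j n) ∧
      (∀ (P Q : ResolutionPair X R) (f : P.F ⟶ Q.F) (f' : P.F' ⟶ Q.F')
        (g : toPshCh P.K ⟶ toPshCh Q.K), P.i ≫ f' = f ≫ Q.i → P.j ≫ g = f ≫ Q.j →
        ∀ n : ℤ, globalCohomologyMap f' n ≫ (e Q n).hom =
          (e P n).hom ≫ globalCohomologyMap g n) := by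
  choose e he using fun (P : ResolutionPair X R) (n : ℤ) => exists_comparison P.i_weakEquiv
    P.j_weakEquiv P.isHypersheaf (hflabby P.K P.isFlabby) ⊤ n
  refine ⟨e, fun P n => ?_, fun P Q f f' g hf' hg n => ?_⟩
  · ext u
    exact (he P n _ _).1 (homologyMap_mem_cohomologyRelation P.i P.j u)
  · ext u
    exact (he Q n _ _).1 (map_mem_cohomologyRelation hf' hg ((he P n u _).2 rfl))

/-! ### Contractions at a point of a hypercover -/

section Factor

open SimplexCategory

/-- The intersection of two faces of a simplex is a face of both. -/
lemma exists_eq_comp_δ {k : SimplexCategory} {n : ℕ} {u v : k ⟶ ⦋n + 1⦌} {i j : Fin (n + 2)}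
    (hij : i ≤ j) (h : u ≫ δ i.castSucc = v ≫ δ j.succ) :
    ∃ w : k ⟶ ⦋n⦌, w ≫ δ j = u ∧ w ≫ δ i = v := by
  obtain ⟨k⟩ := k
  have hu : ∀ a, u.toOrderHom a ≠ j := by
    intro a ha
    have h1 : j.succ = j.succ.succAbove (v.toOrderHom a) := by
      have h2 := congrArg (fun f => f.toOrderHom a) h
      change i.castSucc.succAbove (u.toOrderHom a) = j.succ.succAbove (v.toOrderHom a) at h2
      rw [← h2, ha, Fin.succAbove_castSucc_of_le i j hij]
    exact Fin.succAbove_ne _ _ h1.symm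
  have hw := factor_δ_spec u j hu
  refine ⟨factor_δ u j, hw, ?_⟩
  rw [← cancel_mono (δ j.succ), ← h, Category.assoc, δ_comp_δ hij, ← Category.assoc, hw]

end Factor

namespace OpenHypercover

variable {U : Opens X} (H : OpenHypercover X U)

lemma face_face {p : ℕ} {i j : Fin (p + 2)} (hij : i ≤ j) (σ : H.I.obj (op ⦋p + 2⦌)) :
    H.face i (H.face j.succ σ) = H.face j (H.face i.castSucc σ) := by
  rw [face, face, ← Functor.map_comp_apply, ← op_comp, SimplexCategory.δ_comp_δ hij, op_comp,
    Functor.map_comp_apply]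

lemma exists_vertex {x : X} (hx : x ∈ U) : ∃ v : H.I.obj (op ⦋0⦌), x ∈ H.V v := by
  have hs : ∀ {m : SimplexCategory} (s : m ⟶ ⦋0⦌), Function.Surjective s.toOrderHom :=
    fun s b => ⟨0, Subsingleton.elim (α := Fin 1) _ _⟩
  obtain ⟨v, hv, -⟩ := H.exists_filler (n := 0)
    ⟨fun s h => (h (hs s)).elim, fun _ s h => (h (hs s)).elim⟩ hx (fun s h => (h (hs s)).elim)
  exact ⟨v, hv⟩

/-- Simplices containing a point and with compatible faces are the faces of a simplex containing
this point. -/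
lemma exists_face_eq {x : X} (hx : x ∈ U) {n : ℕ} (y : Fin (n + 2) → H.I.obj (op ⦋n⦌))
    (hy : ∀ {m : SimplexCategory} (u v : m ⟶ ⦋n⦌) (i j : Fin (n + 2)), i < j →
      u ≫ SimplexCategory.δ i = v ≫ SimplexCategory.δ j →
      H.I.map u.op (y i) = H.I.map v.op (y j))
    (hxy : ∀ i, x ∈ H.V (y i)) :
    ∃ τ : H.I.obj (op ⦋n + 1⦌), x ∈ H.V τ ∧ ∀ i, H.face i τ = y i := by
  obtain ⟨b, hb⟩ := exists_boundaryFamily H.I y hy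
  have hb' : ∀ {m : SimplexCategory} (s : m ⟶ ⦋n + 1⦌) hs, x ∈ H.V (b.simplex s hs) := by
    intro m s hs
    obtain ⟨m⟩ := m
    obtain ⟨i, hi⟩ := not_forall.1 hs
    have hs' := SimplexCategory.factor_δ_spec s i fun a ha => hi ⟨a, ha⟩
    generalize SimplexCategory.factor_δ s i = u at hs'
    subst hs'
    rw [hb u i hs]
    exact H.V_le_map u _ (hxy i)
  obtain ⟨τ, hτ, hτ'⟩ := H.exists_filler b hx hb'
  refine ⟨τ, hτ, fun i => ?_⟩
  have h1 := hb (𝟙 _) i (by rw [Category.id_comp]; exact not_surjective_δ i)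
  have h2 := hτ' (𝟙 _ ≫ SimplexCategory.δ i)
    (by rw [Category.id_comp]; exact not_surjective_δ i)
  rw [h1] at h2
  simpa using h2

lemma exists_face_eq_of_face_eq {x : X} (hx : x ∈ U) {n : ℕ}
    (y : Fin (n + 3) → H.I.obj (op ⦋n + 1⦌))
    (hy : ∀ i j : Fin (n + 2), i ≤ j → H.face j (y i.castSucc) = H.face i (y j.succ))
    (hxy : ∀ i, x ∈ H.V (y i)) :
    ∃ τ : H.I.obj (op ⦋n + 2⦌), x ∈ H.V τ ∧ ∀ i, H.face i τ = y i := by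
  refine H.exists_face_eq hx y (fun {m} u v i j hij huv => ?_) hxy
  obtain ⟨i, rfl⟩ : ∃ i', i = Fin.castSucc i' := ⟨i.castPred (Fin.ne_last_of_lt hij), by simp⟩
  obtain ⟨j, rfl⟩ : ∃ j', j = Fin.succ j' := ⟨j.pred (Fin.ne_zero_of_lt hij), by simp⟩
  have hij' : i ≤ j := Fin.castSucc_lt_succ_iff.1 hij
  obtain ⟨w, rfl, rfl⟩ := exists_eq_comp_δ hij' huv
  rw [op_comp, op_comp, Functor.map_comp_apply, Functor.map_comp_apply]
  exact congrArg _ (hy i j hij')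

lemma exists_edge {x : X} (hx : x ∈ U) (y : Fin 2 → H.I.obj (op ⦋0⦌))
    (hxy : ∀ i, x ∈ H.V (y i)) :
    ∃ τ : H.I.obj (op ⦋1⦌), x ∈ H.V τ ∧ ∀ i, H.face i τ = y i := by
  refine H.exists_face_eq hx y (fun {m} u v i j hij huv => ?_) hxy
  have h1 : ∀ a b : Fin 1, i.succAbove a = j.succAbove b → False := by
    intro a b
    fin_cases i <;> fin_cases j <;> fin_cases a <;> fin_cases b <;> simp_all
  exact (h1 _ _ (congrArg (fun f => f.toOrderHom 0) huv)).elim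

/-- Joins of the `p`-simplices containing `x` with a vertex. The last condition says that the
faces not opposite to the vertex satisfy the relations needed to continue the construction in
dimension `p + 1`. -/
structure IsCone (x : X) (p : ℕ) (h : H.I.obj (op ⦋p⦌) → H.I.obj (op ⦋p + 1⦌)) : Prop where
  mem : ∀ σ, x ∈ H.V σ → x ∈ H.V (h σ)
  face_zero : ∀ σ, x ∈ H.V σ → H.face 0 (h σ) = σ
  face_succ_face : ∀ τ : H.I.obj (op ⦋p + 1⦌), x ∈ H.V τ → ∀ i j : Fin (p + 1), i ≤ j →
    H.face j.succ (h (H.face i.castSucc τ)) = H.face i.succ (h (H.face j.succ τ))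

variable {H}

lemma IsCone.exists_succ {x : X} (hx : x ∈ U) {p : ℕ}
    {h : H.I.obj (op ⦋p⦌) → H.I.obj (op ⦋p + 1⦌)} (hh : H.IsCone x p h) :
    ∃ h' : H.I.obj (op ⦋p + 1⦌) → H.I.obj (op ⦋p + 2⦌), H.IsCone x (p + 1) h' ∧
      ∀ τ, x ∈ H.V τ → ∀ i, H.face i.succ (h' τ) = h (H.face i τ) := by
  have key : ∀ τ : H.I.obj (op ⦋p + 1⦌), ∃ ρ : H.I.obj (op ⦋p + 2⦌), x ∈ H.V τ →
      x ∈ H.V ρ ∧ H.face 0 ρ = τ ∧ ∀ i, H.face i.succ ρ = h (H.face i τ) := by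
    intro τ
    by_cases hτ : x ∈ H.V τ
    swap
    · exact ⟨H.degen 0 τ, fun h => (hτ h).elim⟩
    have hf : ∀ i, x ∈ H.V (H.face i τ) := fun i => H.V_le_map _ τ hτ
    obtain ⟨ρ, h1, h2⟩ := H.exists_face_eq_of_face_eq hx (Fin.cons τ fun i => h (H.face i τ))
      (fun i j hij => by
        cases i using Fin.cases with
        | zero => simpa using (hh.face_zero _ (hf j)).symm
        | succ i =>
          cases j using Fin.cases with
          | zero => simp at hij
          | succ j =>
            rw [Fin.castSucc_succ, Fin.cons_succ, Fin.cons_succ]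
            exact hh.face_succ_face τ hτ i j (Fin.succ_le_succ_iff.1 hij))
      (fun i => by
        cases i using Fin.cases with
        | zero => simpa using hτ
        | succ i => simpa using hh.mem _ (hf i))
    exact ⟨ρ, fun _ => ⟨h1, h2 0, fun i => h2 i.succ⟩⟩
  choose h' hh' using key
  have hf : ∀ τ : H.I.obj (op ⦋p + 2⦌), x ∈ H.V τ → ∀ i, x ∈ H.V (H.face i τ) :=
    fun τ hτ i => H.V_le_map _ τ hτ
  refine ⟨h', ⟨fun σ hσ => (hh' σ hσ).1, fun σ hσ => (hh' σ hσ).2.1, fun τ hτ i j hij => ?_⟩,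
    fun τ hτ => (hh' τ hτ).2.2⟩
  rw [(hh' _ (hf τ hτ _)).2.2, (hh' _ (hf τ hτ _)).2.2, H.face_face hij]

variable (H)

lemma exists_isCone {x : X} (hx : x ∈ U) (p : ℕ) : ∃ h, H.IsCone x p h := by
  induction p with
  | zero =>
    obtain ⟨v, hv⟩ := H.exists_vertex hx
    have key : ∀ σ : H.I.obj (op ⦋0⦌), ∃ τ : H.I.obj (op ⦋1⦌), x ∈ H.V σ →
        x ∈ H.V τ ∧ H.face 0 τ = σ ∧ H.face 1 τ = v := by
      intro σ
      by_cases hσ : x ∈ H.V σ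
      swap
      · exact ⟨H.degen 0 σ, fun h => (hσ h).elim⟩
      obtain ⟨τ, h1, h2⟩ := H.exists_edge hx ![σ, v] (by simp [Fin.forall_fin_two, hσ, hv])
      exact ⟨τ, fun _ => ⟨h1, h2 0, h2 1⟩⟩
    choose h hh using key
    refine ⟨h, fun σ hσ => (hh σ hσ).1, fun σ hσ => (hh σ hσ).2.1, fun τ hτ i j _ => ?_⟩
    have hf : ∀ i, x ∈ H.V (H.face i τ) := fun i => H.V_le_map _ τ hτ
    obtain rfl : i = 0 := Subsingleton.elim (α := Fin 1) _ _
    obtain rfl : j = 0 := Subsingleton.elim (α := Fin 1) _ _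
    exact (hh _ (hf _)).2.2.trans (hh _ (hf _)).2.2.symm
  | succ p ih =>
    obtain ⟨h, hh⟩ := ih
    obtain ⟨h', hh', -⟩ := hh.exists_succ hx
    exact ⟨h', hh'⟩

/-! ### Rows of the double complex of a flabby sheaf -/

section Rows

variable (A : TopCat.Presheaf AddCommGrpCat.{u} X) {B : TopCat.Presheaf AddCommGrpCat.{u} X}

/-- The group `A(V_p) = ∏_{σ ∈ I_p} A(V σ)`. -/
abbrev Cochain (p : ℕ) : Type u := ∀ σ : H.I.obj (op ⦋p⦌), A.obj (op (H.V σ))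

/-- Restriction of sections, as a homomorphism. -/
abbrev resHom {V W : Opens X} (h : W ≤ V) : A.obj (op V) →+ A.obj (op W) :=
  (A.map (homOfLE h).op).hom

/-- The alternating sum of the coface maps. -/
def rowD (p : ℕ) : H.Cochain A p →+ H.Cochain A (p + 1) where
  toFun f σ := ∑ i : Fin (p + 2), (-1 : ℤ) ^ (i : ℕ) •
    resHom A (H.V_le_map (SimplexCategory.δ i) σ) (f (H.face i σ))
  map_zero' := by
    funext σ
    simp
  map_add' f g := by
    funext σ
    simp [Finset.sum_add_distrib]

variable {A} in
/-- The map `A(V_p) → B(V_p)` induced by a morphism of presheaves. -/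
def cochainMap (φ : A ⟶ B) (p : ℕ) : H.Cochain A p →+ H.Cochain B p where
  toFun f σ := (φ.app _).hom (f σ)
  map_zero' := by
    funext σ
    simp
  map_add' f g := by
    funext σ
    simp

variable {A}

lemma resHom_resHom {W V V' : Opens X} (h : W ≤ V) (h' : V ≤ V') (s : A.obj (op V')) :
    resHom A h (resHom A h' s) = resHom A (h.trans h') s :=
  (Functor.map_comp_apply A (homOfLE h').op (homOfLE h).op s).symm

lemma resHom_congr {p : SimplexCategory} (f : ∀ σ : H.I.obj (op p), A.obj (op (H.V σ)))
    {W : Opens X} {σ τ : H.I.obj (op p)} (h : σ = τ) (hσ : W ≤ H.V σ) (hτ : W ≤ H.V τ) :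
    resHom A hσ (f σ) = resHom A hτ (f τ) := by
  subst h
  rfl

variable {H}

lemma rowD_apply (p : ℕ) (f : H.Cochain A p) (σ : H.I.obj (op ⦋p + 1⦌)) :
    H.rowD A p f σ = ∑ i : Fin (p + 2), (-1 : ℤ) ^ (i : ℕ) •
      resHom A (H.V_le_map (SimplexCategory.δ i) σ) (f (H.face i σ)) := rfl

@[simp]
lemma cochainMap_apply (φ : A ⟶ B) (p : ℕ) (f : H.Cochain A p) (σ : H.I.obj (op ⦋p⦌)) :
    H.cochainMap φ p f σ = (φ.app _).hom (f σ) := rfl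

lemma resHom_app (φ : A ⟶ B) {V W : Opens X} (h : W ≤ V) (s : A.obj (op V)) :
    resHom B h ((φ.app _).hom s) = (φ.app _).hom (resHom A h s) :=
  (NatTrans.naturality_apply φ (homOfLE h).op s).symm

lemma rowD_cochainMap (φ : A ⟶ B) (p : ℕ) (f : H.Cochain A p) :
    H.rowD B p (H.cochainMap φ p f) = H.cochainMap φ (p + 1) (H.rowD A p f) := by
  funext σ
  rw [cochainMap_apply, rowD_apply, rowD_apply, map_sum]
  refine Finset.sum_congr rfl fun i _ => ?_
  rw [map_zsmul, cochainMap_apply, resHom_app]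

/-- The value of the iterated coboundary at `σ` is an iterated alternating sum over the faces of the
simplex `Δ^{p + 2}`. -/
lemma rowD_rowD (p : ℕ) (f : H.Cochain A p) : H.rowD A (p + 1) (H.rowD A p f) = 0 := by
  funext σ
  let g : ∀ p', (⦋p'⦌ ⟶ ⦋p + 2⦌) → A.obj (op (H.V σ)) := fun p' s =>
    resHom A (H.V_le_map s σ) (Pi.single (M := fun p => H.Cochain A p) p f p' (H.I.map s.op σ))
  refine Eq.trans ?_ (altFace_altFace g (p + 2) (𝟙 _))
  rw [rowD_apply]
  refine Finset.sum_congr rfl fun i _ => ?_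
  congr 1
  rw [rowD_apply, map_sum]
  refine Finset.sum_congr rfl fun j _ => ?_
  rw [map_zsmul, resHom_resHom]
  congr 1
  simp only [g, Pi.single_eq_same]
  refine H.resHom_congr f ?_ _ _
  rw [Category.comp_id, op_comp, Functor.map_comp_apply]

end Rows

end OpenHypercover

/-! ### The Godement sheaf of a sheaf of abelian groups -/

section Godement

/-- The presheaf `W ↦ ∏_{x ∈ W} T x`. -/
def functionPresheaf (T : X → AddCommGrpCat.{u}) : TopCat.Presheaf AddCommGrpCat.{u} X where
  obj W := AddCommGrpCat.of (∀ x : W.unop, T x)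
  map i := AddCommGrpCat.ofHom
    { toFun := fun s x => s ⟨x.1, i.unop.le x.2⟩
      map_zero' := rfl
      map_add' := fun _ _ => rfl }

/-- The value of a section of `functionPresheaf T` at a point. -/
def functionEval (T : X → AddCommGrpCat.{u}) {W : Opens X} {x : X} (hx : x ∈ W) :
    (functionPresheaf T).obj (op W) →+ T x where
  toFun s := (show ∀ x : W, T x from s) ⟨x, hx⟩
  map_zero' := rfl
  map_add' _ _ := rfl

lemma functionPresheaf_isSheaf (T : X → AddCommGrpCat.{u}) : (functionPresheaf T).IsSheaf :=
  (TopCat.Presheaf.isSheaf_iff_isSheaf_comp (forget AddCommGrpCat.{u}) _).2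
    (TopCat.Presheaf.toTypes_isSheaf X fun x => T x)

/-- The Godement sheaf `W ↦ ∏_{x ∈ W} A_x`. -/
def godement (A : TopCat.Sheaf AddCommGrpCat.{u} X) : TopCat.Sheaf AddCommGrpCat.{u} X :=
  ⟨functionPresheaf fun x => A.presheaf.stalk x, functionPresheaf_isSheaf _⟩

/-- The embedding of a sheaf into its Godement sheaf. -/
def toGodement (A : TopCat.Sheaf AddCommGrpCat.{u} X) : A ⟶ godement A :=
  ⟨{ app := fun W => AddCommGrpCat.ofHom
      { toFun := fun s x => A.presheaf.germ W.unop x.1 x.2 s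
        map_zero' := funext fun x => map_zero _
        map_add' := fun s t => funext fun x => map_add _ s t }
     naturality := fun W W' i => by
      ext s
      funext x
      exact A.presheaf.germ_res_apply i.unop x.1 x.2 s }⟩

lemma toGodement_injective (A : TopCat.Sheaf AddCommGrpCat.{u} X) (W : Opens X) :
    Function.Injective ((toGodement A).hom.app (op W)).hom := fun s t h =>
  TopCat.Presheaf.section_ext A W s t fun x hx => congrFun h ⟨x, hx⟩

instance (A : TopCat.Sheaf AddCommGrpCat.{u} X) : (godement A).IsFlasque where
  epi {V W} i := by
    classical
    refine (AddCommGrpCat.epi_iff_surjective _).2 fun s =>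
      ⟨fun x => if h : x.1 ∈ W.unop then s ⟨x.1, h⟩ else 0, ?_⟩
    funext x
    exact dif_pos x.2

instance (A : TopCat.Sheaf AddCommGrpCat.{u} X) : Mono (toGodement A) := by
  refine (TopCat.Sheaf.forget AddCommGrpCat X).mono_of_mono_map ?_
  have : ∀ W, Mono ((toGodement A).hom.app W) := fun W =>
    (AddCommGrpCat.mono_iff_injective _).2 (toGodement_injective A W.unop)
  exact NatTrans.mono_of_mono_app (toGodement A).hom

/-- A flabby sheaf `A` embeds into a sheaf of functions with flabby quotient `B`, and the sequence
`0 → A(W) → ∏_{x ∈ W} T x → B(W) → 0` is exact for all open `W`. -/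
lemma exists_embedding (A : TopCat.Sheaf AddCommGrpCat.{u} X) (hA : A.IsFlasque) :
    ∃ (T : X → AddCommGrpCat.{u}) (B : TopCat.Sheaf AddCommGrpCat.{u} X)
      (ι : A.obj ⟶ functionPresheaf T) (π : functionPresheaf T ⟶ B.obj), B.IsFlasque ∧
      (∀ W, Function.Injective (ι.app (op W)).hom) ∧
      (∀ W s, (π.app (op W)).hom ((ι.app (op W)).hom s) = 0) ∧
      (∀ W s, (π.app (op W)).hom s = 0 → ∃ t, (ι.app (op W)).hom t = s) ∧
      (∀ W, Function.Surjective (π.app (op W)).hom) := by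
  let S : ShortComplex (TopCat.Sheaf AddCommGrpCat.{u} X) :=
    ShortComplex.mk (toGodement A) (Limits.cokernel.π (toGodement A)) (Limits.cokernel.condition _)
  have hS : S.ShortExact :=
    { exact := ShortComplex.exact_cokernel _
      mono_f := inferInstanceAs (Mono (toGodement A))
      epi_g := inferInstanceAs (Epi (Limits.cokernel.π (toGodement A))) }
  have : S.X₁.IsFlasque := hA
  have : S.X₂.IsFlasque := inferInstanceAs (godement A).IsFlasque
  exact ⟨fun x => A.presheaf.stalk x, S.X₃, S.f.hom, S.g.hom,
    TopCat.Sheaf.IsFlasque.of_shortExact_of_isFlasque₁₂ hS, toGodement_injective A,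
    fun W s => ConcreteCategory.congr_hom
      (NatTrans.congr_app (congrArg (fun φ => φ.hom) S.zero) (op W)) s,
    fun W s h => TopCat.Sheaf.sections_exact_of_left_exact hS.exact hS.mono_f s h,
    fun W => (AddCommGrpCat.epi_iff_surjective _).1 (TopCat.Sheaf.IsFlasque.epi_of_shortExact hS)⟩

end Godement

namespace OpenHypercover

variable {U : Opens X} (H : OpenHypercover X U)

/-- The row of `functionPresheaf T` is exact, since it is a product of rows which are contractible
by the cones at the points of `U`. -/
lemma exists_rowD_functionPresheaf_eq (T : X → AddCommGrpCat.{u}) (p : ℕ)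
    (f : H.Cochain (functionPresheaf T) (p + 1)) (hf : H.rowD _ (p + 1) f = 0) :
    ∃ g, H.rowD _ p g = f := by
  have key : ∀ x : X, ∃ (h : H.I.obj (op ⦋p⦌) → H.I.obj (op ⦋p + 1⦌))
      (h' : H.I.obj (op ⦋p + 1⦌) → H.I.obj (op ⦋p + 2⦌)), x ∈ U → H.IsCone x p h ∧
        H.IsCone x (p + 1) h' ∧
        ∀ τ, x ∈ H.V τ → ∀ i, H.face i.succ (h' τ) = h (H.face i τ) := by
    intro x
    by_cases hx : x ∈ U
    · obtain ⟨h, hh⟩ := H.exists_isCone hx p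
      obtain ⟨h', hh'⟩ := hh.exists_succ hx
      exact ⟨h, h', fun _ => ⟨hh, hh'⟩⟩
    · exact ⟨H.degen 0, H.degen 0, fun h => (hx h).elim⟩
  choose h h' hh using key
  -- the value at `x` of the contracted cochain is its value at the join with the vertex for `x`
  let g : H.Cochain (functionPresheaf T) p := fun σ => (show ∀ x : H.V σ, T x from fun x =>
    functionEval T ((hh x.1 (H.V_le σ x.2)).1.mem σ x.2) (f (h x σ)))
  refine ⟨g, funext fun τ => funext fun y : H.V τ => ?_⟩
  obtain ⟨x, hx⟩ := y
  obtain ⟨h1, h2, h3⟩ := hh x (H.V_le τ hx)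
  have happ : ∀ (q : ℕ) (g : H.Cochain (functionPresheaf T) q) (ρ : H.I.obj (op ⦋q + 1⦌))
      (hρ : x ∈ H.V ρ), functionEval T hρ (H.rowD _ q g ρ) = ∑ i : Fin (q + 2),
        (-1 : ℤ) ^ (i : ℕ) • functionEval T (H.V_le_map _ ρ hρ) (g (H.face i ρ)) := by
    intro q g ρ hρ
    rw [rowD_apply, map_sum]
    exact Finset.sum_congr rfl fun i _ => map_zsmul _ _ _
  have hcongr : ∀ {σ σ' : H.I.obj (op ⦋p + 1⦌)} (hσ : σ = σ') (h1 : x ∈ H.V σ)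
      (h2 : x ∈ H.V σ'), functionEval T h1 (f σ) = functionEval T h2 (f σ') := by
    rintro σ _ rfl _ _
    rfl
  change functionEval T hx (H.rowD _ p g τ) = functionEval T hx (f τ)
  have e := congrArg (functionEval T (h2.mem τ hx)) (congrFun hf (h' x τ))
  rw [happ, Fin.sum_univ_succ, hcongr (h2.face_zero τ hx) _ hx, Pi.zero_apply, map_zero] at e
  simp only [Fin.val_zero, pow_zero, one_smul, Fin.val_succ, pow_succ, mul_neg, mul_one,
    neg_smul, Finset.sum_neg_distrib] at e
  rw [happ, add_neg_eq_zero.1 e]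
  exact Finset.sum_congr rfl fun i _ => by 
    rw [hcongr (h3 τ hx i) _ (h1.mem _ (H.V_le_map _ τ hx))]
    rfl

variable {H} in
/-- If `A` embeds into a sheaf of functions with quotient `B`, and the cocycles of degree `p` of `B`
lift to cocycles, then the cocycles of degree `p + 1` of `A` are coboundaries. -/
lemma exists_rowD_eq_of_embedding {T : X → AddCommGrpCat.{u}}
    {A B : TopCat.Presheaf AddCommGrpCat.{u} X} {ι : A ⟶ functionPresheaf T}
    {π : functionPresheaf T ⟶ B} (hι : ∀ W, Function.Injective (ι.app (op W)).hom)
    (hπι : ∀ W s, (π.app (op W)).hom ((ι.app (op W)).hom s) = 0)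
    (hex : ∀ W s, (π.app (op W)).hom s = 0 → ∃ t, (ι.app (op W)).hom t = s) {p : ℕ}
    (f : H.Cochain A (p + 1)) (hf : H.rowD _ (p + 1) f = 0)
    (hB : ∀ b : H.Cochain B p, H.rowD _ p b = 0 →
      ∃ g : H.Cochain (functionPresheaf T) p, H.rowD _ p g = 0 ∧ H.cochainMap π p g = b) :
    ∃ g, H.rowD _ p g = f := by
  obtain ⟨g, hg⟩ := H.exists_rowD_functionPresheaf_eq T p (H.cochainMap ι _ f)
    (by rw [rowD_cochainMap, hf, map_zero])
  obtain ⟨g₁, h1, h2⟩ := hB (H.cochainMap π p g) (by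
    rw [rowD_cochainMap, hg]
    exact funext fun σ => hπι _ _)
  choose g' hg' using fun σ => hex (H.V σ) ((g - g₁) σ) (by
    rw [← cochainMap_apply, map_sub, h2, sub_self]
    rfl)
  have e : H.cochainMap ι _ g' = g - g₁ := funext hg'
  refine ⟨g', funext fun σ => hι _ ?_⟩
  rw [← cochainMap_apply, ← cochainMap_apply, ← rowD_cochainMap, e, map_sub, h1, sub_zero, hg]

/-- A section over `U` vanishing on the open subsets of degree `0` vanishes, since they cover
`U`. -/
lemma eq_zero_of_resHom_eq_zero (A : TopCat.Sheaf AddCommGrpCat.{u} X) (s : A.obj.obj (op U))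
    (hs : ∀ σ : H.I.obj (op ⦋0⦌), resHom A.obj (H.V_le σ) s = 0) : s = 0 := by
  refine A.eq_of_locally_eq' (fun σ : H.I.obj (op ⦋0⦌) => H.V σ) U (fun σ => homOfLE (H.V_le σ))
    (fun x hx => ?_) s 0 fun σ => ?_
  · obtain ⟨v, hv⟩ := H.exists_vertex hx
    exact Opens.mem_iSup.2 ⟨v, hv⟩
  · exact (hs σ).trans (map_zero (resHom A.obj (H.V_le σ))).symm

/-- A cocycle of degree `0` with values in a sheaf comes from a section: it is compatible, since
`V σ ⊓ V σ'` is covered by the `V τ` for the edges `τ` between `σ` and `σ'`. -/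
lemma exists_resHom_eq (A : TopCat.Sheaf AddCommGrpCat.{u} X) (f : H.Cochain A.obj 0)
    (hf : H.rowD A.obj 0 f = 0) :
    ∃ s : A.obj.obj (op U), ∀ σ, resHom A.obj (H.V_le σ) s = f σ := by
  obtain ⟨s, hs, -⟩ := A.existsUnique_gluing' (fun σ : H.I.obj (op ⦋0⦌) => H.V σ) U
    (fun σ => homOfLE (H.V_le σ))
    (fun x hx => by
      obtain ⟨v, hv⟩ := H.exists_vertex hx
      exact Opens.mem_iSup.2 ⟨v, hv⟩) f
    (fun σ σ' => by
      refine A.eq_of_locally_eq' (fun τ : {τ : H.I.obj (op ⦋1⦌) //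
          H.face 0 τ = σ ∧ H.face 1 τ = σ'} => H.V τ.1) _
        (fun τ => homOfLE (le_inf ((H.V_le_map (SimplexCategory.δ 0) τ.1).trans
          (congrArg H.V τ.2.1).le) ((H.V_le_map (SimplexCategory.δ 1) τ.1).trans
          (congrArg H.V τ.2.2).le)))
        (fun x hx => ?_) _ _ fun ⟨τ, h0, h1⟩ => ?_
      · obtain ⟨τ, h1, h2⟩ := H.exists_edge (H.V_le σ hx.1) ![σ, σ']
          (Fin.forall_fin_two.2 ⟨hx.1, hx.2⟩)
        exact Opens.mem_iSup.2 ⟨⟨τ, h2 0, h2 1⟩, h1⟩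
      · subst h0 h1
        have e := congrFun hf τ
        rw [rowD_apply, Fin.sum_univ_two] at e
        simp only [Fin.val_zero, pow_zero, one_smul, Fin.val_one, pow_one, neg_smul] at e
        exact (resHom_resHom _ _ _).trans ((add_neg_eq_zero.1 e).trans
          (resHom_resHom _ _ _).symm))
  exact ⟨s, hs⟩

/-- The rows of a flabby sheaf are exact. By induction on the degree: a cocycle of degree `p + 1`
with values in a flabby sheaf `A` is the coboundary of a cochain with values in a sheaf of
functions. The image of this cochain in the quotient by `A`, which is flabby, is a cocycle of
degree `p`, so it can be made zero by subtracting a cocycle. -/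
lemma exists_rowD_eq (A : TopCat.Sheaf AddCommGrpCat.{u} X) (hA : A.IsFlasque) (p : ℕ)
    (f : H.Cochain A.obj (p + 1)) (hf : H.rowD _ (p + 1) f = 0) : ∃ g, H.rowD _ p g = f := by
  induction p generalizing A with
  | zero =>
    obtain ⟨T, B, ι, π, hB, hι, hπι, hex, hπ⟩ := exists_embedding A hA
    refine exists_rowD_eq_of_embedding hι hπι hex f hf fun b hb => ?_
    obtain ⟨b, hb⟩ := H.exists_resHom_eq B b hb
    obtain ⟨s, rfl⟩ := hπ U b
    refine ⟨fun σ => resHom _ (H.V_le σ) s, funext fun τ => ?_, funext fun σ => ?_⟩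
    · rw [rowD_apply, Fin.sum_univ_two]
      simp only [resHom_resHom, Fin.val_zero, pow_zero, one_smul, Fin.val_one, pow_one, neg_smul]
      exact add_neg_cancel _
    · rw [cochainMap_apply, ← resHom_app]
      exact hb σ
  | succ p ih =>
    obtain ⟨T, B, ι, π, hB, hι, hπι, hex, hπ⟩ := exists_embedding A hA
    refine exists_rowD_eq_of_embedding hι hπι hex f hf fun b hb => ?_
    obtain ⟨b, rfl⟩ := ih B hB b hb
    choose g hg using fun σ => hπ (H.V σ) (b σ)
    obtain rfl : H.cochainMap π _ g = b := funext hg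
    exact ⟨H.rowD _ p g, rowD_rowD p g, (rowD_cochainMap π p g).symm⟩

end OpenHypercover

/-! ### Bounded below complexes of flabby sheaves -/

namespace OpenHypercover

variable {U : Opens X} (H : OpenHypercover X U) (F : PshCh X R)

/-- The rows of the double complex `F^q(V_p)` augmented by `F^q(U)` are exact: at
`F^q(U)`, at `F^q(V_0)` and at `F^q(V_{p + 1})`. -/
structure HasExactRows : Prop where
  eq_zero : ∀ {q : ℤ} (s : Sec F q U), (∀ σ : H.I.obj (op ⦋0⦌), res F (H.V_le σ) s = 0) → s = 0
  exists_res_eq : ∀ {q : ℤ} (f : ∀ σ : H.I.obj (op ⦋0⦌), Sec F q (H.V σ)),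
    (∀ τ : H.I.obj (op ⦋1⦌), ∑ i : Fin 2, (-1 : ℤ) ^ (i : ℕ) •
      res F (H.V_le_map (SimplexCategory.δ i) τ) (f (H.face i τ)) = 0) →
    ∃ s : Sec F q U, ∀ σ, res F (H.V_le σ) s = f σ
  exists_altSum_eq : ∀ {p : ℕ} {q : ℤ} (f : ∀ σ : H.I.obj (op ⦋p + 1⦌), Sec F q (H.V σ)),
    (∀ τ : H.I.obj (op ⦋p + 2⦌), ∑ i : Fin (p + 3), (-1 : ℤ) ^ (i : ℕ) •
      res F (H.V_le_map (SimplexCategory.δ i) τ) (f (H.face i τ)) = 0) →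
    ∃ g : ∀ σ : H.I.obj (op ⦋p⦌), Sec F q (H.V σ), ∀ τ : H.I.obj (op ⦋p + 1⦌),
      ∑ i : Fin (p + 2), (-1 : ℤ) ^ (i : ℕ) •
        res F (H.V_le_map (SimplexCategory.δ i) τ) (g (H.face i τ)) = f τ

variable {H F}

lemma HasExactRows.totAug_injective (hF : H.HasExactRows F) (n : ℤ) :
    Function.Injective (H.totAug F n) := by
  refine (injective_iff_map_eq_zero _).2 fun s hs => hF.eq_zero s fun σ => ?_
  rw [← totApp_totAug_zero s (by simp) σ, hs, totApp_zero]

/-- A total cochain which is bounded in the horizontal direction, and whose coboundary vanishes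
outside column `0`, comes from a section over `U`, up to a coboundary. The component in the last
column is a cocycle of its row, so it can be removed by subtracting a coboundary. -/
lemma HasExactRows.exists_totAug_add_totD_eq (hF : H.HasExactRows F) {m : ℤ} (P : ℕ)
    (y : H.Tot F (m + 1)) (hP : ∀ p q h σ, P < p → totApp y p q h σ = 0)
    (hy : ∀ p q h σ, totApp (H.totD F (m + 1) y) (p + 1) q h σ = 0) :
    ∃ (s : Sec F (m + 1) U) (v : H.Tot F m), H.totAug F (m + 1) s + H.totD F m v = y := by
  have hrow : ∀ (P : ℕ) (y : H.Tot F (m + 1)), (∀ p q h σ, P < p → totApp y p q h σ = 0) →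
      (∀ p q h σ, totApp (H.totD F (m + 1) y) (p + 1) q h σ = 0) →
      ∀ (q : ℤ) (h : P + q = m + 1) (τ : H.I.obj (op ⦋P + 1⦌)),
      ∑ i : Fin (P + 2), (-1 : ℤ) ^ (i : ℕ) •
        res F (H.V_le_map (SimplexCategory.δ i) τ) (totApp y P q h (H.face i τ)) = 0 := by
    intro P y hP hy q h τ
    have e := hy P q (by push_cast; omega) τ
    rwa [totApp_totD_succ y P (q' := q - 1) (by omega) _ (by push_cast; omega) h,
      hP _ _ _ _ (by omega), map_zero, smul_zero, add_zero] at e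
  induction P generalizing y with
  | zero =>
    obtain ⟨s, hs⟩ := hF.exists_res_eq (fun σ => totApp y 0 (m + 1) (by simp) σ)
      (hrow 0 y hP hy (m + 1) (by simp))
    refine ⟨s, 0, ?_⟩
    rw [map_zero, add_zero]
    refine tot_ext fun p q h σ => ?_
    rcases p with _ | p
    · obtain rfl : q = m + 1 := by simpa using h
      rw [totApp_totAug_zero, hs]
    · rw [totApp_totAug_succ, hP _ _ _ _ (by omega)]
  | succ P ih =>
    have key : ∀ (p : ℕ) (q : ℤ) (h : p + q = m), ∃ g : ∀ σ : H.I.obj (op ⦋p⦌), Sec F q (H.V σ),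
        (p = P → ∀ τ : H.I.obj (op ⦋p + 1⦌), ∑ i : Fin (p + 2), (-1 : ℤ) ^ (i : ℕ) •
          res F (H.V_le_map (SimplexCategory.δ i) τ) (g (H.face i τ)) =
            totApp y (p + 1) q (by push_cast; omega) τ) ∧ (p ≠ P → g = 0) := by
      intro p q h
      by_cases hp : p = P
      · subst hp
        obtain ⟨g, hg⟩ := hF.exists_altSum_eq
          (fun σ => totApp y (p + 1) q (by push_cast; omega) σ)
          (hrow (p + 1) y hP hy q (by push_cast; omega))
        exact ⟨g, fun _ => hg, fun h => (h rfl).elim⟩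
      · exact ⟨0, fun h => (hp h).elim, fun _ => rfl⟩
    choose g hg hg' using key
    let w : H.Tot F m := totMk g
    have hw : ∀ p q h σ, P < p → totApp w p q h σ = 0 := fun p q h σ hp =>
      congrFun (hg' p q h (by omega)) σ
    obtain ⟨s, v, hsv⟩ := ih (y - H.totD F m w)
      (fun p q h σ hp => by
        obtain ⟨p, rfl⟩ : ∃ p', p = p' + 1 := ⟨p - 1, by omega⟩
        rw [totApp_sub, totApp_totD_succ w p (q' := q - 1) (by omega) _ (by omega)
          (by push_cast at h; omega), hw (p + 1) _ _ _ hp, map_zero, smul_zero, add_zero,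
          sub_eq_zero]
        rcases (Nat.lt_succ_iff.1 hp).eq_or_lt with hp' | hp'
        · exact (hg p q _ hp'.symm σ).symm
        · rw [hP _ _ _ _ (by omega)]
          refine (Finset.sum_eq_zero fun i _ => ?_).symm
          rw [hw _ _ _ _ hp', map_zero, smul_zero])
      (fun p q h σ => by rw [map_sub, totD_totD, sub_zero, hy])
    refine ⟨s, v + w, ?_⟩
    rw [map_add, ← add_assoc, hsv, sub_add_cancel]

/-- The map from the sections over `U` to the total complex is a quasi-isomorphism if the rows are
exact and the complex is bounded below. -/
lemma HasExactRows.quasiIso_toHolim (hF : H.HasExactRows F) {N : ℤ}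
    (hN : ∀ q < N, ∀ (W : Opens X) (s : Sec F q W), s = 0) : QuasiIso (H.toHolim F) := by
  have key : ∀ {m : ℤ} (y : H.Tot F (m + 1)),
      (∀ p q h σ, totApp (H.totD F (m + 1) y) (p + 1) q h σ = 0) →
      ∃ (s : Sec F (m + 1) U) (v : H.Tot F m), H.totAug F (m + 1) s + H.totD F m v = y :=
    fun {m} y hy => hF.exists_totAug_add_totD_eq (m + 1 - N).toNat y
      (fun p q h σ hp => hN q (by omega) _ _) hy
  refine (H.quasiIso_toHolim_iff F).2 fun m => ⟨fun x hx ⟨w, hw⟩ => ?_, fun y hy => ?_⟩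
  · obtain ⟨m, rfl⟩ : ∃ m', m = m' + 1 := ⟨m - 1, by omega⟩
    obtain ⟨s, v, rfl⟩ := key w fun p q h σ => by rw [hw, totApp_totAug_succ]
    refine ⟨s, hF.totAug_injective _ ?_⟩
    rw [← hw, map_add, totD_totD, add_zero, totD_totAug]
  · obtain ⟨s, v, rfl⟩ := key y fun p q h σ => by rw [hy, totApp_zero]
    refine ⟨s, hF.totAug_injective _ ?_, -v, ?_⟩
    · rw [map_add, totD_totD, add_zero, totD_totAug] at hy
      rw [hy, map_zero]
    · rw [map_neg, sub_add_cancel_left]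

/-- The sheaf of abelian groups underlying a sheaf of modules. -/
abbrev underlyingAddCommGrp (A : TopCat.Sheaf (ModuleCat.{u} R) X) :
    TopCat.Sheaf AddCommGrpCat.{u} X :=
  (sheafCompose (Opens.grothendieckTopology X) (forget₂ (ModuleCat.{u} R) AddCommGrpCat.{u})).obj A

variable (H) in
lemma hasExactRows_of_isFlasque (K : CochainComplex (TopCat.Sheaf (ModuleCat.{u} R) X) ℤ)
    (hK : ∀ q, (K.X q).IsFlasque) : H.HasExactRows (toPshCh K) := by
  let A := fun q => underlyingAddCommGrp (K.X q)
  have hA : ∀ q, (A q).IsFlasque := fun q =>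
    ⟨fun i => (AddCommGrpCat.epi_iff_surjective _).2
      ((ModuleCat.epi_iff_surjective _).1 ((hK q).epi i))⟩
  exact
    { eq_zero := fun {q} s hs => H.eq_zero_of_resHom_eq_zero (A q) s hs
      exists_res_eq := fun {q} f hf => H.exists_resHom_eq (A q) f (funext hf)
      exists_altSum_eq := fun {p q} f hf =>
        (H.exists_rowD_eq (A q) (hA q) p f (funext hf)).imp fun g hg => congrFun hg }

end OpenHypercover

/-- A bounded below complex of flabby sheaves is a hypersheaf. -/
theorem IsBoundedBelowFlabby.isHypersheaf
    {K : CochainComplex (TopCat.Sheaf (ModuleCat.{u} R) X) ℤ} (hK : IsBoundedBelowFlabby K) :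
    IsHypersheaf (toPshCh K) := by
  intro U H
  obtain ⟨N, hN⟩ := hK.boundedBelow
  refine (H.hasExactRows_of_isFlasque K hK.flabby).quasiIso_toHolim (N := N) fun q hq W s => ?_
  have h : Limits.IsZero (K.X q) := K.isZero_of_isStrictlyGE N q hq
  have h' : (𝟙 (K.X q)) = 0 := h.eq_of_src _ _
  exact ConcreteCategory.congr_hom
    (NatTrans.congr_app (congrArg (fun φ => φ.hom) h') (op W)) s

end

end Hypersheaf

theorem mainTheorem3 (X : TopCat.{u}) (R : Type u) [CommRing R] :
    (∀ K : CochainComplex (TopCat.Sheaf (ModuleCat.{u} R) X) ℤ,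
      IsBoundedBelowFlabby K → IsHypersheaf (toPshCh K)) ∧
    (∃ e : ∀ (P : ResolutionPair X R) (n : ℤ), P.hypersheafCohomology n ≅ P.flabbyCohomology n,
      (∀ (P : ResolutionPair X R) (n : ℤ),
        globalCohomologyMap P.i n ≫ (e P n).hom = globalCohomologyMap P.j n) ∧
      (∀ (P Q : ResolutionPair X R) (f : P.F ⟶ Q.F) (f' : P.F' ⟶ Q.F')
        (g : toPshCh P.K ⟶ toPshCh Q.K), P.i ≫ f' = f ≫ Q.i → P.j ≫ g = f ≫ Q.j →
        ∀ n : ℤ, globalCohomologyMap f' n ≫ (e Q n).hom =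
          (e P n).hom ≫ globalCohomologyMap g n)) := by
  have hflabby : ∀ K : CochainComplex (TopCat.Sheaf (ModuleCat.{u} R) X) ℤ,
      IsBoundedBelowFlabby K → IsHypersheaf (toPshCh K) := fun K hK => hK.isHypersheaf
  exact ⟨hflabby, exists_natural_comparison hflabby⟩
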